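/- **Setting.** Let $d\ge 1$, let $\mathcal T_h$ be a conforming simplicial triangulation of a bounded polyhedral open set $\Omega\subset\mathbb R^d$ ($\Omega$ being the interior of the union of the closed elements), let $\mathcal E_i$ be the set of interior faces (shared by two elements), and let the boundary faces be split into Dirichlet faces (union $\partial\Omega_D$) and Neumann faces (union $\partial\Omega_N$). Let $\kappa>0$ be constant on each element, $f\in L^2(\Omega)$, $g_D\in L^2(\partial\Omega_D)$, $g_N\in L^2(\partial\Omega_N)$, $C_{11}\in\mathbb R$, $p\ge1$, and $$V_h=\{v: v|_K\in\mathcal P_p(K)\ \forall K\},\qquad \Sigma_h=\{\tau:\tau|_K\in[\mathcal P_p(K)]^d\ \forall K\}.$$ On an interior face $e=\partial K^+\cap\partial K^-$ with unit normals $n^\pm$ outward to $K^\pm$ put $\{t\}=\frac12(t^++t^-)$, $[v]=v^+n^++v^-n^-$, $[\tau]=\tau^+\cdot n^++\tau^-\cdot n^-$ and $C_{12}=\frac12(S^+n^++S^-n^-)$, with switches $S^\pm\in\{0,1\}$, $S^++S^-=1$. On boundary faces $n$ is the outward unit normal. $\nabla_h$ is the elementwise gradient. The face-wise liftings with values in $\Sigma_h$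 are defined by $$\int_\Omega r^e(\phi)\cdot\tau=-\int_e\phi\cdot\{\tau\},\quad \int_\Omega l^e(q)\cdot\tau=-\int_e q[\tau]\quad(e\in\mathcal E_i),\qquad \int_\Omega r^e_D(q)\cdot\tau=-\int_e q\,\tau\cdot n\quad(e\subset\partial\Omega_D)$$ for all $\tau\in\Sigma_h$, with $r^e=l^e=0$ for $e\notin\mathcal E_i$ and $r_D^e=0$ for $e\not\subset\partial\Omega_D$. The global liftings $r,l,r_D$ are defined in the same way with the integrals taken over all of $\mathcal E_i$, respectively $\partial\Omega_D$. **CDG scheme.** Find $u_h\in V_h$, $\sigma_h\in\Sigma_h$ such that for all $K\in\mathcal T_h$ $$\int_K\sigma_h\cdot\tau=-\int_K u_h\nabla\cdot(\kappa\tau)+\int_{\partial K}\hat u\,\kappa\tau\cdot n\quad\forall\tau\in[\mathcal P_p(K)]^d,$$ $$\int_K\sigma_h\cdot\nabla v=\int_K fv+\int_{\partial K}\hat\sigma\cdot n\,v\quad\forall v\in\mathcal P_p(K),$$ where, with $\sigma_h^e=\kappa\nabla_hu_h+\kappa r^e([u_h])+\kappa l^e(C_{12}\cdot[u_h])-\kappa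 r^e_D(g_D-u_h)$, - on $e\in\mathcal E_i$: $\hat\sigma=\{\sigma_h^e\}-C_{11}[u_h]+C_{12}[\sigma_h^e]$, $\ \hat u=\{u_h\}-C_{12}\cdot[u_h]$; - on $e\subset\partial\Omega_D$: $\hat\sigma=\sigma_h^e-C_{11}(u_h-g_D)n$, $\ \hat u=g_D$; - on $e\subset\partial\Omega_N$: $\hat\sigma=g_Nn$, $\ \hat u=u_h$. **Forms.** Put $R^e(u)=r^e([u])+l^e(C_{12}\cdot[u])+r_D^e(u)$ and $$\begin{aligned}B_h^{CDG}(u,v)=&\int_\Omega\nabla_hv\cdot\kappa\nabla_hu-\int_{\mathcal E_i}\big([u]\cdot\{\kappa\nabla_hv\}+\{\kappa\nabla_hu\}\cdot[v]\big)-\int_{\mathcal E_i}\big(C_{12}\cdot[u]\,[\kappa\nabla_hv]+[\kappa\nabla_hu]\,C_{12}\cdot[v]\big)\\&+\sum_{e\in\mathcal E_i\cup\partial\Omega_D}\int_\Omega\kappa R^e(u)\cdot R^e(v)-\int_{\partial\Omega_D}\big(\kappa\nabla_hu\cdot n\,v+u\,\kappa\nabla_hv\cdot n\big)+\int_{\mathcal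 E_i}C_{11}[u]\cdot[v]+\int_{\partial\Omega_D}C_{11}uv,\end{aligned}$$ $$L_h^{CDG}(v)=\int_\Omega fv-\int_{\partial\Omega_D}g_D\,\kappa\nabla_hv\cdot n-\sum_{e\subset\partial\Omega_D}\int_e\kappa v\,r_D^e(g_D)\cdot n+\int_{\partial\Omega_D}C_{11}g_Dv+\int_{\partial\Omega_N}vg_N.$$ $B_h^{LDG}$ is given by the same formula as $B_h^{CDG}$ with the sum over $e$ replaced by $\int_\Omega\kappa R(u)\cdot R(v)$, where $R(u)=r([u])+l(C_{12}\cdot[u])+r_D(u)$, and $$L_h^{LDG}(v)=\int_\Omega fv-\int_{\partial\Omega_D}g_D\,\kappa\big(\nabla_hv+r([v])+l(C_{12}\cdot[v])\big)\cdot n-\int_{\partial\Omega_D}\kappa v\,r_D(g_D)\cdot n+\int_{\partial\Omega_D}C_{11}g_Dv+\int_{\partial\Omega_N}vg_N.$$ The forms are also used, by the same formulas with Sobolev traces, on the broken space $H^2(\mathcal T_h)=\{v: v|_K\in H^2(K)\ \forall K\}\supset V_h$. **Theorem.** 1. The liftings $r^e,l^e,r_D^e$ are well defined on $L^2(e)$: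 the element of $\Sigma_h$ exists and is unique. 2. For $u_h\in V_h$ the field $\kappa\nabla_hu_h+\kappa r([u_h])+\kappa l(C_{12}\cdot[u_h])-\kappa r_D(g_D-u_h)$ belongs to $\Sigma_h$, and $(u_h,\sigma_h)\in V_h\times\Sigma_h$ solves the CDG scheme if and only if $\sigma_h$ equals this field and $B_h^{CDG}(u_h,v)=L_h^{CDG}(v)$ for all $v\in V_h$. In particular, $u_h\in V_h$ is the first component of a solution of the CDG scheme if and only if $B_h^{CDG}(u_h,v)=L_h^{CDG}(v)$ for all $v\in V_h$. 3. On $V_h$, $B_h^{CDG}$ is bilinear and $L_h^{CDG}$ is linear; $B_h^{CDG}$ is symmetric, $B_h^{CDG}(u,v)=B_h^{CDG}(v,u)$. 4. (Consistency.) If $u\in H^1(\Omega)\cap H^2(\mathcal T_h)$ solves $-\nabla\cdot(\kappa\nabla u)=f$ in $\Omega$ (in the sense of distributions), $u=g_D$ on $\partial\Omega_D$, $\kappa\,\partial u/\partial n=g_N$ on $\partial\Omega_N$, then $B_h^{CDG}(u,v)=L_h^{CDG}(v)$ for all $v\in H^2(\mathcal T_h)$, in particular for all $v\in V_h$. 5.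 (Adjoint consistency.) If $g\in L^2(\Omega)$ and $\psi\in H^1(\Omega)\cap H^2(\mathcal T_h)$ solves $-\nabla\cdot(\kappa\nabla\psi)=g$ in $\Omega$, $\psi=0$ on $\partial\Omega_D$, $\kappa\,\partial\psi/\partial n=0$ on $\partial\Omega_N$, then $B_h^{CDG}(v,\psi)=\int_\Omega gv$ for all $v\in H^2(\mathcal T_h)$, in particular for all $v\in V_h$. 6. (Comparison with LDG.) For all $u,v\in H^2(\mathcal T_h)$, $$B_h^{LDG}(u,v)=B_h^{CDG}(u,v)+\sum_{e\ne e'}\int_\Omega\kappa R^e(u)\cdot R^{e'}(v),\qquad L_h^{LDG}(v)=L_h^{CDG}(v)+\sum_{e\subset\partial\Omega_D}\sum_{e'\neq e}\int_\Omega\kappa\, r_D^e(g_D)\cdot R^{e'}(v),$$ where $e$ in the first sum and $e'$ in both run over $\mathcal E_i\cup\partial\Omega_D$; that is, CDG is obtained from LDG by dropping the off-diagonal products of liftings. -/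

import Mathlib

open MeasureTheory Filter Topology
open scoped ContDiff RealInnerProductSpace

noncomputable section

namespace CDG

/-- Euclidean space `ℝ^d`. -/
abbrev Pt (d : ℕ) := EuclideanSpace ℝ (Fin d)

/-- The polynomial functions `ℝ^d → ℝ` of total degree at most `p`. -/
def polySpace (d p : ℕ) : Submodule ℝ (Pt d → ℝ) :=
  (MvPolynomial.restrictTotalDegree (Fin d) ℝ p).map
    (LinearMap.pi fun x : Pt d => (MvPolynomial.aeval (R := ℝ) fun i => x i).toLinearMap)

/-- The vector fields all of whose components lie in `polySpace d p`. -/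
def polyFieldSpace (d p : ℕ) : Submodule ℝ (Pt d → Pt d) where
  carrier := {τ | ∀ i, (fun x => τ x i) ∈ polySpace d p}
  add_mem' := fun ha hb i => (polySpace d p).add_mem (ha i) (hb i)
  zero_mem' := fun _ => (polySpace d p).zero_mem
  smul_mem' := fun c _ ha i => (polySpace d p).smul_mem c (ha i)

/-- The (pointwise, classical) divergence of a vector field. -/
def divergence {d : ℕ} (τ : Pt d → Pt d) (x : Pt d) : ℝ :=
  ∑ i, fderiv ℝ (fun y => τ y i) x (EuclideanSpace.single i 1)

/-- The closed simplex (or face of a simplex) spanned by a finite set of points. -/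
def hull {d : ℕ} (s : Finset (Pt d)) : Set (Pt d) := convexHull ℝ (s : Set (Pt d))

/-- The `(d-1)`-dimensional surface measure on the face spanned by `e`. -/
def faceMeasure {d : ℕ} (e : Finset (Pt d)) : Measure (Pt d) :=
  (Measure.euclideanHausdorffMeasure (d - 1)).restrict (hull e)

/-- The unit normal to the face `e` of the simplex `K`, pointing out of `K`: the normalised
component orthogonal to `e` of the vector from the barycentre of `K` to that of `e`. -/
def outwardNormal {d : ℕ} (K e : Finset (Pt d)) : Pt d :=
  let w := ((vectorSpan ℝ (e : Set (Pt d)))ᗮ).starProjection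
    ((e.card : ℝ)⁻¹ • (∑ x ∈ e, x) - (K.card : ℝ)⁻¹ • (∑ x ∈ K, x))
  ‖w‖⁻¹ • w

/-- `v ∈ H¹(K)` for the simplex `K`, with weak gradient `G` and with trace `γ` on `∂K`.  The trace
is the continuous extension of the restriction map: `γ` is the `L²(∂K)`-limit of the restrictions
to `∂K` of smooth functions that converge to `v` in `H¹(K)`. -/
def HasH1Trace {d : ℕ} (K : Finset (Pt d)) (v : Pt d → ℝ) (G : Pt d → Pt d) (γ : Pt d → ℝ) :
    Prop :=
  MemLp v 2 (volume.restrict (hull K)) ∧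
  MemLp G 2 (volume.restrict (hull K)) ∧
  (∀ φ : Pt d → ℝ, ContDiff ℝ ∞ φ → HasCompactSupport φ → tsupport φ ⊆ interior (hull K) →
    ∀ i, ∫ x in hull K, v x * gradient φ x i = -∫ x in hull K, G x i * φ x) ∧
  (∀ e ∈ K.powersetCard d, MemLp γ 2 (faceMeasure e)) ∧
  ∃ φ : ℕ → Pt d → ℝ, (∀ n, ContDiff ℝ ∞ (φ n)) ∧
    Tendsto (fun n => eLpNorm (φ n - v) 2 (volume.restrict (hull K))) atTop (𝓝 0) ∧
    Tendsto (fun n => eLpNorm (gradient (φ n) - G) 2 (volume.restrict (hull K))) atTop (𝓝 0) ∧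
    ∀ e ∈ K.powersetCard d,
      Tendsto (fun n => eLpNorm (φ n - γ) 2 (faceMeasure e)) atTop (𝓝 0)

/-- A conforming simplicial triangulation in `ℝ^d`; each element is given by its `d + 1`
vertices, and two elements meet exactly in the simplex spanned by their common vertices. -/
structure Triangulation (d : ℕ) where
  cells : Finset (Finset (Pt d))
  card_cell : ∀ K ∈ cells, K.card = d + 1
  indep : ∀ K ∈ cells, AffineIndependent ℝ ((↑) : K → Pt d)
  inter_hull : ∀ K ∈ cells, ∀ K' ∈ cells,
    hull K ∩ hull K' = convexHull ℝ ((K : Set (Pt d)) ∩ (K' : Set (Pt d)))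

namespace Triangulation

variable {d : ℕ} (M : Triangulation d)

/-- The elements of the triangulation. -/
abbrev Cell := {K : Finset (Pt d) // K ∈ M.cells}

/-- The triangulated domain `Ω`. -/
def domain : Set (Pt d) := interior (⋃ K : M.Cell, hull K.1)

open Classical in
/-- All `(d-1)`-dimensional faces of elements. -/
def faces : Finset (Finset (Pt d)) := M.cells.biUnion fun K => K.powersetCard d

open Classical in
/-- The elements having `e` as a face. -/
def neighbours (e : Finset (Pt d)) : Finset M.Cell := Finset.univ.filter fun K => e ⊆ K.1

/-- The interior faces: those shared by two elements. -/
def interiorFaces : Finset (Finset (Pt d)) := M.faces.filter fun e => (M.neighbours e).card = 2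

/-- The boundary faces: those belonging to one element only. -/
def boundaryFaces : Finset (Finset (Pt d)) := M.faces.filter fun e => (M.neighbours e).card = 1

/-- `∫_Ω w dx`, for an elementwise given function `w`. -/
def integral (w : M.Cell → Pt d → ℝ) : ℝ := ∑ K : M.Cell, ∫ x in hull K.1, w K x

/-- The average `{t}` on an interior face `e`, for `t` scalar- or vector-valued. -/
def avg {F : Type*} [AddCommGroup F] [Module ℝ F] (t : M.Cell → Pt d → F) (e : Finset (Pt d))
    (x : Pt d) : F :=
  (1 / 2 : ℝ) • ∑ K ∈ M.neighbours e, t K x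

/-- The jump `[t] = t⁺ n⁺ + t⁻ n⁻` of a scalar on an interior face `e`. -/
def jump (t : M.Cell → Pt d → ℝ) (e : Finset (Pt d)) (x : Pt d) : Pt d :=
  ∑ K ∈ M.neighbours e, t K x • outwardNormal K.1 e

/-- The jump `[τ] = τ⁺ · n⁺ + τ⁻ · n⁻` of a vector on an interior face `e`. -/
def normalJump (τ : M.Cell → Pt d → Pt d) (e : Finset (Pt d)) (x : Pt d) : ℝ :=
  ∑ K ∈ M.neighbours e, ⟪τ K x, outwardNormal K.1 e⟫

/-- The value on a boundary face `e`, taken from the only element having that face. -/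
def bdry {F : Type*} [AddCommGroup F] (t : M.Cell → Pt d → F) (e : Finset (Pt d)) (x : Pt d) : F :=
  ∑ K ∈ M.neighbours e, t K x

/-- The outward unit normal `n` to `Ω` on a boundary face `e`. -/
def bdryNormal (e : Finset (Pt d)) : Pt d := ∑ K ∈ M.neighbours e, outwardNormal K.1 e

/-- A function in the broken space, given elementwise with its gradient and with the traces on
the element boundaries of the function and of its gradient. -/
structure BrokenFn where
  val : M.Cell → Pt d → ℝ
  grad : M.Cell → Pt d → Pt d
  tr : M.Cell → Pt d → ℝ
  gradTr : M.Cell → Pt d → Pt d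

variable {M} in
/-- An elementwise smooth function, viewed as a broken function. -/
def BrokenFn.smooth (v : M.Cell → Pt d → ℝ) : M.BrokenFn where
  val := v
  grad := fun K => gradient (v K)
  tr := v
  gradTr := fun K => gradient (v K)

variable {M} in
/-- `u` belongs to the broken Sobolev space `H²(𝒯_h)`, and the gradient and traces that it
carries are its weak gradient and its Sobolev traces. -/
def BrokenFn.IsH2 (u : M.BrokenFn) : Prop :=
  ∀ K : M.Cell, HasH1Trace K.1 (u.val K) (u.grad K) (u.tr K) ∧
    ∀ i, ∃ H : Pt d → Pt d, HasH1Trace K.1 (fun x => u.grad K x i) H (fun x => u.gradTr K x i)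

end Triangulation

/-- A triangulation with all the parameters of the scheme: polynomial degree `p`, coefficient `κ`
(constant on each element), Dirichlet faces, face switches and stabilization constant `C11`. -/
structure Discretization (d : ℕ) extends Triangulation d where
  p : ℕ
  one_le_p : 1 ≤ p
  κ : {K : Finset (Pt d) // K ∈ cells} → ℝ
  κ_pos : ∀ K, 0 < κ K
  dirichletFaces : Finset (Finset (Pt d))
  dirichlet_subset : dirichletFaces ⊆ toTriangulation.boundaryFaces
  switch : {K : Finset (Pt d) // K ∈ cells} → Finset (Pt d) → ℝ
  switch_mem : ∀ e ∈ toTriangulation.interiorFaces, ∀ K ∈ toTriangulation.neighbours e,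
    switch K e = 0 ∨ switch K e = 1
  switch_sum : ∀ e ∈ toTriangulation.interiorFaces,
    ∑ K ∈ toTriangulation.neighbours e, switch K e = 1
  C11 : ℝ

namespace Discretization

variable {d : ℕ} (D : Discretization d)

/-- Elementwise given vector fields. -/
abbrev Field := D.Cell → Pt d → Pt d

open Classical in
/-- The boundary faces that are not Dirichlet faces. -/
def neumannFaces : Finset (Finset (Pt d)) := D.boundaryFaces \ D.dirichletFaces

open Classical in
/-- The set `ℰ_i ∪ ∂Ω_D` of faces. -/
def activeFaces : Finset (Finset (Pt d)) := D.interiorFaces ∪ D.dirichletFaces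

/-- The finite element space `V_h`. -/
def Vh : Submodule ℝ (D.Cell → Pt d → ℝ) := Submodule.pi Set.univ fun _ => polySpace d D.p

/-- The finite element space `Σ_h`. -/
def Sigmah : Submodule ℝ D.Field := Submodule.pi Set.univ fun _ => polyFieldSpace d D.p

/-- `∫_Ω σ · τ dx`. -/
def dot (σ τ : D.Field) : ℝ := D.integral fun K x => ⟪σ K x, τ K x⟫

/-- Multiplication by `κ`. -/
def kmul (τ : D.Field) : D.Field := fun K x => D.κ K • τ K x

/-- The vector `C₁₂ = (S⁺ n⁺ + S⁻ n⁻) / 2` on an interior face. -/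
def C12 (e : Finset (Pt d)) : Pt d :=
  (1 / 2 : ℝ) • ∑ K ∈ D.neighbours e, D.switch K e • outwardNormal K.1 e

open Classical in
/-- The element of `Σ_h` representing the functional `ℓ` with respect to the `L²(Ω)` product. -/
def represent (ℓ : D.Field → ℝ) : D.Field :=
  if h : ∃ ρ ∈ D.Sigmah, ∀ τ ∈ D.Sigmah, D.dot ρ τ = ℓ τ then h.choose else 0

/-- The functional `τ ↦ -∫_e φ · {τ} ds` of an interior face. -/
def rFun (e : Finset (Pt d)) (φ : Pt d → Pt d) (τ : D.Field) : ℝ :=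
  -∫ x, ⟪φ x, D.avg τ e x⟫ ∂faceMeasure e

/-- The functional `τ ↦ -∫_e q [τ] ds` of an interior face. -/
def lFun (e : Finset (Pt d)) (q : Pt d → ℝ) (τ : D.Field) : ℝ :=
  -∫ x, q x * D.normalJump τ e x ∂faceMeasure e

/-- The functional `τ ↦ -∫_e q τ · n ds` of a boundary face. -/
def rDFun (e : Finset (Pt d)) (q : Pt d → ℝ) (τ : D.Field) : ℝ :=
  -∫ x, q x * ⟪D.bdry τ e x, D.bdryNormal e⟫ ∂faceMeasure e

open Classical in
/-- The face-wise lifting `r^e` (zero unless `e` is an interior face). -/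
def rE (e : Finset (Pt d)) (φ : Pt d → Pt d) : D.Field :=
  if e ∈ D.interiorFaces then D.represent (D.rFun e φ) else 0

open Classical in
/-- The face-wise lifting `l^e` (zero unless `e` is an interior face). -/
def lE (e : Finset (Pt d)) (q : Pt d → ℝ) : D.Field :=
  if e ∈ D.interiorFaces then D.represent (D.lFun e q) else 0

open Classical in
/-- The face-wise lifting `r^e_D` (zero unless `e` is a Dirichlet face). -/
def rDE (e : Finset (Pt d)) (q : Pt d → ℝ) : D.Field :=
  if e ∈ D.dirichletFaces then D.represent (D.rDFun e q) else 0

/-- The global lifting `r`; `φ` is given face by face. -/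
def rGlobal (φ : Finset (Pt d) → Pt d → Pt d) : D.Field :=
  D.represent fun τ => ∑ e ∈ D.interiorFaces, D.rFun e (φ e) τ

/-- The global lifting `l`; `q` is given face by face. -/
def lGlobal (q : Finset (Pt d) → Pt d → ℝ) : D.Field :=
  D.represent fun τ => ∑ e ∈ D.interiorFaces, D.lFun e (q e) τ

/-- The global lifting `r_D`; `q` is given face by face. -/
def rDGlobal (q : Finset (Pt d) → Pt d → ℝ) : D.Field :=
  D.represent fun τ => ∑ e ∈ D.dirichletFaces, D.rDFun e (q e) τ

/-- `r^e([u]) + l^e(C₁₂ · [u]) + r^e_D(u)`. -/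
def faceLift (u : D.BrokenFn) (e : Finset (Pt d)) : D.Field :=
  D.rE e (D.jump u.tr e) + D.lE e (fun x => ⟪D.C12 e, D.jump u.tr e x⟫)
    + D.rDE e (D.bdry u.tr e)

/-- `r([u]) + l(C₁₂ · [u]) + r_D(u)`. -/
def globalLift (u : D.BrokenFn) : D.Field :=
  D.rGlobal (D.jump u.tr) + D.lGlobal (fun e x => ⟪D.C12 e, D.jump u.tr e x⟫)
    + D.rDGlobal (D.bdry u.tr)

/-! ### The CDG scheme -/

/-- The flux `û` on the face `e`. -/
def uHat (gD : Pt d → ℝ) (u : D.BrokenFn) (e : Finset (Pt d)) (x : Pt d) : ℝ :=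
  open Classical in
  if e ∈ D.interiorFaces then D.avg u.tr e x - ⟪D.C12 e, D.jump u.tr e x⟫
  else if e ∈ D.dirichletFaces then gD x
  else D.bdry u.tr e x

/-- The trace on element boundaries of the face-associated stress
`σ^e = κ ∇_h u + κ r^e([u]) + κ l^e(C₁₂ · [u]) - κ r^e_D(g_D - u)`. -/
def sigmaE (gD : Pt d → ℝ) (u : D.BrokenFn) (e : Finset (Pt d)) : D.Field :=
  D.kmul u.gradTr + D.kmul (D.rE e (D.jump u.tr e))
    + D.kmul (D.lE e (fun x => ⟪D.C12 e, D.jump u.tr e x⟫))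
    - D.kmul (D.rDE e (fun x => gD x - D.bdry u.tr e x))

/-- The CDG flux `σ̂` on the face `e`. -/
def sigmaHat (gD gN : Pt d → ℝ) (u : D.BrokenFn) (e : Finset (Pt d)) (x : Pt d) : Pt d :=
  open Classical in
  if e ∈ D.interiorFaces then
    D.avg (D.sigmaE gD u e) e x - D.C11 • D.jump u.tr e x
      + D.normalJump (D.sigmaE gD u e) e x • D.C12 e
  else if e ∈ D.dirichletFaces then
    D.bdry (D.sigmaE gD u e) e x - (D.C11 * (D.bdry u.tr e x - gD x)) • D.bdryNormal e
  else gN x • D.bdryNormal e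

/-- The pair `(u, σ)` satisfies the element equations of the CDG scheme: for each element `K`,
`∫_K σ·τ = -∫_K u ∇·(κτ) + ∫_∂K û κτ·n` for all `τ ∈ P_p(K)^d` and
`∫_K σ·∇v = ∫_K f v + ∫_∂K σ̂·n v` for all `v ∈ P_p(K)`. -/
def IsCDGSolution (f gD gN : Pt d → ℝ) (u : D.Cell → Pt d → ℝ) (σ : D.Field) : Prop :=
  ∀ K : D.Cell,
    (∀ τ ∈ polyFieldSpace d D.p,
      ∫ x in hull K.1, ⟪σ K x, τ x⟫ =
        -(∫ x in hull K.1, u K x * divergence (fun y => D.κ K • τ y) x)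
        + ∑ e ∈ K.1.powersetCard d,
            ∫ x, D.uHat gD (.smooth u) e x * ⟪D.κ K • τ x, outwardNormal K.1 e⟫ ∂faceMeasure e) ∧
    (∀ v ∈ polySpace d D.p,
      ∫ x in hull K.1, ⟪σ K x, gradient v x⟫ =
        (∫ x in hull K.1, f x * v x)
        + ∑ e ∈ K.1.powersetCard d,
            ∫ x, ⟪D.sigmaHat gD gN (.smooth u) e x, outwardNormal K.1 e⟫ * v x ∂faceMeasure e)

/-- `κ ∇_h u + κ r([u]) + κ l(C₁₂ · [u]) - κ r_D(g_D - u)`. -/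
def stress (gD : Pt d → ℝ) (u : D.BrokenFn) : D.Field :=
  D.kmul u.grad + D.kmul (D.rGlobal (D.jump u.tr))
    + D.kmul (D.lGlobal (fun e x => ⟪D.C12 e, D.jump u.tr e x⟫))
    - D.kmul (D.rDGlobal (fun e x => gD x - D.bdry u.tr e x))

/-! ### The primal forms -/

/-- All the terms of the bilinear forms except the one with products of liftings. -/
def baseForm (u v : D.BrokenFn) : ℝ :=
  (D.integral fun K x => ⟪v.grad K x, D.κ K • u.grad K x⟫)
  - (∑ e ∈ D.interiorFaces, ∫ x, (⟪D.jump u.tr e x, D.avg (D.kmul v.gradTr) e x⟫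
        + ⟪D.avg (D.kmul u.gradTr) e x, D.jump v.tr e x⟫) ∂faceMeasure e)
  - (∑ e ∈ D.interiorFaces, ∫ x,
      (⟪D.C12 e, D.jump u.tr e x⟫ * D.normalJump (D.kmul v.gradTr) e x
        + D.normalJump (D.kmul u.gradTr) e x * ⟪D.C12 e, D.jump v.tr e x⟫) ∂faceMeasure e)
  - (∑ e ∈ D.dirichletFaces, ∫ x,
      (⟪D.bdry (D.kmul u.gradTr) e x, D.bdryNormal e⟫ * D.bdry v.tr e x
        + D.bdry u.tr e x * ⟪D.bdry (D.kmul v.gradTr) e x, D.bdryNormal e⟫) ∂faceMeasure e)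
  + (∑ e ∈ D.interiorFaces, ∫ x, D.C11 * ⟪D.jump u.tr e x, D.jump v.tr e x⟫ ∂faceMeasure e)
  + (∑ e ∈ D.dirichletFaces, ∫ x, D.C11 * (D.bdry u.tr e x * D.bdry v.tr e x) ∂faceMeasure e)

/-- The bilinear form `B_h^{CDG}`. -/
def cdgForm (u v : D.BrokenFn) : ℝ :=
  D.baseForm u v + ∑ e ∈ D.activeFaces, D.dot (D.kmul (D.faceLift u e)) (D.faceLift v e)

/-- The bilinear form `B_h^{LDG}`. -/
def ldgForm (u v : D.BrokenFn) : ℝ :=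
  D.baseForm u v + D.dot (D.kmul (D.globalLift u)) (D.globalLift v)

/-- The linear form `L_h^{CDG}`. -/
def cdgLoad (f gD gN : Pt d → ℝ) (v : D.BrokenFn) : ℝ :=
  (D.integral fun K x => f x * v.val K x)
  - (∑ e ∈ D.dirichletFaces,
      ∫ x, gD x * ⟪D.bdry (D.kmul v.gradTr) e x, D.bdryNormal e⟫ ∂faceMeasure e)
  - (∑ e ∈ D.dirichletFaces,
      ∫ x, D.bdry v.tr e x * ⟪D.bdry (D.kmul (D.rDE e gD)) e x, D.bdryNormal e⟫ ∂faceMeasure e)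
  + (∑ e ∈ D.dirichletFaces, ∫ x, D.C11 * (gD x * D.bdry v.tr e x) ∂faceMeasure e)
  + (∑ e ∈ D.neumannFaces, ∫ x, D.bdry v.tr e x * gN x ∂faceMeasure e)

/-- The linear form `L_h^{LDG}`. -/
def ldgLoad (f gD gN : Pt d → ℝ) (v : D.BrokenFn) : ℝ :=
  (D.integral fun K x => f x * v.val K x)
  - (∑ e ∈ D.dirichletFaces, ∫ x, gD x *
      ⟪D.bdry (D.kmul (v.gradTr + D.rGlobal (D.jump v.tr)
        + D.lGlobal (fun e' y => ⟪D.C12 e', D.jump v.tr e' y⟫))) e x, D.bdryNormal e⟫ ∂faceMeasure e)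
  - (∑ e ∈ D.dirichletFaces, ∫ x, D.bdry v.tr e x *
      ⟪D.bdry (D.kmul (D.rDGlobal (fun _ => gD))) e x, D.bdryNormal e⟫ ∂faceMeasure e)
  + (∑ e ∈ D.dirichletFaces, ∫ x, D.C11 * (gD x * D.bdry v.tr e x) ∂faceMeasure e)
  + (∑ e ∈ D.neumannFaces, ∫ x, D.bdry v.tr e x * gN x ∂faceMeasure e)

/-- `u` solves `-∇·(κ∇u) = f` in `Ω`, `u = gD` on `∂Ω_D`, `κ ∂u/∂n = gN` on `∂Ω_N`: the piecewise
gradient of `u` is its weak gradient on `Ω`, the equation holds in the sense of distributions on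
`Ω`, and the boundary conditions hold for the traces. -/
def SolvesPoisson (f gD gN : Pt d → ℝ) (u : D.BrokenFn) : Prop :=
  (∀ φ : Pt d → ℝ, ContDiff ℝ ∞ φ → HasCompactSupport φ → tsupport φ ⊆ D.domain →
    (∀ i, (D.integral fun K x => u.val K x * gradient φ x i)
        = -D.integral fun K x => u.grad K x i * φ x) ∧
    (D.integral fun K x => ⟪D.κ K • u.grad K x, gradient φ x⟫)
        = D.integral fun _ x => f x * φ x) ∧
  (∀ e ∈ D.dirichletFaces, ∀ᵐ x ∂faceMeasure e, D.bdry u.tr e x = gD x) ∧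
  (∀ e ∈ D.neumannFaces, ∀ᵐ x ∂faceMeasure e,
    ⟪D.bdry (D.kmul u.gradTr) e x, D.bdryNormal e⟫ = gN x)

end Discretization

end CDG

end

open MeasureTheory Filter Topology
open scoped ContDiff RealInnerProductSpace

noncomputable section

namespace CDG

/-! Everything rests on Green's formula on a simplex and on linear algebra in the finite-dimensional
space `Sigmah`.

Green's formula. A C¹ function is multiplied by the product of the cut-offs η(λ_b/ε) in the
barycentric coordinates λ_b; one integrates by parts on all of ℝ^d and lets ε → 0. The derivative of
the factor of a vertex concentrates on the opposite facet, and Fubini in the normal direction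
identifies its limit as the surface integral (`IsSimplex.tendsto_integral_face`,
`IsSimplex.integral_fderiv`). Since `HasH1Trace` describes traces as L² limits of smooth functions,
the formula extends to H¹ (`IsSimplex.green`). Conformity puts two cells with a common facet on
opposite sides of it (`IsSimplex.bary_neg`), so their normals are opposite, a face has at most two
neighbours, and sums over element boundaries become sums over faces of jumps and averages
(`Triangulation.sum_cells_faces`, `Triangulation.sum_flux_interior`, `Triangulation.broken_green`).

Liftings. The L² product is positive definite on `Sigmah`, so every linear functional is represented
uniquely (`Discretization.LinearOnSigmah.represent_iff`). By uniqueness, a global lifting is the sum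
of the face-wise ones.

The scheme. Testing cell by cell is the same as testing globally (`forall_cells_iff`). The summed
residual of the first equation is ∫(σ − stress)·τ (`Discretization.sum_residual_stress`), which
forces σ to be the stress. With this σ the summed residual of the second equation is B(u,v) − L(v)
(`Discretization.sum_residual_load`). There the flux on e contains only the liftings of e itself, so
the jump of v on e is paired with R^e(u) alone; this is why only diagonal products of liftings
occur. Linearity is read off the residual, and symmetry holds term by term.

Consistency. Test functions supported in one cell give the equation almost everywhere
(`Triangulation.ae_eq_neg_divergence`); those supported near one interior face show that u and κ∇u·n
do not jump (`Triangulation.jump_eq_zero`, `Triangulation.normalJump_eq_zero`). The interior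
liftings of u then vanish, the Dirichlet ones are the liftings of gD, and the broken Green formula
gives the claim. Adjoint consistency follows by symmetry. The comparison with LDG expands a product
of two sums of face liftings and separates the diagonal. -/

/-- `K` is the vertex set of a nondegenerate simplex of full dimension. -/
structure IsSimplex {d : ℕ} (K : Finset (Pt d)) : Prop where
  card : K.card = d + 1
  indep : AffineIndependent ℝ ((↑) : K → Pt d)

/-- The vertices of a full simplex, as an affine basis. -/
def IsSimplex.basis {d : ℕ} {K : Finset (Pt d)} (hK : IsSimplex K) : AffineBasis K ℝ (Pt d) where
  toFun := (↑)
  ind' := hK.indep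
  tot' := by
    rw [hK.indep.affineSpan_eq_top_iff_card_eq_finrank_add_one]
    simp [hK.card]

open Classical in
/-- The barycentric coordinate of the simplex `K` belonging to the vertex `a`. -/
def bary {d : ℕ} (K : Finset (Pt d)) (a : Pt d) : Pt d →ᵃ[ℝ] ℝ :=
  if h : IsSimplex K ∧ a ∈ K then h.1.basis.coord ⟨a, h.2⟩ else 0

/-! ### Barycentric coordinates, facets and outward normals of a simplex. -/

section Simplex

variable {d : ℕ} {K e : Finset (Pt d)} {a b : Pt d}

theorem IsSimplex.bary_eq (hK : IsSimplex K) (a : K) : bary K a = hK.basis.coord a := by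
  rw [bary, dif_pos ⟨hK, a.2⟩]

theorem IsSimplex.basis_apply (hK : IsSimplex K) (a : K) : hK.basis a = a := rfl

theorem IsSimplex.bary_self (hK : IsSimplex K) (ha : a ∈ K) : bary K a a = 1 := by
  have := hK.basis.coord_apply_eq ⟨a, ha⟩
  rwa [← hK.bary_eq, hK.basis_apply] at this

theorem IsSimplex.bary_of_ne (hK : IsSimplex K) (ha : a ∈ K) (hb : b ∈ K) (h : a ≠ b) :
    bary K a b = 0 := by
  have := hK.basis.coord_apply_ne (i := ⟨a, ha⟩) (j := ⟨b, hb⟩) (by simpa using h)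
  rwa [← hK.bary_eq, hK.basis_apply] at this

theorem IsSimplex.sum_bary (hK : IsSimplex K) (x : Pt d) : ∑ a ∈ K, bary K a x = 1 := by
  rw [← hK.basis.sum_coord_apply_eq_one x, ← Finset.sum_coe_sort K]
  simp only [hK.bary_eq]

theorem IsSimplex.sum_bary_smul (hK : IsSimplex K) (x : Pt d) : ∑ a ∈ K, bary K a x • a = x := by
  conv_rhs => rw [← hK.basis.linear_combination_coord_eq_self x]
  rw [← Finset.sum_coe_sort K]
  simp only [hK.bary_eq]
  rfl

theorem IsSimplex.mem_hull (hK : IsSimplex K) {x : Pt d} :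
    x ∈ hull K ↔ ∀ a ∈ K, 0 ≤ bary K a x := by
  have h : hull K = convexHull ℝ (Set.range hK.basis) := by
    rw [hull]; congr 1; ext y; simp [IsSimplex.basis_apply]
  rw [h, hK.basis.convexHull_eq_nonneg_coord]
  simp only [Set.mem_ofPred_eq, ← hK.bary_eq, Subtype.forall]

theorem IsSimplex.interior_hull (hK : IsSimplex K) :
    interior (hull K) = {x | ∀ a ∈ K, 0 < bary K a x} := by
  have h : hull K = convexHull ℝ (Set.range hK.basis) := by
    rw [hull]; congr 1; ext y; simp [IsSimplex.basis_apply]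
  rw [h, hK.basis.interior_convexHull]
  simp only [← hK.bary_eq, Subtype.forall]

theorem affine_add (f : Pt d →ᵃ[ℝ] ℝ) (x v : Pt d) : f (x + v) = f x + f.linear v := by
  rw [add_comm, ← vadd_eq_add v x, f.map_vadd, vadd_eq_add, add_comm]

theorem sum_smul_affine {s : Finset (Pt d)} (f : Pt d →ᵃ[ℝ] ℝ) (c : Pt d → ℝ)
    (hc : ∑ a ∈ s, c a = 1) : f (∑ a ∈ s, c a • a) = ∑ a ∈ s, c a * f a := by
  have h : ∀ x, f x = f.linear x + f 0 := fun x => by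
    rw [add_comm, ← affine_add, zero_add]
  have h2 : ∑ a ∈ s, c a * f a = ∑ a ∈ s, c a * f.linear a + f 0 := by
    rw [Finset.sum_congr rfl fun a _ => by rw [h a, mul_add], Finset.sum_add_distrib,
      ← Finset.sum_mul, hc, one_mul]
  rw [h, map_sum, h2]
  simp only [map_smul, smul_eq_mul]

theorem IsSimplex.affine_apply (hK : IsSimplex K) (f : Pt d →ᵃ[ℝ] ℝ) (x : Pt d) :
    f x = ∑ a ∈ K, bary K a x * f a := by
  conv_lhs => rw [← hK.sum_bary_smul x]
  exact sum_smul_affine f _ (hK.sum_bary x)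

theorem isCompact_hull (s : Finset (Pt d)) : IsCompact (hull s) :=
  s.finite_toSet.isCompact_convexHull (𝕜 := ℝ)

theorem isClosed_hull (s : Finset (Pt d)) : IsClosed (hull s) := (isCompact_hull s).isClosed

theorem convex_hull (s : Finset (Pt d)) : Convex ℝ (hull s) := convex_convexHull ℝ _

theorem hull_mono {s t : Finset (Pt d)} (h : s ⊆ t) : hull s ⊆ hull t :=
  convexHull_mono (by exact_mod_cast h)

/-- When the other coordinates vanish, the barycentric combination of the vertices of `K` is already
a convex combination of the vertices of `e`. -/
theorem IsSimplex.mem_hull_of_subset (hK : IsSimplex K) (he : e ⊆ K) {x : Pt d} :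
    x ∈ hull e ↔ x ∈ hull K ∧ ∀ a ∈ K, a ∉ e → bary K a x = 0 := by
  constructor
  · refine fun hx => ⟨hull_mono he hx, fun a ha hae => ?_⟩
    have : hull e ⊆ (bary K a) ⁻¹' {0} := by
      refine convexHull_min (fun b hb => ?_) ((convex_singleton 0).affine_preimage _)
      exact hK.bary_of_ne ha (he hb) (fun h => hae (h ▸ hb))
    exact this hx
  · rintro ⟨hx, h0⟩
    rw [hK.mem_hull] at hx
    have h1 : ∑ a ∈ e, bary K a x = 1 := by
      rw [← hK.sum_bary x]
      exact Finset.sum_subset he h0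
    rw [← hK.sum_bary_smul x, ← Finset.sum_subset he fun a ha hae => by rw [h0 a ha hae, zero_smul]]
    exact (convex_hull e).sum_mem (fun a ha => hx a (he ha)) h1
      fun a ha => subset_convexHull ℝ _ (by exact_mod_cast ha)

theorem IsSimplex.mem_powersetCard [DecidableEq (Pt d)] (hK : IsSimplex K) :
    e ∈ K.powersetCard d ↔ ∃ a ∈ K, e = K.erase a := by
  rw [Finset.mem_powersetCard]
  constructor
  · rintro ⟨hs, hc⟩
    have : (K \ e).card = 1 := by rw [Finset.card_sdiff_of_subset hs, hc, hK.card]; omega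
    obtain ⟨a, ha⟩ := Finset.card_eq_one.1 this
    have haK : a ∈ K \ e := by rw [ha]; simp
    refine ⟨a, (Finset.mem_sdiff.1 haK).1, ?_⟩
    rw [Finset.erase_eq, ← ha, Finset.sdiff_sdiff_eq_self hs]
  · rintro ⟨a, ha, rfl⟩
    exact ⟨Finset.erase_subset _ _, by rw [Finset.card_erase_of_mem ha, hK.card]; rfl⟩

/-- The linear parts of the coordinates sum to zero and reproduce v = Σ_b λ_b'(v) b. If λ_a'(v) = 0,
only facet vertices remain in this sum, and since the coefficients sum to zero, a fixed facet vertex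
`c` may be subtracted from each of them. -/
theorem IsSimplex.vectorSpan_erase [DecidableEq (Pt d)] (hK : IsSimplex K) (ha : a ∈ K) :
    vectorSpan ℝ (K.erase a : Set (Pt d)) = LinearMap.ker (bary K a).linear := by
  apply le_antisymm
  · rw [vectorSpan_def, Submodule.span_le]
    rintro _ ⟨x, hx, y, hy, rfl⟩
    simp only [Finset.coe_erase, Set.mem_sdiff, Finset.mem_coe, Set.mem_singleton_iff] at hx hy
    simp only [SetLike.mem_coe, LinearMap.mem_ker, AffineMap.linearMap_vsub,
      hK.bary_of_ne ha hx.1 (Ne.symm hx.2), hK.bary_of_ne ha hy.1 (Ne.symm hy.2), vsub_self]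
  · intro v hv
    have hsum : ∀ x, ∑ b ∈ K, (bary K b).linear x = 0 := fun x => by
      have h := hK.sum_bary (0 + x)
      simp only [affine_add] at h
      rw [Finset.sum_add_distrib, hK.sum_bary] at h
      linarith
    have hrep : ∑ b ∈ K, (bary K b).linear v • b = v := by
      have h := hK.sum_bary_smul (0 + v)
      simp only [affine_add, add_smul] at h
      rwa [Finset.sum_add_distrib, hK.sum_bary_smul, zero_add, zero_add] at h
    have h0 : (bary K a).linear v = 0 := hv
    rw [← Finset.sum_erase K (a := a) (by rw [h0, zero_smul])] at hrep
    have hs := hsum v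
    rw [← Finset.sum_erase K (a := a) h0] at hs
    rcases (K.erase a).eq_empty_or_nonempty with he | ⟨c, hc⟩
    · rw [he] at hrep; simp only [Finset.sum_empty] at hrep
      rw [← hrep]; exact zero_mem _
    · have : v = ∑ b ∈ K.erase a, (bary K b).linear v • (b - c) := by
        simp only [smul_sub, Finset.sum_sub_distrib, hrep, ← Finset.sum_smul, hs, zero_smul,
          sub_zero]
      rw [this]
      exact Submodule.sum_mem _ fun b hb => Submodule.smul_mem _ _
        (vsub_mem_vectorSpan ℝ (by exact_mod_cast hb) (by exact_mod_cast hc))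

/-- The defining properties of the outward normal, in terms of the barycentric coordinate that
vanishes on the face. -/
theorem IsSimplex.outwardNormal_spec [DecidableEq (Pt d)] (hd : 1 ≤ d) (hK : IsSimplex K)
    (ha : a ∈ K) :
    ‖outwardNormal K (K.erase a)‖ = 1 ∧
    outwardNormal K (K.erase a) ∈ (LinearMap.ker (bary K a).linear)ᗮ ∧
    (bary K a).linear (outwardNormal K (K.erase a)) < 0 := by
  set L := (bary K a).linear with hL
  set z : Pt d := ((K.erase a).card : ℝ)⁻¹ • (∑ x ∈ K.erase a, x) - (K.card : ℝ)⁻¹ • (∑ x ∈ K, x)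
    with hz
  set w := ((vectorSpan ℝ (K.erase a : Set (Pt d)))ᗮ).starProjection z with hw
  have hn : outwardNormal K (K.erase a) = ‖w‖⁻¹ • w := rfl
  have hwmem : w ∈ (LinearMap.ker L)ᗮ := by
    rw [← hK.vectorSpan_erase ha]; exact Submodule.starProjection_apply_mem _ _
  have hcard : ((K.erase a).card : ℝ) ≠ 0 := by
    rw [Finset.card_erase_of_mem ha, hK.card]; simp; omega
  have hcardK : (K.card : ℝ) ≠ 0 := by rw [hK.card]; positivity
  -- λ_a is 0 at the barycentre of the facet and 1/(d+1) at that of `K`, and `z` is the difference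
  -- of the two.
  have hLz : L z = -(K.card : ℝ)⁻¹ := by
    have h1 : bary K a (∑ x ∈ K.erase a, ((K.erase a).card : ℝ)⁻¹ • x) = 0 := by
      rw [sum_smul_affine _ (fun _ => ((K.erase a).card : ℝ)⁻¹) (by simp [hcard])]
      exact Finset.sum_eq_zero fun b hb => by
        rw [hK.bary_of_ne ha (Finset.mem_of_mem_erase hb) (Finset.ne_of_mem_erase hb).symm,
          mul_zero]
    have h2 : bary K a (∑ x ∈ K, (K.card : ℝ)⁻¹ • x) = (K.card : ℝ)⁻¹ := by
      rw [sum_smul_affine _ (fun _ => (K.card : ℝ)⁻¹) (by simp [hcardK]),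
        Finset.sum_eq_single a, hK.bary_self ha, mul_one]
      · exact fun b hb hba => by rw [hK.bary_of_ne ha hb hba.symm, mul_zero]
      · exact fun h => absurd ha h
    rw [hz, ← vsub_eq_sub, hL, AffineMap.linearMap_vsub, Finset.smul_sum, Finset.smul_sum, h1, h2,
      vsub_eq_sub, zero_sub]
  -- The projection changes `z` only by a vector in the direction of the facet, that is, in the
  -- kernel of `L`.
  have hLw : L w = L z := by
    have : z - w ∈ LinearMap.ker L := by
      rw [← hK.vectorSpan_erase ha, hw]
      have h := Submodule.sub_starProjection_mem_orthogonal
        (K := (vectorSpan ℝ (K.erase a : Set (Pt d)))ᗮ) z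
      rwa [Submodule.orthogonal_orthogonal] at h
    rw [LinearMap.mem_ker, map_sub, sub_eq_zero] at this
    exact this.symm
  have hw0 : w ≠ 0 := by
    intro h; rw [h, map_zero, hLz] at hLw
    exact hcardK (by simpa using hLw)
  have hwpos : 0 < ‖w‖ := norm_pos_iff.2 hw0
  refine ⟨?_, ?_, ?_⟩
  · rw [hn, norm_smul, norm_inv, norm_norm, inv_mul_cancel₀ hwpos.ne']
  · rw [hn]; exact Submodule.smul_mem _ _ hwmem
  · rw [hn, map_smul, hLw, hLz, smul_eq_mul, mul_neg, neg_lt_zero]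
    have : (0 : ℝ) < K.card := by positivity
    positivity

/-- A linear functional is determined by its value at a unit vector orthogonal to its kernel. -/
theorem linear_eq_inner_mul {L : Pt d →ₗ[ℝ] ℝ} {n : Pt d} (hn : ‖n‖ = 1)
    (hL : n ∈ (LinearMap.ker L)ᗮ) (v : Pt d) : L v = ⟪v, n⟫ * L n := by
  by_cases h0 : L n = 0
  · have : n ∈ LinearMap.ker L := h0
    have h1 := hL n this
    rw [real_inner_self_eq_norm_sq, hn] at h1
    norm_num at h1
  · have hk : L n • v - L v • n ∈ LinearMap.ker L := by
      rw [LinearMap.mem_ker, map_sub, map_smul, map_smul, smul_eq_mul, smul_eq_mul]; ring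
    have := hL _ hk
    rw [inner_sub_left, inner_smul_left, inner_smul_left, real_inner_self_eq_norm_sq, hn] at this
    simp only [conj_trivial, one_pow, mul_one] at this
    linarith

/-- The outward normal is the only unit vector with the properties of
`IsSimplex.outwardNormal_spec`. -/
theorem unit_normal_unique {L : Pt d →ₗ[ℝ] ℝ} {n m : Pt d} (hn : ‖n‖ = 1)
    (hnL : n ∈ (LinearMap.ker L)ᗮ) (hm : ‖m‖ = 1)
    (hmL : m ∈ (LinearMap.ker L)ᗮ) (h : 0 < L n * L m) : n = m := by
  have h1 := linear_eq_inner_mul hn hnL m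
  have h2 := linear_eq_inner_mul hm hmL n
  have hc : ⟪m, n⟫ = 1 := by
    rw [real_inner_comm] at h2
    set c : ℝ := ⟪m, n⟫
    have hn0 : L n ≠ 0 := fun h0 => by rw [h0] at h; simp at h
    -- Each vector's `L`-value is c times that of the other, so applying the relation twice gives c²
    -- = 1; the sign hypothesis then selects c = 1.
    have hc2 : c * c = 1 := by
      have : L n * (c * c) = L n * 1 := by
        rw [mul_one]
        conv_rhs => rw [h2, h1]
        ring
      exact mul_left_cancel₀ hn0 this
    rw [h1] at h
    have h3 : 0 < c * (L n * L n) := by linarith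
    have hcpos : 0 < c := pos_of_mul_pos_left h3 (mul_self_nonneg (L n))
    nlinarith
  exact ((inner_eq_one_iff_of_norm_eq_one (𝕜 := ℝ) hm hn).1 hc).symm

end Simplex

/-! ### Fubini along a unit vector and its orthogonal hyperplane. -/

section Slicing

variable {d : ℕ}

/-- The zero set is a proper affine subspace. The general space `E` allows the use on the hyperplane
of a facet. -/
theorem volume_affine_zero {E : Type*} [NormedAddCommGroup E] [InnerProductSpace ℝ E]
    [FiniteDimensional ℝ E] [MeasurableSpace E] [BorelSpace E] (f : E →ᵃ[ℝ] ℝ) {z : E}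
    (hz : f z ≠ 0) : (volume : Measure E) {x | f x = 0} = 0 := by
  have h := Measure.addHaar_affineSubspace (volume : Measure E)
    ((AffineSubspace.mk' (0 : ℝ) ⊥).comap f) (fun h => by
      have : z ∈ (AffineSubspace.mk' (0 : ℝ) ⊥).comap f := by rw [h]; trivial
      simp [AffineSubspace.mem_mk', hz] at this)
  convert h using 2
  ext x
  simp [AffineSubspace.mem_mk']

theorem slice_eq {n : Pt d} (hn : ‖n‖ = 1) (x₀ : Pt d) :
    (fun p : ℝ × ↥(ℝ ∙ n)ᗮ => x₀ + p.1 • n + (p.2 : Pt d)) =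
      ((ℝ ∙ n).measurableEquivProd x₀).symm ∘
        Prod.map (LinearIsometryEquiv.toSpanUnitSingleton (𝕜 := ℝ) n hn) id := by
  funext p
  simp [Submodule.measurableEquivProd_symm_apply, add_comm, add_left_comm]

/-- Coordinates of `ℝ^d` along a unit vector `n` and its orthogonal complement preserve volume. -/
theorem measurePreserving_slice {n : Pt d} (hn : ‖n‖ = 1) (x₀ : Pt d) :
    MeasurePreserving (fun p : ℝ × ↥(ℝ ∙ n)ᗮ => x₀ + p.1 • n + (p.2 : Pt d))
      (volume.prod volume) volume := by
  have h1 := ((ℝ ∙ n).measurePreserving_measurableEquivProd x₀).symm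
  rw [InnerProductSpace.euclideanHausdorffMeasure_eq_volume] at h1
  have h2 : MeasurePreserving (LinearIsometryEquiv.toSpanUnitSingleton (𝕜 := ℝ) n hn) :=
    LinearIsometryEquiv.measurePreserving _
  have h3 := h1.comp (h2.prod (MeasurePreserving.id (volume : Measure ↥(ℝ ∙ n)ᗮ)))
  rwa [slice_eq hn]

theorem continuous_slice (n : Pt d) (x₀ : Pt d) (c : ℝ) :
    Continuous fun p : ℝ × ↥(ℝ ∙ n)ᗮ => x₀ + (c * p.1) • n + (p.2 : Pt d) := by
  fun_prop

/-- With an embedding, integrals can be transported without measurability assumptions on the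
integrand. -/
theorem measurableEmbedding_slice {n : Pt d} (hn : ‖n‖ = 1) (x₀ : Pt d) :
    MeasurableEmbedding (fun p : ℝ × ↥(ℝ ∙ n)ᗮ => x₀ + p.1 • n + (p.2 : Pt d)) := by
  have h1 := ((ℝ ∙ n).measurableEquivProd x₀).symm.measurableEmbedding
  have h2 : MeasurableEmbedding (LinearIsometryEquiv.toSpanUnitSingleton (𝕜 := ℝ) n hn) :=
    (LinearIsometryEquiv.toSpanUnitSingleton (𝕜 := ℝ) n hn).toHomeomorph.measurableEmbedding
  have h3 := h1.comp (h2.prodMap (MeasurableEmbedding.id (α := ↥(ℝ ∙ n)ᗮ)))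
  rwa [slice_eq hn]

/-- The factor is the Jacobian of the dilation t ↦ ct of the normal coordinate; c may be negative,
so that the normal coordinate can run into the simplex. -/
theorem integral_slice {n : Pt d} (hn : ‖n‖ = 1) (x₀ : Pt d) {c : ℝ} (hc : c ≠ 0)
    (G : Pt d → ℝ) :
    ∫ p : ℝ × ↥(ℝ ∙ n)ᗮ, G (x₀ + (c * p.1) • n + (p.2 : Pt d)) ∂(volume.prod volume)
      = |c⁻¹| * ∫ x, G x := by
  have hmap : Measure.map (fun p : ℝ × ↥(ℝ ∙ n)ᗮ => (c * p.1, p.2)) (volume.prod volume)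
      = ENNReal.ofReal |c⁻¹| • (volume.prod volume) := by
    have h := Measure.map_prod_map (volume : Measure ℝ) (volume : Measure ↥(ℝ ∙ n)ᗮ)
      (f := fun t => c * t) (g := id) (by fun_prop) measurable_id
    rw [Real.map_volume_mul_left hc, Measure.map_id, Measure.prod_smul_left] at h
    exact h.symm
  have hemb : MeasurableEmbedding (fun p : ℝ × ↥(ℝ ∙ n)ᗮ => (c * p.1, p.2)) :=
    ((Homeomorph.mulLeft₀ c hc).measurableEmbedding).prodMap
      (MeasurableEmbedding.id (α := ↥(ℝ ∙ n)ᗮ))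
  have h1 := hemb.integral_map (μ := volume.prod volume)
    (fun p : ℝ × ↥(ℝ ∙ n)ᗮ => G (x₀ + p.1 • n + (p.2 : Pt d)))
  rw [hmap, integral_smul_measure, ENNReal.toReal_ofReal (abs_nonneg _), smul_eq_mul,
    (measurePreserving_slice hn x₀).integral_comp (measurableEmbedding_slice hn x₀)] at h1
  exact h1.symm

end Slicing

/-! ### The surface measure of a facet as Lebesgue measure on its hyperplane. -/

section FaceMeasure

variable {d : ℕ} {K e : Finset (Pt d)} {a b : Pt d}

theorem isometry_translate (n : Pt d) (x₀ : Pt d) :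
    Isometry fun y : ↥(ℝ ∙ n)ᗮ => x₀ + (y : Pt d) :=
  (IsometryEquiv.addLeft x₀).isometry.comp isometry_subtype_coe

/-- The face measure is the push-forward of Lebesgue measure on the hyperplane of the face. -/
theorem faceMeasure_eq_map {n : Pt d} (hn : ‖n‖ = 1) {x₀ : Pt d}
    (he : ∀ x ∈ hull e, x - x₀ ∈ (ℝ ∙ n)ᗮ) :
    faceMeasure e = (volume.restrict {y : ↥(ℝ ∙ n)ᗮ | x₀ + (y : Pt d) ∈ hull e}).map
      (fun y : ↥(ℝ ∙ n)ᗮ => x₀ + (y : Pt d)) := by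
  have hiso := isometry_translate n x₀
  have hrank : Module.finrank ℝ ↥(ℝ ∙ n)ᗮ = d - 1 := by
    have h := (ℝ ∙ n).finrank_add_finrank_orthogonal
    rw [finrank_span_singleton (by rintro rfl; simp at hn)] at h
    simp only [finrank_euclideanSpace, Fintype.card_fin] at h
    omega
  have hmap := hiso.map_euclideanHausdorffMeasure (d := d - 1)
  conv_lhs at hmap => rw [← hrank]
  -- On n^⊥, whose dimension is d − 1, the normalised Hausdorff measure of that dimension is the
  -- volume.
  rw [InnerProductSpace.euclideanHausdorffMeasure_eq_volume] at hmap
  have hsub : hull e ⊆ Set.range fun y : ↥(ℝ ∙ n)ᗮ => x₀ + (y : Pt d) :=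
    fun x hx => ⟨⟨_, he x hx⟩, by simp⟩
  have hme : MeasurableSet (hull e) := (isClosed_hull e).measurableSet
  have h := Measure.restrict_restrict (μ := Measure.euclideanHausdorffMeasure (d - 1))
    (t := Set.range fun y : ↥(ℝ ∙ n)ᗮ => x₀ + (y : Pt d)) hme
  rw [Set.inter_eq_self_of_subset_left hsub, ← hmap,
    Measure.restrict_map hiso.continuous.measurable hme] at h
  exact h.symm

theorem IsSimplex.ker_bary [DecidableEq (Pt d)] (hd : 1 ≤ d) (hK : IsSimplex K) (ha : a ∈ K) :
    LinearMap.ker (bary K a).linear = (ℝ ∙ outwardNormal K (K.erase a))ᗮ := by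
  obtain ⟨h1, h2, h3⟩ := hK.outwardNormal_spec hd ha
  ext v
  rw [LinearMap.mem_ker, linear_eq_inner_mul h1 h2,
    Submodule.mem_orthogonal_singleton_iff_inner_left]
  simp [h3.ne]

/-- Choosing a base point, the face opposite to `a` lies in the hyperplane through that point. -/
theorem IsSimplex.exists_base [DecidableEq (Pt d)] (hd : 1 ≤ d) (hK : IsSimplex K) (ha : a ∈ K) :
    ∃ x₀ ∈ K.erase a, bary K a x₀ = 0 ∧
      ∀ x, bary K a x = 0 ↔ x - x₀ ∈ (ℝ ∙ outwardNormal K (K.erase a))ᗮ := by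
  have hne : (K.erase a).Nonempty := by
    rw [← Finset.card_pos, Finset.card_erase_of_mem ha, hK.card]; omega
  obtain ⟨x₀, hx₀⟩ := hne
  have h0 : bary K a x₀ = 0 :=
    hK.bary_of_ne ha (Finset.mem_of_mem_erase hx₀) (Finset.ne_of_mem_erase hx₀).symm
  refine ⟨x₀, hx₀, h0, fun x => ?_⟩
  rw [← hK.ker_bary hd ha, LinearMap.mem_ker, ← vsub_eq_sub, AffineMap.linearMap_vsub, h0,
    vsub_eq_sub, sub_zero]

theorem IsSimplex.mem_hull_erase [DecidableEq (Pt d)] (hK : IsSimplex K) (ha : a ∈ K) {x : Pt d} :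
    x ∈ hull (K.erase a) ↔ bary K a x = 0 ∧ ∀ b ∈ K.erase a, 0 ≤ bary K b x := by
  rw [hK.mem_hull_of_subset (Finset.erase_subset a K), hK.mem_hull]
  constructor
  · rintro ⟨h1, h2⟩
    exact ⟨h2 a ha (Finset.notMem_erase a K), fun b hb => h1 b (Finset.mem_of_mem_erase hb)⟩
  · rintro ⟨h1, h2⟩
    refine ⟨fun b hb => ?_, fun b hb hbe => ?_⟩
    · by_cases h : b = a
      · rw [h, h1]
      · exact h2 b (Finset.mem_erase.2 ⟨h, hb⟩)
    · by_cases h : b = a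
      · rw [h, h1]
      · exact absurd (Finset.mem_erase.2 ⟨h, hb⟩) hbe

theorem IsSimplex.faceMeasure_eq [DecidableEq (Pt d)] (hd : 1 ≤ d) (hK : IsSimplex K) (ha : a ∈ K)
    {x₀ : Pt d} (h0 : ∀ x, bary K a x = 0 ↔ x - x₀ ∈ (ℝ ∙ outwardNormal K (K.erase a))ᗮ) :
    faceMeasure (K.erase a) = (volume.restrict
      {y : ↥(ℝ ∙ outwardNormal K (K.erase a))ᗮ | x₀ + (y : Pt d) ∈ hull (K.erase a)}).map
      (fun y : ↥(ℝ ∙ outwardNormal K (K.erase a))ᗮ => x₀ + (y : Pt d)) :=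
  faceMeasure_eq_map (hK.outwardNormal_spec hd ha).1
    fun x hx => (h0 x).1 ((hK.mem_hull_erase ha).1 hx).1

/-- On the hyperplane of the facet λ_b is affine and takes the value 1 at the vertex b, so it is not
identically zero there. -/
theorem IsSimplex.volume_bary_eq_zero [DecidableEq (Pt d)] (hK : IsSimplex K)
    {x₀ : Pt d} {n : Pt d}
    (h0 : ∀ x, bary K a x = 0 ↔ x - x₀ ∈ (ℝ ∙ n)ᗮ) (ha : a ∈ K) (hb : b ∈ K.erase a) :
    volume {y : ↥(ℝ ∙ n)ᗮ | bary K b (x₀ + (y : Pt d)) = 0} = 0 := by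
  have hba := Finset.ne_of_mem_erase hb
  have hbK := Finset.mem_of_mem_erase hb
  let f : ↥(ℝ ∙ n)ᗮ →ᵃ[ℝ] ℝ := (bary K b).comp
    (AffineMap.const ℝ _ x₀ + (ℝ ∙ n)ᗮ.subtype.toAffineMap)
  have hf : ∀ y : ↥(ℝ ∙ n)ᗮ, f y = bary K b (x₀ + (y : Pt d)) := fun y => rfl
  have := volume_affine_zero f (z := ⟨b - x₀, (h0 b).1 (hK.bary_of_ne ha hbK hba.symm)⟩) (by
    rw [hf]; simp [hK.bary_self hbK])
  simpa only [hf] using this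

theorem isFiniteMeasure_restrict_hull (x₀ n : Pt d) :
    IsFiniteMeasure (volume.restrict {y : ↥(ℝ ∙ n)ᗮ | x₀ + (y : Pt d) ∈ hull e}) := by
  constructor
  rw [Measure.restrict_apply_univ]
  have : IsCompact {y : ↥(ℝ ∙ n)ᗮ | x₀ + (y : Pt d) ∈ hull e} := by
    have hcl : Topology.IsClosedEmbedding fun y : ↥(ℝ ∙ n)ᗮ => x₀ + (y : Pt d) :=
      (isometry_translate n x₀).isClosedEmbedding
    exact hcl.isCompact_preimage (isCompact_hull e)
  exact this.measure_lt_top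

theorem IsSimplex.isFiniteMeasure_faceMeasure (hd : 1 ≤ d) (hK : IsSimplex K)
    (he : e ∈ K.powersetCard d) : IsFiniteMeasure (faceMeasure e) := by
  classical
  obtain ⟨a, ha, rfl⟩ := hK.mem_powersetCard.1 he
  obtain ⟨x₀, -, -, h0⟩ := hK.exists_base hd ha
  rw [hK.faceMeasure_eq hd ha h0]
  have := isFiniteMeasure_restrict_hull (e := K.erase a) x₀ (outwardNormal K (K.erase a))
  infer_instance

/-- Almost every point of a face lies in its relative interior. -/
theorem IsSimplex.ae_faceMeasure [DecidableEq (Pt d)] (hd : 1 ≤ d) (hK : IsSimplex K) (ha : a ∈ K) :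
    ∀ᵐ x ∂faceMeasure (K.erase a), bary K a x = 0 ∧ ∀ b ∈ K.erase a, 0 < bary K b x := by
  obtain ⟨x₀, -, -, h0⟩ := hK.exists_base hd ha
  have h1 : ∀ᵐ x ∂faceMeasure (K.erase a), x ∈ hull (K.erase a) :=
    ae_restrict_mem (isClosed_hull _).measurableSet
  have h2 : ∀ b ∈ K.erase a, ∀ᵐ x ∂faceMeasure (K.erase a), bary K b x ≠ 0 := by
    intro b hb
    have hcont : Continuous (bary K b) := (bary K b).continuous_of_finiteDimensional
    rw [hK.faceMeasure_eq hd ha h0]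
    refine (ae_map_iff (isometry_translate _ x₀).continuous.aemeasurable
      (hcont.measurable (measurableSet_singleton 0).compl)).2 (ae_restrict_of_ae ?_)
    rw [ae_iff]
    simpa using hK.volume_bary_eq_zero h0 ha hb
  rw [← Finset.eventually_all] at h2
  filter_upwards [h1, h2] with x hx hx2
  have := (hK.mem_hull_erase ha).1 hx
  exact ⟨this.1, fun b hb => lt_of_le_of_ne (this.2 b hb) (hx2 b hb).symm⟩

theorem IsSimplex.sum_powersetCard [DecidableEq (Pt d)] (hK : IsSimplex K) {M : Type*}
    [AddCommMonoid M] (F : Finset (Pt d) → M) :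
    ∑ e ∈ K.powersetCard d, F e = ∑ a ∈ K, F (K.erase a) := by
  symm
  refine Finset.sum_bij (fun a _ => K.erase a) (fun a ha => hK.mem_powersetCard.2 ⟨a, ha, rfl⟩)
    ?_ ?_ (fun a ha => rfl)
  · intro a ha b hb h
    exact (Finset.erase_inj K ha).1 h
  · intro e he
    obtain ⟨a, ha, h⟩ := hK.mem_powersetCard.1 he
    exact ⟨a, ha, h.symm⟩

end FaceMeasure

/-! ### The divergence theorem on a simplex by barycentric cut-offs. -/

section Cutoff

local notation "η" => Real.smoothTransition

theorem deriv_smoothTransition_of_neg {t : ℝ} (ht : t < 0) : deriv η t = 0 := by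
  have : η =ᶠ[𝓝 t] fun _ => 0 := by
    filter_upwards [Iio_mem_nhds ht] with s hs using
      Real.smoothTransition.zero_of_nonpos (le_of_lt hs)
  rw [this.deriv_eq, deriv_const]

theorem deriv_smoothTransition_of_one_lt {t : ℝ} (ht : 1 < t) : deriv η t = 0 := by
  have : η =ᶠ[𝓝 t] fun _ => 1 := by
    filter_upwards [Ioi_mem_nhds ht] with s hs using
      Real.smoothTransition.one_of_one_le (le_of_lt hs)
  rw [this.deriv_eq, deriv_const]

theorem deriv_smoothTransition_eq_zero {t : ℝ} (ht : t ∉ Set.Icc (0 : ℝ) 1) : deriv η t = 0 := by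
  rw [Set.mem_Icc, not_and_or, not_le, not_le] at ht
  exact ht.elim deriv_smoothTransition_of_neg deriv_smoothTransition_of_one_lt

theorem continuous_deriv_smoothTransition : Continuous (deriv η) :=
  (Real.smoothTransition.contDiff (n := 1)).continuous_deriv le_rfl

theorem hasCompactSupport_deriv_smoothTransition : HasCompactSupport (deriv η) :=
  HasCompactSupport.intro isCompact_Icc fun _ => deriv_smoothTransition_eq_zero

theorem hasDerivAt_smoothTransition (t : ℝ) : HasDerivAt η (deriv η t) t :=
  ((Real.smoothTransition.contDiff (n := 1)).differentiable one_ne_zero t).hasDerivAt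

theorem integrable_deriv_smoothTransition : Integrable (deriv η) :=
  continuous_deriv_smoothTransition.integrable_of_hasCompactSupport
    hasCompactSupport_deriv_smoothTransition

/-- η rises from 0 to 1. This normalisation is what gives the limit surface measure the constant 1.
-/
theorem integral_deriv_smoothTransition : ∫ t, deriv η t = 1 := by
  have h := integral_of_hasDerivAt_of_tendsto (f := η) (f' := deriv η) (m := 0) (n := 1)
    hasDerivAt_smoothTransition integrable_deriv_smoothTransition ?_ ?_
  · rw [h, sub_zero]
  · refine tendsto_const_nhds.congr' ?_
    filter_upwards [eventually_le_atBot 0] with s hs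
    exact (Real.smoothTransition.zero_of_nonpos hs).symm
  · refine tendsto_const_nhds.congr' ?_
    filter_upwards [eventually_ge_atTop 1] with s hs
    exact (Real.smoothTransition.one_of_one_le hs).symm

theorem exists_bound_deriv_smoothTransition : ∃ M, ∀ t, |deriv η t| ≤ M :=
  hasCompactSupport_deriv_smoothTransition.exists_bound_of_continuous
    continuous_deriv_smoothTransition

variable {d : ℕ} {K : Finset (Pt d)} {a b : Pt d}

theorem continuous_bary (K : Finset (Pt d)) (a : Pt d) : Continuous (bary K a) :=
  (bary K a).continuous_of_finiteDimensional

/-- The product of the cut-offs `η (λ_b / ε)` over the vertices in `s`. -/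
def cutoff (K s : Finset (Pt d)) (ε : ℝ) (x : Pt d) : ℝ := ∏ b ∈ s, η (bary K b x / ε)

theorem continuous_cutoff (K s : Finset (Pt d)) (ε : ℝ) : Continuous (cutoff K s ε) :=
  continuous_finsetProd _ fun b _ =>
    Real.smoothTransition.continuous.comp ((continuous_bary K b).div_const ε)

theorem cutoff_nonneg (K s : Finset (Pt d)) (ε : ℝ) (x : Pt d) : 0 ≤ cutoff K s ε x :=
  Finset.prod_nonneg fun _ _ => Real.smoothTransition.nonneg _

theorem cutoff_le_one (K s : Finset (Pt d)) (ε : ℝ) (x : Pt d) : cutoff K s ε x ≤ 1 :=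
  Finset.prod_le_one (fun _ _ => Real.smoothTransition.nonneg _)
    fun _ _ => Real.smoothTransition.le_one _

theorem cutoff_eq_zero {s : Finset (Pt d)} {ε : ℝ} (hε : 0 < ε) {x : Pt d} (hb : b ∈ s)
    (h : bary K b x ≤ 0) : cutoff K s ε x = 0 :=
  Finset.prod_eq_zero hb
    (Real.smoothTransition.zero_of_nonpos (div_nonpos_of_nonpos_of_nonneg h hε.le))

/-- Eventually z_k > c/2 > 1/(k+1), so the argument of η exceeds 1. -/
theorem eventually_smoothTransition_one {z : ℕ → ℝ} {c : ℝ} (hz : Tendsto z atTop (𝓝 c))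
    (hc : 0 < c) : ∀ᶠ k : ℕ in atTop, η (z k / (1 / ((k : ℝ) + 1))) = 1 := by
  have h1 : ∀ᶠ k : ℕ in atTop, c / 2 < z k := hz.eventually_const_lt (by linarith)
  have h2 : ∀ᶠ k : ℕ in atTop, 1 / ((k : ℝ) + 1) < c / 2 :=
    tendsto_one_div_add_atTop_nhds_zero_nat.eventually_lt_const (by linarith)
  filter_upwards [h1, h2] with k hk1 hk2
  apply Real.smoothTransition.one_of_one_le
  rw [le_div_iff₀ (by positivity)]
  linarith

/-- Limit of the cut-offs along a converging sequence of points. -/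
theorem tendsto_cutoff {s : Finset (Pt d)} {x : Pt d} {z : ℕ → Pt d}
    (hz : Tendsto z atTop (𝓝 x)) (h : ∀ b ∈ s, 0 < bary K b x) :
    ∀ᶠ k : ℕ in atTop, cutoff K s (1 / ((k : ℝ) + 1)) (z k) = 1 := by
  have : ∀ᶠ k : ℕ in atTop, ∀ b ∈ s, η (bary K b (z k) / (1 / ((k : ℝ) + 1))) = 1 := by
    rw [Finset.eventually_all]
    exact fun b hb => eventually_smoothTransition_one
      (((continuous_bary K b).tendsto x).comp hz) (h b hb)
  filter_upwards [this] with k hk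
  exact Finset.prod_eq_one hk

theorem tendsto_cutoff_zero {s : Finset (Pt d)} {x : Pt d} {z : ℕ → Pt d}
    (hz : Tendsto z atTop (𝓝 x)) (hb : b ∈ s) (h : bary K b x < 0) :
    ∀ᶠ k : ℕ in atTop, cutoff K s (1 / ((k : ℝ) + 1)) (z k) = 0 := by
  have h1 : ∀ᶠ k : ℕ in atTop, bary K b (z k) < 0 :=
    (((continuous_bary K b).tendsto x).comp hz).eventually_lt_const h
  filter_upwards [h1] with k hk
  exact cutoff_eq_zero (by positivity) hb hk.le

/-- The derivative of the cut-off, concentrated near the face opposite to `a`, converges to the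
surface measure of that face. -/
theorem IsSimplex.tendsto_integral_face [DecidableEq (Pt d)] (hd : 1 ≤ d) (hK : IsSimplex K)
    (ha : a ∈ K) {w : Pt d → ℝ} (hw : Continuous w) :
    Tendsto (fun k : ℕ => ∫ x, (-(bary K a).linear (outwardNormal K (K.erase a))
        / (1 / ((k : ℝ) + 1))) * (w x * deriv η (bary K a x / (1 / ((k : ℝ) + 1))) *
          cutoff K (K.erase a) (1 / ((k : ℝ) + 1)) x))
      atTop (𝓝 (∫ x, w x ∂faceMeasure (K.erase a))) := by
  obtain ⟨hn, hnL, hneg⟩ := hK.outwardNormal_spec hd ha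
  obtain ⟨x₀, hx₀, hbx₀, h0⟩ := hK.exists_base hd ha
  have hface := hK.faceMeasure_eq hd ha h0
  have hker := hK.ker_bary hd ha
  set n := outwardNormal K (K.erase a) with hndef
  set l : ℝ := -(bary K a).linear n with hl
  have hlpos : 0 < l := by linarith
  set ε : ℕ → ℝ := fun k => 1 / ((k : ℝ) + 1) with hε
  have hεpos : ∀ k, 0 < ε k := fun k => by simp only [hε]; positivity
  have hεle : ∀ k, ε k ≤ 1 := fun k => by
    simp only [hε]; rw [div_le_one (by positivity)]; linarith [(Nat.cast_nonneg k : (0 : ℝ) ≤ k)]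
  have hεlim : Tendsto ε atTop (𝓝 0) := tendsto_one_div_add_atTop_nhds_zero_nat
  -- Coordinates of the boundary layer: as λ_a has slope −l along the outward normal, moving inwards
  -- by εt/l gives λ_a = εt. Hence η'(λ_a/ε) becomes η'(t), independent of ε, and the prefactor l/ε
  -- is cancelled by the Jacobian.
  let Ψ : ℕ → ℝ × ↥(ℝ ∙ n)ᗮ → Pt d := fun k p => x₀ + ((-(ε k / l)) * p.1) • n + (p.2 : Pt d)
  have hΨa : ∀ k p, bary K a (Ψ k p) / ε k = p.1 := by
    intro k p
    have hp2 : (bary K a).linear (p.2 : Pt d) = 0 := by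
      rw [← LinearMap.mem_ker, hker]; exact p.2.2
    simp only [Ψ, affine_add, hbx₀, map_smul, hp2, smul_eq_mul]
    have : (bary K a).linear n = -l := by rw [hl]; ring
    rw [this]
    have := (hεpos k).ne'
    field_simp
    ring
  let F : ℕ → ℝ × ↥(ℝ ∙ n)ᗮ → ℝ := fun k p =>
    w (Ψ k p) * deriv η p.1 * cutoff K (K.erase a) (ε k) (Ψ k p)
  have hΨcont : ∀ k, Continuous (Ψ k) := fun k => continuous_slice n x₀ _
  have hstep : ∀ k, ∫ x, (l / ε k) * (w x * deriv η (bary K a x / ε k) *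
      cutoff K (K.erase a) (ε k) x) = ∫ p, F k p ∂(volume.prod volume) := by
    intro k
    have h := integral_slice hn x₀ (c := -(ε k / l))
      (neg_ne_zero.2 (div_pos (hεpos k) hlpos).ne')
      (fun x => w x * deriv η (bary K a x / ε k) * cutoff K (K.erase a) (ε k) x)
    rw [integral_const_mul, ← show |(-(ε k / l))⁻¹| = l / ε k by
      rw [inv_neg, abs_neg, inv_div, abs_of_pos (div_pos hlpos (hεpos k))], ← h]
    refine integral_congr_ae (Eventually.of_forall fun p => ?_)
    change w (Ψ k p) * deriv η (bary K a (Ψ k p) / ε k) * cutoff K (K.erase a) (ε k) (Ψ k p) = _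
    rw [hΨa]
  refine Tendsto.congr (fun k => (hstep k).symm) ?_
  -- The expected limit is a product in (t, y), so its t-integral is ∫η' = 1.
  have hlim : ∫ x, w x ∂faceMeasure (K.erase a) = ∫ p : ℝ × ↥(ℝ ∙ n)ᗮ, deriv η p.1 *
      Set.indicator {y : ↥(ℝ ∙ n)ᗮ | x₀ + (y : Pt d) ∈ hull (K.erase a)}
        (fun y => w (x₀ + (y : Pt d))) p.2 ∂(volume.prod volume) := by
    have hms : MeasurableSet {y : ↥(ℝ ∙ n)ᗮ | x₀ + (y : Pt d) ∈ hull (K.erase a)} :=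
      (isometry_translate n x₀).continuous.measurable (isClosed_hull _).measurableSet
    rw [integral_prod_mul (deriv η), integral_deriv_smoothTransition, one_mul,
      integral_indicator hms,
      hface, integral_map (isometry_translate n x₀).continuous.aemeasurable
        hw.aestronglyMeasurable]
  rw [hlim]
  obtain ⟨C, hC⟩ := (isCompact_hull K).exists_bound_of_continuousOn hw.continuousOn
  obtain ⟨M, hM⟩ := exists_bound_deriv_smoothTransition
  obtain ⟨R, hR⟩ := (isCompact_hull K).isBounded.subset_closedBall x₀
  -- A compact set containing the supports of all the integrands: nonzero values force t ∈ [0,1] and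
  -- a point of `K`, which lies within `R` of x₀, while the normal shift is at most ε/l ≤ 1/l.
  let S : Set (ℝ × ↥(ℝ ∙ n)ᗮ) := Set.Icc (0 : ℝ) 1 ×ˢ Metric.closedBall 0 (R + 1 / l)
  have hS : IsCompact S := isCompact_Icc.prod (isCompact_closedBall _ _)
  refine tendsto_integral_of_dominated_convergence (S.indicator fun _ => |C| * |M|) ?_ ?_ ?_ ?_
  · intro k
    refine Continuous.aestronglyMeasurable ?_
    exact ((hw.comp (hΨcont k)).mul (continuous_deriv_smoothTransition.comp continuous_fst)).mul
      ((continuous_cutoff _ _ _).comp (hΨcont k))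
  · rw [integrable_indicator_iff hS.measurableSet]
    exact integrableOn_const hS.measure_lt_top.ne
  · intro k
    refine Eventually.of_forall fun p => ?_
    by_cases hF : F k p = 0
    · rw [hF, norm_zero]
      exact Set.indicator_nonneg (fun _ _ => by positivity) _
    have ht : p.1 ∈ Set.Icc (0 : ℝ) 1 := by
      by_contra h
      exact hF (by simp only [F, deriv_smoothTransition_eq_zero h, mul_zero, zero_mul])
    have hxK : Ψ k p ∈ hull K := by
      rw [hK.mem_hull]
      intro b hb
      by_cases hba : b = a
      · rw [hba]
        have := hΨa k p
        rw [div_eq_iff (hεpos k).ne'] at this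
        rw [this]
        exact mul_nonneg ht.1 (hεpos k).le
      · by_contra hneg
        exact hF (by
          simp only [F, cutoff_eq_zero (hεpos k) (Finset.mem_erase.2 ⟨hba, hb⟩)
            (not_le.1 hneg).le, mul_zero])
    have hpS : p ∈ S := by
      refine ⟨ht, ?_⟩
      rw [mem_closedBall_zero_iff]
      have h1 := hR hxK
      rw [mem_closedBall_iff_norm] at h1
      have h2 : (p.2 : Pt d) = (Ψ k p - x₀) + ((ε k / l) * p.1) • n := by
        simp only [Ψ, neg_mul, neg_smul]; abel
      have h3 : ‖(p.2 : Pt d)‖ ≤ R + 1 / l := by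
        rw [h2]
        refine (norm_add_le _ _).trans (add_le_add h1 ?_)
        rw [norm_smul, hn, mul_one, Real.norm_eq_abs, abs_of_nonneg
          (mul_nonneg (div_pos (hεpos k) hlpos).le ht.1)]
        calc ε k / l * p.1 ≤ ε k / l * 1 :=
              mul_le_mul_of_nonneg_left ht.2 (div_pos (hεpos k) hlpos).le
          _ ≤ 1 / l := by rw [mul_one]; exact div_le_div_of_nonneg_right (hεle k) hlpos.le
      exact h3
    rw [Set.indicator_of_mem hpS, norm_mul, norm_mul]
    have hc := cutoff_nonneg K (K.erase a) (ε k) (Ψ k p)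
    have hc1 := cutoff_le_one K (K.erase a) (ε k) (Ψ k p)
    rw [Real.norm_eq_abs (cutoff _ _ _ _), abs_of_nonneg hc]
    calc _ ≤ ‖w (Ψ k p)‖ * ‖deriv η p.1‖ * 1 := by gcongr
      _ ≤ |C| * |M| := by
        rw [mul_one]
        exact mul_le_mul ((hC _ hxK).trans (le_abs_self C)) ((hM _).trans (le_abs_self M))
          (norm_nonneg _) (abs_nonneg _)
  · have hae : ∀ᵐ p : ℝ × ↥(ℝ ∙ n)ᗮ ∂(volume.prod volume),
        ∀ b ∈ K.erase a, bary K b (x₀ + (p.2 : Pt d)) ≠ 0 := by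
      rw [Finset.eventually_all]
      intro b hb
      refine Measure.quasiMeasurePreserving_snd.ae (p := fun y : ↥(ℝ ∙ n)ᗮ =>
        bary K b (x₀ + (y : Pt d)) ≠ 0) ?_
      rw [ae_iff]
      simpa using hK.volume_bary_eq_zero h0 ha hb
    filter_upwards [hae] with p hp
    have hΨlim : Tendsto (fun k => Ψ k p) atTop (𝓝 (x₀ + (p.2 : Pt d))) := by
      have : Tendsto (fun k => x₀ + ((-(ε k / l)) * p.1) • n + (p.2 : Pt d)) atTop
          (𝓝 (x₀ + ((-(0 / l)) * p.1) • n + (p.2 : Pt d))) :=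
        ((tendsto_const_nhds.add ((((hεlim.div_const l).neg).mul_const p.1).smul_const n))).add_const
          _
      simpa [Ψ] using this
    have hwlim : Tendsto (fun k => w (Ψ k p)) atTop (𝓝 (w (x₀ + (p.2 : Pt d)))) :=
      (hw.tendsto _).comp hΨlim
    have h0y : bary K a (x₀ + (p.2 : Pt d)) = 0 := by
      rw [h0, add_sub_cancel_left]; exact p.2.2
    -- Almost every y has no vanishing facet coordinate. Either all are positive and the cut-offs
    -- are eventually 1, or one is negative and the product is eventually 0.
    by_cases hpos : ∀ b ∈ K.erase a, 0 < bary K b (x₀ + (p.2 : Pt d))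
    · have hmem : p.2 ∈ {y : ↥(ℝ ∙ n)ᗮ | x₀ + (y : Pt d) ∈ hull (K.erase a)} :=
        (hK.mem_hull_erase ha).2 ⟨h0y, fun b hb => (hpos b hb).le⟩
      rw [Set.indicator_of_mem hmem, mul_comm (deriv η p.1)]
      refine (hwlim.mul_const (deriv η p.1)).congr' ?_
      filter_upwards [tendsto_cutoff hΨlim hpos] with k hk
      simp only [F]
      rw [hk, mul_one]
    · push Not at hpos
      obtain ⟨b, hb, hb0⟩ := hpos
      have hb0 := lt_of_le_of_ne hb0 (hp b hb)
      have hmem : p.2 ∉ {y : ↥(ℝ ∙ n)ᗮ | x₀ + (y : Pt d) ∈ hull (K.erase a)} := fun h =>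
        absurd (((hK.mem_hull_erase ha).1 h).2 b hb) (not_le.2 hb0)
      rw [Set.indicator_of_notMem hmem, mul_zero]
      refine tendsto_const_nhds.congr' ?_
      filter_upwards [tendsto_cutoff_zero hΨlim hb hb0] with k hk
      simp only [F]
      rw [hk, mul_zero]

theorem hasFDerivAt_bary (K : Finset (Pt d)) (a x : Pt d) :
    HasFDerivAt (bary K a) (bary K a).linear.toContinuousLinearMap x := by
  have h : ⇑(bary K a) = fun y => (bary K a).linear.toContinuousLinearMap y + bary K a 0 := by
    funext y
    have := affine_add (bary K a) 0 y
    rw [zero_add, add_comm] at this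
    exact this
  rw [h]
  exact (ContinuousLinearMap.hasFDerivAt _).add_const _

/-- Product rule: the summand of `a` is carried by the layer 0 ≤ λ_a ≤ ε and keeps the cut-offs of
the remaining vertices. -/
theorem hasFDerivAt_cutoff [DecidableEq (Pt d)] (K s : Finset (Pt d)) (ε : ℝ) (x : Pt d) :
    HasFDerivAt (cutoff K s ε) (∑ a ∈ s, cutoff K (s.erase a) ε x •
      ((deriv η (bary K a x / ε) * ε⁻¹) • (bary K a).linear.toContinuousLinearMap)) x := by
  refine HasFDerivAt.finsetProd fun a _ => ?_
  have h1 : HasDerivAt (fun t => η (t / ε)) (deriv η (bary K a x / ε) * ε⁻¹) (bary K a x) := by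
    have := (hasDerivAt_smoothTransition (bary K a x / ε)).comp (bary K a x)
      ((hasDerivAt_id (bary K a x)).div_const ε)
    rwa [one_div] at this
  exact h1.comp_hasFDerivAt x (hasFDerivAt_bary K a x)

theorem fderiv_cutoff_apply [DecidableEq (Pt d)] (K s : Finset (Pt d)) (ε : ℝ) (x v : Pt d) :
    fderiv ℝ (cutoff K s ε) x v = ∑ a ∈ s, cutoff K (s.erase a) ε x *
      (deriv η (bary K a x / ε) * ε⁻¹ * (bary K a).linear v) := by
  rw [(hasFDerivAt_cutoff K s ε x).fderiv]
  simp

/-- The divergence theorem on a simplex, in the direction `v`. -/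
theorem IsSimplex.integral_fderiv (hd : 1 ≤ d) (hK : IsSimplex K) {w : Pt d → ℝ}
    (hw : ContDiff ℝ 1 w) (v : Pt d) :
    ∫ x in hull K, fderiv ℝ w x v =
      ∑ e ∈ K.powersetCard d, (∫ x, w x ∂faceMeasure e) * ⟪v, outwardNormal K e⟫ := by
  classical
  rw [hK.sum_powersetCard]
  set ε : ℕ → ℝ := fun k => 1 / ((k : ℝ) + 1) with hε
  have hεpos : ∀ k, 0 < ε k := fun k => by simp only [hε]; positivity
  have hdw : Continuous fun x => fderiv ℝ w x v :=
    (hw.continuous_fderiv one_ne_zero).clm_apply continuous_const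
  have hsupp : ∀ k x, x ∉ hull K → cutoff K K (ε k) x = 0 := by
    intro k x hx
    rw [hK.mem_hull] at hx
    push Not at hx
    obtain ⟨b, hb, hb0⟩ := hx
    exact cutoff_eq_zero (hεpos k) hb hb0.le
  have hcomp : ∀ k, HasCompactSupport (cutoff K K (ε k)) := fun k =>
    HasCompactSupport.intro (isCompact_hull K) (hsupp k)
  have hterm : ∀ k a x, a ∈ K → x ∉ hull K →
      deriv η (bary K a x / ε k) * cutoff K (K.erase a) (ε k) x = 0 := by
    intro k a x ha hx
    by_contra h
    rw [mul_eq_zero, not_or] at h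
    refine hx (hK.mem_hull.2 fun b hb => ?_)
    by_cases hba : b = a
    · rw [hba]
      by_contra hneg
      exact h.1 (deriv_smoothTransition_of_neg (div_neg_of_neg_of_pos (not_le.1 hneg) (hεpos k)))
    · by_contra hneg
      exact h.2 (cutoff_eq_zero (hεpos k) (Finset.mem_erase.2 ⟨hba, hb⟩) (not_le.1 hneg).le)
  have htermcont : ∀ k a, Continuous fun x =>
      w x * deriv η (bary K a x / ε k) * cutoff K (K.erase a) (ε k) x := fun k a =>
    (hw.continuous.mul (continuous_deriv_smoothTransition.comp
      ((continuous_bary K a).div_const _))).mul (continuous_cutoff _ _ _)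
  have htermint : ∀ k, ∀ a ∈ K, Integrable fun x =>
      w x * deriv η (bary K a x / ε k) * cutoff K (K.erase a) (ε k) x := fun k a ha =>
    (htermcont k a).integrable_of_hasCompactSupport (HasCompactSupport.intro (isCompact_hull K)
      fun x hx => by rw [mul_assoc, hterm k a x ha hx, mul_zero])
  -- The derivative of λ_a in the direction `v` equals ⟪v, n⟫ times its derivative along the normal
  -- n, which brings out the factor of the boundary term.
  have hfd : ∀ k x, fderiv ℝ (cutoff K K (ε k)) x v * w x = -∑ a ∈ K,
      ⟪v, outwardNormal K (K.erase a)⟫ * ((-(bary K a).linear (outwardNormal K (K.erase a)) / ε k) *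
        (w x * deriv η (bary K a x / ε k) * cutoff K (K.erase a) (ε k) x)) := by
    intro k x
    rw [fderiv_cutoff_apply, Finset.sum_mul, ← Finset.sum_neg_distrib]
    refine Finset.sum_congr rfl fun a ha => ?_
    obtain ⟨h1, h2, -⟩ := hK.outwardNormal_spec hd ha
    rw [linear_eq_inner_mul h1 h2 v]
    have := (hεpos k).ne'
    field_simp
  have hibp : ∀ k, ∫ x, cutoff K K (ε k) x * fderiv ℝ w x v = ∑ a ∈ K,
      ⟪v, outwardNormal K (K.erase a)⟫ * ∫ x,
        (-(bary K a).linear (outwardNormal K (K.erase a)) / ε k) *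
        (w x * deriv η (bary K a x / ε k) * cutoff K (K.erase a) (ε k) x) := by
    intro k
    have hint : Integrable fun x => fderiv ℝ (cutoff K K (ε k)) x v * w x := by
      simp only [hfd]
      exact (integrable_finsetSum _ fun a ha =>
        (((htermint k a ha).const_mul _).const_mul _)).neg
    rw [integral_mul_fderiv_eq_neg_fderiv_mul_of_integrable hint
      (((continuous_cutoff _ _ _).mul hdw).integrable_of_hasCompactSupport (hcomp k).mul_right)
      (((continuous_cutoff _ _ _).mul hw.continuous).integrable_of_hasCompactSupport
        (hcomp k).mul_right)
      (fun x _ => (hasFDerivAt_cutoff K K (ε k) x).differentiableAt)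
      (fun x _ => hw.differentiable one_ne_zero x)]
    simp only [hfd]
    rw [integral_neg, neg_neg, integral_finsetSum _ fun a ha =>
        (((htermint k a ha).const_mul _).const_mul _)]
    simp only [integral_const_mul]
  -- The full cut-off tends to 1 in the interior and is 0 outside `K`; the frontier of a convex set
  -- is null.
  have hlim1 : Tendsto (fun k => ∫ x, cutoff K K (ε k) x * fderiv ℝ w x v) atTop
      (𝓝 (∫ x in hull K, fderiv ℝ w x v)) := by
    have hnull : volume (frontier (hull K)) = 0 := (convex_hull K).addHaar_frontier volume
    obtain ⟨C, hC⟩ := (isCompact_hull K).exists_bound_of_continuousOn hdw.continuousOn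
    rw [← integral_indicator (isClosed_hull K).measurableSet]
    refine tendsto_integral_of_dominated_convergence ((hull K).indicator fun _ => |C|) ?_ ?_ ?_ ?_
    · exact fun k => ((continuous_cutoff _ _ _).mul hdw).aestronglyMeasurable
    · rw [integrable_indicator_iff (isClosed_hull K).measurableSet]
      exact integrableOn_const (isCompact_hull K).measure_lt_top.ne
    · intro k
      refine Eventually.of_forall fun x => ?_
      by_cases hx : x ∈ hull K
      · rw [Set.indicator_of_mem hx, norm_mul, Real.norm_eq_abs,
          abs_of_nonneg (cutoff_nonneg _ _ _ _)]
        calc _ ≤ 1 * ‖fderiv ℝ w x v‖ := by gcongr; exact cutoff_le_one _ _ _ _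
          _ ≤ |C| := by rw [one_mul]; exact (hC x hx).trans (le_abs_self C)
      · rw [hsupp k x hx, zero_mul, norm_zero, Set.indicator_of_notMem hx]
    · filter_upwards [measure_eq_zero_iff_ae_notMem.1 hnull] with x hx
      by_cases hxK : x ∈ hull K
      · have hxi : x ∈ interior (hull K) := by
          by_contra h; exact hx ⟨subset_closure hxK, h⟩
        rw [hK.interior_hull] at hxi
        rw [Set.indicator_of_mem hxK]
        refine tendsto_const_nhds.congr' ?_
        filter_upwards [tendsto_cutoff (K := K) (s := K) (z := fun _ => x) tendsto_const_nhds hxi]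
          with k hk
        rw [hk, one_mul]
      · rw [Set.indicator_of_notMem hxK]
        refine tendsto_const_nhds.congr fun k => ?_
        rw [hsupp k x hxK, zero_mul]
  refine tendsto_nhds_unique hlim1 ?_
  simp only [hibp]
  refine tendsto_finsetSum _ fun a ha => ?_
  rw [mul_comm]
  exact (hK.tendsto_integral_face hd ha hw.continuous).const_mul _

end Cutoff

/-! ### Products of L² functions and their limits. -/

section LTwo

variable {X : Type*} [MeasurableSpace X] {μ : Measure X}

/-- The integral of a product is continuous for `L²` convergence of the factors. -/
theorem tendsto_integral_mul {f g : X → ℝ} {F G : ℕ → X → ℝ} (hf : MemLp f 2 μ) (hg : MemLp g 2 μ)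
    (hF : ∀ n, MemLp (F n) 2 μ) (hG : ∀ n, MemLp (G n) 2 μ)
    (hFf : Tendsto (fun n => eLpNorm (F n - f) 2 μ) atTop (𝓝 0))
    (hGg : Tendsto (fun n => eLpNorm (G n - g) 2 μ) atTop (𝓝 0)) :
    Tendsto (fun n => ∫ x, F n x * G n x ∂μ) atTop (𝓝 (∫ x, f x * g x ∂μ)) := by
  have key : ∀ {a b : X → ℝ} (ha : MemLp a 2 μ) (hb : MemLp b 2 μ),
      ⟪ha.toLp a, hb.toLp b⟫ = ∫ x, a x * b x ∂μ := by
    intro a b ha hb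
    rw [L2.inner_def]
    refine integral_congr_ae ?_
    filter_upwards [ha.coeFn_toLp, hb.coeFn_toLp] with x h1 h2
    rw [h1, h2]
    simp [mul_comm]
  have h1 := (Lp.tendsto_Lp_iff_tendsto_eLpNorm'' F hF f hf).2 hFf
  have h2 := (Lp.tendsto_Lp_iff_tendsto_eLpNorm'' G hG g hg).2 hGg
  have h3 := h1.inner h2 (𝕜 := ℝ)
  simpa only [key] using h3

theorem _root_.MeasureTheory.MemLp.integrable_mul_two {f g : X → ℝ} (hf : MemLp f 2 μ)
    (hg : MemLp g 2 μ) :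
    Integrable (fun x => f x * g x) μ :=
  MemLp.integrable_mul hf hg

theorem memLp_of_continuous_of_compact {E : Type*} [NormedAddCommGroup E] {d : ℕ}
    {μ : Measure (Pt d)} [IsFiniteMeasure μ] {C : Set (Pt d)} (hC : IsCompact C)
    (hμ : ∀ᵐ x ∂μ, x ∈ C) {f : Pt d → E} [SecondCountableTopology E] (hf : Continuous f) :
    MemLp f 2 μ := by
  obtain ⟨B, hB⟩ := hC.exists_bound_of_continuousOn hf.continuousOn
  exact MemLp.of_bound hf.aestronglyMeasurable B (hμ.mono fun x hx => hB x hx)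

theorem eLpNorm_component_le {d : ℕ} (f : X → Pt d) (i : Fin d) :
    eLpNorm (fun x => f x i) 2 μ ≤ eLpNorm f 2 μ :=
  eLpNorm_mono fun x => PiLp.norm_apply_le (f x) i

theorem _root_.MeasureTheory.MemLp.inner_two {d : ℕ} {f g : X → Pt d} (hf : MemLp f 2 μ)
    (hg : MemLp g 2 μ) :
    Integrable (fun x => ⟪f x, g x⟫) μ := by
  have h : (fun x => ⟪f x, g x⟫) = fun x => ∑ i, f x i * g x i := by
    funext x; simp [PiLp.inner_apply, mul_comm]
  rw [h]
  exact integrable_finsetSum _ fun i _ => (hf.eval_piLp i).integrable_mul_two (hg.eval_piLp i)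

end LTwo

/-! ### Green's formula in H¹ of a simplex. -/

section Green

variable {d : ℕ} {K e : Finset (Pt d)}

theorem gradient_apply (f : Pt d → ℝ) (x : Pt d) (i : Fin d) :
    gradient f x i = fderiv ℝ f x (EuclideanSpace.single i 1) := by
  rw [← inner_gradient_left, EuclideanSpace.inner_single_right]
  simp

theorem continuous_gradient {f : Pt d → ℝ} (hf : ContDiff ℝ 1 f) : Continuous (gradient f) :=
  (InnerProductSpace.toDual ℝ (Pt d)).symm.continuous.comp (hf.continuous_fderiv one_ne_zero)

theorem ae_mem_hull (K : Finset (Pt d)) : ∀ᵐ x ∂volume.restrict (hull K), x ∈ hull K :=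
  ae_restrict_mem (isClosed_hull K).measurableSet

theorem ae_faceMeasure_mem_hull (e : Finset (Pt d)) : ∀ᵐ x ∂faceMeasure e, x ∈ hull e :=
  ae_restrict_mem (isClosed_hull e).measurableSet

instance isFiniteMeasure_restrict_volume_hull (K : Finset (Pt d)) :
    IsFiniteMeasure ((volume : Measure (Pt d)).restrict (hull K)) :=
  ⟨by rw [Measure.restrict_apply_univ]; exact (isCompact_hull K).measure_lt_top⟩

theorem memLp_hull {E : Type*} [NormedAddCommGroup E] [SecondCountableTopology E]
    (K : Finset (Pt d)) {f : Pt d → E} (hf : Continuous f) :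
    MemLp f 2 (volume.restrict (hull K)) :=
  memLp_of_continuous_of_compact (isCompact_hull K) (ae_mem_hull K) hf

theorem IsSimplex.memLp_face {E : Type*} [NormedAddCommGroup E] [SecondCountableTopology E]
    (hd : 1 ≤ d) (hK : IsSimplex K) (he : e ∈ K.powersetCard d) {f : Pt d → E}
    (hf : Continuous f) : MemLp f 2 (faceMeasure e) := by
  have := hK.isFiniteMeasure_faceMeasure hd he
  exact memLp_of_continuous_of_compact (isCompact_hull e) (ae_faceMeasure_mem_hull e) hf

theorem memLp_gradient_component {f : Pt d → ℝ} (hf : ContDiff ℝ 1 f) (i : Fin d) :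
    MemLp (fun x => gradient f x i) 2 (volume.restrict (hull K)) :=
  (memLp_hull K (continuous_gradient hf)).eval_piLp i

theorem IsSimplex.green_smooth (hd : 1 ≤ d) (hK : IsSimplex K) {φ ψ : Pt d → ℝ}
    (hφ : ContDiff ℝ 1 φ) (hψ : ContDiff ℝ 1 ψ) (i : Fin d) :
    (∫ x in hull K, gradient φ x i * ψ x) + ∫ x in hull K, φ x * gradient ψ x i
      = ∑ e ∈ K.powersetCard d, (∫ x, φ x * ψ x ∂faceMeasure e) * outwardNormal K e i := by
  have h := hK.integral_fderiv hd (hφ.mul hψ) (EuclideanSpace.single i 1)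
  have hfd : ∀ x, fderiv ℝ (φ * ψ) x (EuclideanSpace.single i 1)
      = gradient φ x i * ψ x + φ x * gradient ψ x i := by
    intro x
    rw [fderiv_mul (hφ.differentiable one_ne_zero x) (hψ.differentiable one_ne_zero x)]
    simp only [add_apply, smul_apply, gradient_apply,
      smul_eq_mul]
    ring
  change ∫ x in hull K, fderiv ℝ (φ * ψ) x (EuclideanSpace.single i 1) = _ at h
  simp only [hfd] at h
  rw [integral_add ((memLp_gradient_component hφ i).integrable_mul_two (memLp_hull K hψ.continuous))
    ((memLp_hull K hφ.continuous).integrable_mul_two (memLp_gradient_component hψ i))] at h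
  rw [h]
  refine Finset.sum_congr rfl fun e _ => ?_
  rw [EuclideanSpace.inner_single_left]
  simp

theorem tendsto_eLpNorm_gradient_component {μ : Measure (Pt d)} {f : ℕ → Pt d → ℝ}
    {g : Pt d → Pt d} (h : Tendsto (fun n => eLpNorm (gradient (f n) - g) 2 μ) atTop (𝓝 0))
    (i : Fin d) :
    Tendsto (fun n => eLpNorm ((fun x => gradient (f n) x i) - fun x => g x i) 2 μ) atTop (𝓝 0) :=
  tendsto_of_tendsto_of_tendsto_of_le_of_le tendsto_const_nhds h (fun _ => zero_le)
    fun n => eLpNorm_component_le (gradient (f n) - g) i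

/-- Green's formula for functions in `H¹` of a simplex. -/
theorem IsSimplex.green (hd : 1 ≤ d) (hK : IsSimplex K) {v w γ δ : Pt d → ℝ} {G H : Pt d → Pt d}
    (hv : HasH1Trace K v G γ) (hw : HasH1Trace K w H δ) (i : Fin d) :
    (∫ x in hull K, G x i * w x) + ∫ x in hull K, v x * H x i
      = ∑ e ∈ K.powersetCard d, (∫ x, γ x * δ x ∂faceMeasure e) * outwardNormal K e i := by
  obtain ⟨hv1, hv2, -, hv3, φ, hφ, hφ1, hφ2, hφ3⟩ := hv
  obtain ⟨hw1, hw2, -, hw3, ψ, hψ, hψ1, hψ2, hψ3⟩ := hw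
  have hle : (1 : WithTop ℕ∞) ≤ ∞ := by exact_mod_cast le_top
  -- All three kinds of integrals are bilinear and continuous for the L² convergences of functions,
  -- gradients and traces, so the formula for the smooth approximations passes to the limit.
  have l1 := tendsto_integral_mul (F := fun n x => gradient (φ n) x i) (G := ψ)
    (hv2.eval_piLp i) hw1 (fun n => memLp_gradient_component ((hφ n).of_le hle) i)
    (fun n => memLp_hull K (hψ n).continuous) (tendsto_eLpNorm_gradient_component hφ2 i) hψ1
  have l2 := tendsto_integral_mul (F := φ) (G := fun n x => gradient (ψ n) x i) hv1
    (hw2.eval_piLp i) (fun n => memLp_hull K (hφ n).continuous)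
    (fun n => memLp_gradient_component ((hψ n).of_le hle) i) hφ1
    (tendsto_eLpNorm_gradient_component hψ2 i)
  have l3 := tendsto_finsetSum (K.powersetCard d) fun e he =>
    (tendsto_integral_mul (F := φ) (G := ψ) (hv3 e he) (hw3 e he)
      (fun n => hK.memLp_face hd he (hφ n).continuous)
      (fun n => hK.memLp_face hd he (hψ n).continuous) (hφ3 e he) (hψ3 e he)).mul_const
      (outwardNormal K e i)
  refine tendsto_nhds_unique (l1.add l2) (l3.congr fun n => ?_)
  exact (hK.green_smooth hd ((hφ n).of_le hle) ((hψ n).of_le hle) i).symm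

/-- Green's formula with a vector field. -/
theorem IsSimplex.green_vector (hd : 1 ≤ d) (hK : IsSimplex K) {v γ : Pt d → ℝ}
    {G τ δ : Pt d → Pt d} {H : Fin d → Pt d → Pt d} (hv : HasH1Trace K v G γ)
    (hτ : ∀ i, HasH1Trace K (fun x => τ x i) (H i) (fun x => δ x i)) :
    (∫ x in hull K, ⟪G x, τ x⟫) + ∫ x in hull K, v x * ∑ i, H i x i
      = ∑ e ∈ K.powersetCard d, ∫ x, γ x * ⟪δ x, outwardNormal K e⟫ ∂faceMeasure e := by
  have h := Finset.sum_congr (s₁ := Finset.univ) rfl fun i _ => hK.green hd hv (hτ i) i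
  rw [Finset.sum_add_distrib, Finset.sum_comm] at h
  rw [← integral_finsetSum _ fun i _ => (hv.2.1.eval_piLp i).integrable_mul_two (hτ i).1,
    ← integral_finsetSum _ fun i _ => hv.1.integrable_mul_two ((hτ i).2.1.eval_piLp i)] at h
  convert h using 1
  · congr 1
    · refine integral_congr_ae (Eventually.of_forall fun x => ?_)
      simp [PiLp.inner_apply, mul_comm]
    · refine integral_congr_ae (Eventually.of_forall fun x => ?_)
      simp [Finset.mul_sum]
  · refine Finset.sum_congr rfl fun e he => ?_
    simp_rw [← integral_mul_const]
    rw [← integral_finsetSum _ fun i _ =>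
      ((hv.2.2.2.1 e he).integrable_mul_two ((hτ i).2.2.2.1 e he)).mul_const _]
    refine integral_congr_ae (Eventually.of_forall fun x => ?_)
    simp only [PiLp.inner_apply, RCLike.inner_apply, conj_trivial, Finset.mul_sum]
    exact Finset.sum_congr rfl fun i _ => by ring

theorem IsSimplex.hull_face_disjoint_interior (hK : IsSimplex K) (he : e ∈ K.powersetCard d)
    {x : Pt d} (hx : x ∈ hull e) : x ∉ interior (hull K) := by
  classical
  obtain ⟨a, ha, rfl⟩ := hK.mem_powersetCard.1 he
  rw [hK.interior_hull]
  intro h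
  have h1 := h a ha
  rw [((hK.mem_hull_erase ha).1 hx).1] at h1
  exact lt_irrefl _ h1

/-- Smooth functions belong to `H¹` of a simplex. -/
theorem IsSimplex.hasH1Trace_smooth (hd : 1 ≤ d) (hK : IsSimplex K) {v : Pt d → ℝ}
    (hv : ContDiff ℝ ∞ v) : HasH1Trace K v (gradient v) v := by
  have hle : (1 : WithTop ℕ∞) ≤ ∞ := by exact_mod_cast le_top
  refine ⟨memLp_hull K hv.continuous, memLp_hull K (continuous_gradient (hv.of_le hle)), ?_,
    fun e he => hK.memLp_face hd he hv.continuous, fun _ => v, fun _ => hv, ?_, ?_, ?_⟩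
  · intro φ hφ _ hsupp i
    have h := hK.green_smooth hd (hv.of_le hle) (hφ.of_le hle) i
    -- The test function is supported in the interior of `K`, so no facet term survives.
    rw [Finset.sum_eq_zero] at h
    · linarith
    · intro e he
      rw [integral_eq_zero_of_ae, zero_mul]
      filter_upwards [ae_faceMeasure_mem_hull e] with x hx
      have : φ x = 0 := image_eq_zero_of_notMem_tsupport fun h =>
        hK.hull_face_disjoint_interior he hx (hsupp h)
      simp [this]
  all_goals simp

end Green

/-! ### Polynomial functions and fields. -/

section Polynomials

variable {d p : ℕ}

theorem mem_polySpace {v : Pt d → ℝ} : v ∈ polySpace d p ↔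
    ∃ P : MvPolynomial (Fin d) ℝ, P.totalDegree ≤ p ∧
      v = fun x => MvPolynomial.aeval (fun i => x i) P := by
  simp only [polySpace, Submodule.mem_map, MvPolynomial.mem_restrictTotalDegree]
  exact exists_congr fun P => and_congr_right fun _ => eq_comm

instance finiteDimensional_polySpace : FiniteDimensional ℝ (polySpace d p) := by
  unfold polySpace; infer_instance

theorem analyticOnNhd_of_mem_polySpace {v : Pt d → ℝ} (hv : v ∈ polySpace d p) :
    AnalyticOnNhd ℝ v Set.univ := by
  obtain ⟨P, -, rfl⟩ := mem_polySpace.1 hv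
  have h : ∀ i, AnalyticOnNhd ℝ (fun x : Pt d => x i) Set.univ := fun i =>
    (EuclideanSpace.proj i : Pt d →L[ℝ] ℝ).analyticOnNhd _
  exact AnalyticOnNhd.aeval_mvPolynomial h P

theorem contDiff_of_mem_polySpace {v : Pt d → ℝ} (hv : v ∈ polySpace d p) : ContDiff ℝ ∞ v :=
  (analyticOnNhd_of_mem_polySpace hv).contDiff

theorem hasFDerivAt_aeval (P : MvPolynomial (Fin d) ℝ) (x : Pt d) :
    HasFDerivAt (fun x : Pt d => MvPolynomial.aeval (fun i => x i) P)
      (∑ i, (MvPolynomial.aeval (fun i => x i) (MvPolynomial.pderiv i P) : ℝ) •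
        (EuclideanSpace.proj i : Pt d →L[ℝ] ℝ)) x := by
  induction P using MvPolynomial.induction_on with
  | C a =>
    simp only [MvPolynomial.aeval_C, MvPolynomial.pderiv_C, map_zero, zero_smul,
      Finset.sum_const_zero]
    exact hasFDerivAt_const _ _
  | add P Q hP hQ =>
    simp only [map_add, add_smul, Finset.sum_add_distrib]
    exact hP.add hQ
  | mul_X P j hP =>
    have hX : HasFDerivAt (fun x : Pt d => x j) (EuclideanSpace.proj j : Pt d →L[ℝ] ℝ) x :=
      (EuclideanSpace.proj j : Pt d →L[ℝ] ℝ).hasFDerivAt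
    have h := hP.mul hX
    simp only [map_mul, MvPolynomial.aeval_X]
    refine h.congr_fderiv ?_
    ext v
    simp only [add_apply, smul_apply, smul_eq_mul, Finset.smul_sum, sum_apply,
      Derivation.leibniz, MvPolynomial.pderiv_X, map_add, map_mul, MvPolynomial.aeval_X, add_mul,
      Finset.sum_add_distrib]
    congr 1
    · rw [Finset.sum_eq_single j]
      · simp
      · intro b _ hb; simp [hb.symm]
      · simp
    · exact Finset.sum_congr rfl fun i _ => by ring

theorem totalDegree_pderiv_le (i : Fin d) (P : MvPolynomial (Fin d) ℝ) :
    (MvPolynomial.pderiv i P).totalDegree ≤ P.totalDegree := by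
  conv_lhs => rw [P.as_sum, map_sum]
  refine MvPolynomial.totalDegree_finsetSum_le fun s hs => ?_
  rw [MvPolynomial.pderiv_monomial]
  refine (MvPolynomial.totalDegree_monomial_le _ _).trans ?_
  refine le_trans ?_ (MvPolynomial.le_totalDegree hs)
  exact Finsupp.degree_mono tsub_le_self

theorem gradient_mem_polySpace {v : Pt d → ℝ} (hv : v ∈ polySpace d p) (i : Fin d) :
    (fun x => gradient v x i) ∈ polySpace d p := by
  obtain ⟨P, hP, rfl⟩ := mem_polySpace.1 hv
  refine mem_polySpace.2 ⟨MvPolynomial.pderiv i P, ?_, ?_⟩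
  · exact (totalDegree_pderiv_le i P).trans hP
  · funext x
    rw [gradient_apply, (hasFDerivAt_aeval P x).fderiv, sum_apply,
      Finset.sum_eq_single i]
    · simp
    · intro j _ hj; simp [hj]
    · simp

theorem gradient_mem_polyFieldSpace {v : Pt d → ℝ} (hv : v ∈ polySpace d p) :
    gradient v ∈ polyFieldSpace d p := gradient_mem_polySpace hv

/-- The identity theorem for analytic functions applies because a nondegenerate simplex has an
interior point, its centroid. -/
theorem eq_zero_of_mem_polySpace {K : Finset (Pt d)} (hK : IsSimplex K) {v : Pt d → ℝ}
    (hv : v ∈ polySpace d p) (h : ∀ x ∈ interior (hull K), v x = 0) : v = 0 := by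
  have hne : (interior (hull K)).Nonempty := by
    have h1 := hK.basis.centroid_mem_interior_convexHull
    have h2 : hull K = convexHull ℝ (Set.range hK.basis) := by
      rw [hull]; congr 1; ext y; simp [IsSimplex.basis_apply]
    rw [h2]
    exact ⟨_, h1⟩
  obtain ⟨x, hx⟩ := hne
  exact (analyticOnNhd_of_mem_polySpace hv).eq_of_eventuallyEq (g := 0)
    (fun _ _ => analyticAt_const) (z₀ := x)
    (by filter_upwards [isOpen_interior.mem_nhds hx] with y hy using h y hy)

theorem continuous_of_mem_polyFieldSpace {τ : Pt d → Pt d} (hτ : τ ∈ polyFieldSpace d p) :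
    Continuous τ := by
  have : ∀ i, Continuous fun x => τ x i := fun i => (contDiff_of_mem_polySpace (hτ i)).continuous
  exact (PiLp.continuous_toLp 2 _).comp (continuous_pi this)

theorem hasH1Trace_of_mem_polyFieldSpace {K : Finset (Pt d)} (hd : 1 ≤ d) (hK : IsSimplex K)
    {τ : Pt d → Pt d} (hτ : τ ∈ polyFieldSpace d p) (i : Fin d) :
    HasH1Trace K (fun x => τ x i) (gradient fun x => τ x i) (fun x => τ x i) :=
  hK.hasH1Trace_smooth hd (contDiff_of_mem_polySpace (hτ i))

instance finiteDimensional_polyFieldSpace : FiniteDimensional ℝ (polyFieldSpace d p) := by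
  let f : polyFieldSpace d p →ₗ[ℝ] Fin d → polySpace d p :=
    { toFun := fun τ i => ⟨fun x => τ.1 x i, τ.2 i⟩
      map_add' := fun _ _ => rfl
      map_smul' := fun _ _ => rfl }
  refine FiniteDimensional.of_injective f fun τ σ h => ?_
  ext x i
  exact congrFun (congrArg Subtype.val (congrFun h i)) x

/-- Definiteness of the L² product: a continuous nonnegative function with zero integral vanishes on
the interior, and a polynomial vanishing there is zero everywhere. Elements of `Sigmah` are
functions on all of ℝ^d, so this last step is what makes the liftings unique. -/
theorem polyFieldSpace_eq_zero {K : Finset (Pt d)} (hK : IsSimplex K) {τ : Pt d → Pt d}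
    (hτ : τ ∈ polyFieldSpace d p) (h : ∫ x in hull K, ⟪τ x, τ x⟫ = 0) : τ = 0 := by
  have hcont : Continuous fun x => ⟪τ x, τ x⟫ :=
    (continuous_of_mem_polyFieldSpace hτ).inner (continuous_of_mem_polyFieldSpace hτ)
  have hint : IntegrableOn (fun x => ⟪τ x, τ x⟫) (interior (hull K)) :=
    (hcont.continuousOn.integrableOn_compact (isCompact_hull K)).mono_set interior_subset
  have h0 : ∫ x in interior (hull K), ⟪τ x, τ x⟫ = 0 := by
    refine le_antisymm ?_ (setIntegral_nonneg isOpen_interior.measurableSet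
      fun x _ => real_inner_self_nonneg)
    rw [← h]
    exact setIntegral_mono_set (hcont.continuousOn.integrableOn_compact (isCompact_hull K))
      (Eventually.of_forall fun x => real_inner_self_nonneg)
      interior_subset.eventuallyLE
  rw [setIntegral_eq_zero_iff_of_nonneg_ae (Eventually.of_forall fun x => real_inner_self_nonneg)
    hint] at h0
  have h1 : Set.EqOn (fun x => ⟪τ x, τ x⟫) 0 (interior (hull K)) :=
    Measure.eqOn_open_of_ae_eq h0 isOpen_interior hcont.continuousOn continuousOn_const
  funext x
  ext i
  have := eq_zero_of_mem_polySpace hK (hτ i) fun y hy => by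
    have h2 : τ y = 0 := inner_self_eq_zero.1 (h1 hy)
    rw [h2]; rfl
  exact congrFun this x

end Polynomials

/-! ### The finite element spaces and representation of functionals on `Sigmah`. -/

namespace Discretization

variable {d : ℕ} (D : Discretization d)

theorem isSimplex (K : D.Cell) : IsSimplex K.1 := ⟨D.card_cell K.1 K.2, D.indep K.1 K.2⟩

variable {D}

theorem mem_Sigmah {τ : D.Field} : τ ∈ D.Sigmah ↔ ∀ K, τ K ∈ polyFieldSpace d D.p := by
  simp [Sigmah, Submodule.mem_pi]

theorem mem_Vh {v : D.Cell → Pt d → ℝ} : v ∈ D.Vh ↔ ∀ K, v K ∈ polySpace d D.p := by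
  simp [Vh, Submodule.mem_pi]

/-- Multiplication by κ preserves `Sigmah` because κ is constant on each cell; hence κτ may itself
be used as a test field for the liftings. -/
theorem kmul_mem {τ : D.Field} (hτ : τ ∈ D.Sigmah) : D.kmul τ ∈ D.Sigmah :=
  mem_Sigmah.2 fun K => (polyFieldSpace d D.p).smul_mem (D.κ K) (mem_Sigmah.1 hτ K)

theorem gradient_mem {v : D.Cell → Pt d → ℝ} (hv : v ∈ D.Vh) :
    (fun K => gradient (v K)) ∈ D.Sigmah :=
  mem_Sigmah.2 fun K => gradient_mem_polyFieldSpace (mem_Vh.1 hv K)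

variable (D) in
/-- A field that is square integrable on each element. -/
def L2Field (σ : D.Field) : Prop := ∀ K, MemLp (σ K) 2 (volume.restrict (hull K.1))

theorem l2Field_of_mem {σ : D.Field} (hσ : σ ∈ D.Sigmah) : D.L2Field σ := fun K =>
  memLp_hull K.1 (continuous_of_mem_polyFieldSpace (mem_Sigmah.1 hσ K))

theorem L2Field.kmul {σ : D.Field} (hσ : D.L2Field σ) : D.L2Field (D.kmul σ) :=
  fun K => (hσ K).const_smul (D.κ K)

theorem L2Field.add {σ τ : D.Field} (hσ : D.L2Field σ) (hτ : D.L2Field τ) : D.L2Field (σ + τ) :=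
  fun K => (hσ K).add (hτ K)

theorem dot_comm (σ τ : D.Field) : D.dot σ τ = D.dot τ σ := by
  simp only [dot, Triangulation.integral, real_inner_comm]

theorem dot_kmul (σ τ : D.Field) : D.dot (D.kmul σ) τ = D.dot σ (D.kmul τ) := by
  simp only [dot, Triangulation.integral, Discretization.kmul, inner_smul_left, inner_smul_right,
    conj_trivial]

theorem dot_add_left {σ σ' τ : D.Field} (hσ : D.L2Field σ) (hσ' : D.L2Field σ')
    (hτ : D.L2Field τ) : D.dot (σ + σ') τ = D.dot σ τ + D.dot σ' τ := by
  simp only [dot, Triangulation.integral, ← Finset.sum_add_distrib]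
  refine Finset.sum_congr rfl fun K _ => ?_
  rw [← integral_add ((hσ K).inner_two (hτ K)) ((hσ' K).inner_two (hτ K))]
  simp only [Pi.add_apply, inner_add_left]

theorem dot_smul_left (c : ℝ) (σ τ : D.Field) : D.dot (c • σ) τ = c * D.dot σ τ := by
  simp only [dot, Triangulation.integral, Finset.mul_sum, ← integral_const_mul, Pi.smul_apply,
    inner_smul_left, conj_trivial]

theorem dot_sub_left {σ σ' τ : D.Field} (hσ : D.L2Field σ) (hσ' : D.L2Field σ')
    (hτ : D.L2Field τ) : D.dot (σ - σ') τ = D.dot σ τ - D.dot σ' τ := by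
  simp only [dot, Triangulation.integral, ← Finset.sum_sub_distrib]
  refine Finset.sum_congr rfl fun K _ => ?_
  rw [← integral_sub ((hσ K).inner_two (hτ K)) ((hσ' K).inner_two (hτ K))]
  simp only [Pi.sub_apply, inner_sub_left]

theorem dot_zero_left (τ : D.Field) : D.dot 0 τ = 0 := by
  simpa using dot_smul_left 0 (0 : D.Field) τ

theorem eq_zero_of_dot_self {σ : D.Field} (hσ : σ ∈ D.Sigmah) (h : D.dot σ σ = 0) : σ = 0 := by
  have h1 : ∀ K : D.Cell, ∫ x in hull K.1, ⟪σ K x, σ K x⟫ = 0 := fun K =>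
    (Finset.sum_eq_zero_iff_of_nonneg fun K _ => integral_nonneg fun x =>
      real_inner_self_nonneg).1 h K (Finset.mem_univ K)
  funext K
  exact polyFieldSpace_eq_zero (D.isSimplex K) (mem_Sigmah.1 hσ K) (h1 K)

theorem Sigmah_ext {σ σ' : D.Field} (hσ : σ ∈ D.Sigmah) (hσ' : σ' ∈ D.Sigmah)
    (h : ∀ τ ∈ D.Sigmah, D.dot σ τ = D.dot σ' τ) : σ = σ' := by
  have hs := D.Sigmah.sub_mem hσ hσ'
  refine sub_eq_zero.1 (eq_zero_of_dot_self hs ?_)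
  rw [dot_sub_left (l2Field_of_mem hσ) (l2Field_of_mem hσ') (l2Field_of_mem hs), h _ hs, sub_self]

instance finiteDimensional_Sigmah : FiniteDimensional ℝ D.Sigmah := by
  let f : D.Sigmah →ₗ[ℝ] D.Cell → polyFieldSpace d D.p :=
    { toFun := fun τ K => ⟨τ.1 K, mem_Sigmah.1 τ.2 K⟩
      map_add' := fun _ _ => rfl
      map_smul' := fun _ _ => rfl }
  refine FiniteDimensional.of_injective f fun τ σ h => ?_
  ext1
  funext K
  exact congrArg Subtype.val (congrFun h K)

variable (D) in
/-- The functional `ℓ` is linear on `Σ_h`. -/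
structure LinearOnSigmah (ℓ : D.Field → ℝ) : Prop where
  add : ∀ σ ∈ D.Sigmah, ∀ τ ∈ D.Sigmah, ℓ (σ + τ) = ℓ σ + ℓ τ
  smul : ∀ c : ℝ, ∀ τ ∈ D.Sigmah, ℓ (c • τ) = c * ℓ τ

/-- Riesz representation in finite dimension: definiteness makes the map from `Sigmah` to its dual
injective, and equality of dimensions makes it surjective. -/
theorem LinearOnSigmah.exists {ℓ : D.Field → ℝ} (hℓ : D.LinearOnSigmah ℓ) :
    ∃ ρ ∈ D.Sigmah, ∀ τ ∈ D.Sigmah, D.dot ρ τ = ℓ τ := by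
  let B : D.Sigmah →ₗ[ℝ] Module.Dual ℝ D.Sigmah := LinearMap.mk₂ ℝ (fun σ τ => D.dot σ.1 τ.1)
    (fun σ σ' τ => dot_add_left (l2Field_of_mem σ.2) (l2Field_of_mem σ'.2) (l2Field_of_mem τ.2))
    (fun c σ τ => dot_smul_left c σ.1 τ.1)
    (fun σ τ τ' => by
      change D.dot σ.1 (τ.1 + τ'.1) = _
      rw [dot_comm, dot_add_left (l2Field_of_mem τ.2) (l2Field_of_mem τ'.2) (l2Field_of_mem σ.2),
        dot_comm, dot_comm τ'.1])
    (fun c σ τ => by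
      change D.dot σ.1 (c • τ.1) = _
      rw [dot_comm, dot_smul_left, dot_comm]; rfl)
  have hinj : Function.Injective B := by
    rw [injective_iff_map_eq_zero]
    intro σ h
    exact Subtype.ext (eq_zero_of_dot_self σ.2 (LinearMap.congr_fun h σ))
  have hsurj : Function.Surjective B :=
    (LinearMap.injective_iff_surjective_of_finrank_eq_finrank
      (Subspace.dual_finrank_eq (K := ℝ) (V := D.Sigmah)).symm).1 hinj
  obtain ⟨ρ, hρ⟩ := hsurj
    { toFun := fun τ => ℓ τ.1
      map_add' := fun σ τ => hℓ.add σ.1 σ.2 τ.1 τ.2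
      map_smul' := fun c τ => hℓ.smul c τ.1 τ.2 }
  exact ⟨ρ.1, ρ.2, fun τ hτ => LinearMap.congr_fun hρ ⟨τ, hτ⟩⟩

theorem LinearOnSigmah.represent_mem {ℓ : D.Field → ℝ} (hℓ : D.LinearOnSigmah ℓ) :
    D.represent ℓ ∈ D.Sigmah := by
  rw [represent, dif_pos hℓ.exists]
  exact hℓ.exists.choose_spec.1

theorem LinearOnSigmah.dot_represent {ℓ : D.Field → ℝ} (hℓ : D.LinearOnSigmah ℓ) {τ : D.Field}
    (hτ : τ ∈ D.Sigmah) : D.dot (D.represent ℓ) τ = ℓ τ := by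
  rw [represent, dif_pos hℓ.exists]
  exact hℓ.exists.choose_spec.2 τ hτ

theorem LinearOnSigmah.represent_iff {ℓ : D.Field → ℝ} (hℓ : D.LinearOnSigmah ℓ) (ρ : D.Field) :
    (ρ ∈ D.Sigmah ∧ ∀ τ ∈ D.Sigmah, D.dot ρ τ = ℓ τ) ↔ ρ = D.represent ℓ := by
  constructor
  · rintro ⟨h1, h2⟩
    exact Sigmah_ext h1 hℓ.represent_mem fun τ hτ => by rw [h2 τ hτ, hℓ.dot_represent hτ]
  · rintro rfl
    exact ⟨hℓ.represent_mem, fun τ hτ => hℓ.dot_represent hτ⟩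

theorem LinearOnSigmah.finsetSum {ι : Type*} {s : Finset ι} {ℓ : ι → D.Field → ℝ}
    (h : ∀ i ∈ s, D.LinearOnSigmah (ℓ i)) : D.LinearOnSigmah fun τ => ∑ i ∈ s, ℓ i τ where
  add σ hσ τ hτ := by
    rw [← Finset.sum_add_distrib]
    exact Finset.sum_congr rfl fun i hi => (h i hi).add σ hσ τ hτ
  smul c τ hτ := by
    rw [Finset.mul_sum]
    exact Finset.sum_congr rfl fun i hi => (h i hi).smul c τ hτ

end Discretization

/-! ### Two simplices with a common facet. -/

section TwoSimplices

variable {d : ℕ} {K K' e : Finset (Pt d)} {a b c : Pt d} {x : Pt d}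

/-- Barycentric coordinates with respect to a common face agree on the plane of that face. -/
theorem IsSimplex.bary_congr (hK : IsSimplex K) (hK' : IsSimplex K') (he : e ⊆ K) (he' : e ⊆ K')
    (hx : ∀ b ∈ K, b ∉ e → bary K b x = 0) (hc : c ∈ e) : bary K' c x = bary K c x := by
  rw [hK.affine_apply (bary K' c) x, Finset.sum_eq_single c]
  · rw [hK'.bary_self (he' hc), mul_one]
  · intro b hb hbc
    by_cases hbe : b ∈ e
    · rw [hK'.bary_of_ne (he' hc) (he' hbe) hbc.symm, mul_zero]
    · rw [hx b hb hbe, zero_mul]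
  · exact fun h => absurd (he hc) h

/-- Both coordinates are affine and vanish on the common facet, so they are proportional, with the
ratio determined at `a`. -/
theorem IsSimplex.bary_eq_mul [DecidableEq (Pt d)] (hK : IsSimplex K) (hK' : IsSimplex K')
    (ha : a ∈ K) (hb : b ∈ K') (he : K.erase a = K'.erase b) (x : Pt d) :
    bary K' b x = bary K' b a * bary K a x := by
  rw [hK.affine_apply (bary K' b) x, Finset.sum_eq_single a]
  · ring
  · intro c hc hca
    have hce : c ∈ K'.erase b := he ▸ Finset.mem_erase.2 ⟨hca, hc⟩
    rw [hK'.bary_of_ne hb (Finset.mem_of_mem_erase hce) (Finset.ne_of_mem_erase hce).symm, mul_zero]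
  · exact fun h => absurd ha h

theorem IsSimplex.exists_relint [DecidableEq (Pt d)] (hd : 1 ≤ d) (hK : IsSimplex K) (ha : a ∈ K) :
    ∃ z, bary K a z = 0 ∧ ∀ c ∈ K.erase a, 0 < bary K c z := by
  have hcard : (0 : ℝ) < (K.erase a).card := by
    rw [Finset.card_erase_of_mem ha, hK.card]; simp; omega
  refine ⟨∑ b ∈ K.erase a, ((K.erase a).card : ℝ)⁻¹ • b, ?_, fun c hc => ?_⟩
  · rw [sum_smul_affine _ (fun _ => ((K.erase a).card : ℝ)⁻¹) (by simp [hcard.ne'])]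
    exact Finset.sum_eq_zero fun b hb => by
      rw [hK.bary_of_ne ha (Finset.mem_of_mem_erase hb) (Finset.ne_of_mem_erase hb).symm,
          mul_zero]
  · rw [sum_smul_affine _ (fun _ => ((K.erase a).card : ℝ)⁻¹) (by simp [hcard.ne']),
      Finset.sum_eq_single c]
    · rw [hK.bary_self (Finset.mem_of_mem_erase hc)]; positivity
    · exact fun b hb hbc => by
        rw [hK.bary_of_ne (Finset.mem_of_mem_erase hc) (Finset.mem_of_mem_erase hb) hbc.symm,
          mul_zero]
    · exact fun h => absurd hc h

/-- Two simplices with a common facet that meet only in that facet lie on opposite sides of it. -/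
theorem IsSimplex.bary_neg [DecidableEq (Pt d)] (hd : 1 ≤ d) (hK : IsSimplex K)
    (hK' : IsSimplex K') (ha : a ∈ K) (hb : b ∈ K') (he : K.erase a = K'.erase b)
    (hmeet : hull K ∩ hull K' ⊆ hull (K.erase a)) : bary K' b a < 0 := by
  -- Otherwise a short step from the barycentre `z` of the facet towards `a` stays in both simplices
  -- but leaves the facet, against `hmeet`.
  by_contra hneg
  rw [not_lt] at hneg
  obtain ⟨z, hz0, hz⟩ := hK.exists_relint hd ha
  have hzK : z ∈ hull K := by
    rw [hK.mem_hull]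
    intro c hc
    by_cases hca : c = a
    · rw [hca, hz0]
    · exact (hz c (Finset.mem_erase.2 ⟨hca, hc⟩)).le
  have haK : a ∈ hull K := subset_convexHull ℝ _ (by exact_mod_cast ha)
  -- On the plane of the facet the coordinates for `K'` agree with those for `K`, hence are positive
  -- at `z`; continuity does the rest.
  have hev : ∀ᶠ t : ℝ in 𝓝[>] 0, ∀ c ∈ K.erase a, 0 < bary K' c (z + t • (a - z)) := by
    rw [Finset.eventually_all]
    intro c hc
    have hcont : Continuous fun t : ℝ => bary K' c (z + t • (a - z)) :=
      (continuous_bary K' c).comp (by fun_prop)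
    have h0 : 0 < bary K' c (z + (0 : ℝ) • (a - z)) := by
      rw [zero_smul, add_zero, hK.bary_congr hK' (Finset.erase_subset a K)
        (he ▸ Finset.erase_subset b K') _ hc]
      · exact hz c hc
      · intro b' hb' hb'e
        by_cases h : b' = a
        · rw [h, hz0]
        · exact absurd (Finset.mem_erase.2 ⟨h, hb'⟩) hb'e
    exact nhdsWithin_le_nhds ((hcont.tendsto 0).eventually_const_lt h0)
  have hlt : ∀ᶠ t : ℝ in 𝓝[>] 0, t < 1 := nhdsWithin_le_nhds (gt_mem_nhds one_pos)
  obtain ⟨t, ⟨ht, ht1⟩, ht0⟩ := ((hev.and hlt).and self_mem_nhdsWithin).exists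
  have ht0 : (0 : ℝ) < t := ht0
  have hbt : ∀ s (hs : s ∈ K), bary K s (z + t • (a - z)) =
      bary K s z + t * (bary K s a - bary K s z) := by
    intro s _
    rw [affine_add, map_smul, ← vsub_eq_sub, AffineMap.linearMap_vsub, vsub_eq_sub, smul_eq_mul]
  have hxK : z + t • (a - z) ∈ hull K := (convex_hull K).add_smul_sub_mem hzK haK ⟨ht0.le, ht1.le⟩
  have hxa : bary K a (z + t • (a - z)) = t := by
    rw [hbt a ha, hz0, hK.bary_self ha]; ring
  have hxK' : z + t • (a - z) ∈ hull K' := by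
    rw [hK'.mem_hull]
    intro c hc
    by_cases hcb : c = b
    · rw [hcb, hK.bary_eq_mul hK' ha hb he, hxa]
      exact mul_nonneg hneg ht0.le
    · exact (ht c (he ▸ Finset.mem_erase.2 ⟨hcb, hc⟩)).le
  have := ((hK.mem_hull_erase ha).1 (hmeet ⟨hxK, hxK'⟩)).1
  rw [hxa] at this
  exact ht0.ne' this

/-- The two coordinates vanishing on the facet differ by a negative factor: their linear parts have
the same kernel, so both normals span its orthogonal complement, but they point to opposite sides.
-/
theorem IsSimplex.outwardNormal_neg [DecidableEq (Pt d)] (hd : 1 ≤ d) (hK : IsSimplex K)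
    (hK' : IsSimplex K') (ha : a ∈ K) (hb : b ∈ K') (he : K.erase a = K'.erase b)
    (hneg : bary K' b a < 0) : outwardNormal K' (K'.erase b) = -outwardNormal K (K.erase a) := by
  obtain ⟨h1, h2, h3⟩ := hK.outwardNormal_spec hd ha
  obtain ⟨h1', h2', h3'⟩ := hK'.outwardNormal_spec hd hb
  have hlin : ∀ v, (bary K' b).linear v = bary K' b a * (bary K a).linear v := by
    intro v
    have e1 := affine_add (bary K' b) 0 v
    rw [hK.bary_eq_mul hK' ha hb he, hK.bary_eq_mul hK' ha hb he 0, affine_add] at e1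
    linarith
  have hker : LinearMap.ker (bary K' b).linear = LinearMap.ker (bary K a).linear := by
    ext v
    rw [LinearMap.mem_ker, LinearMap.mem_ker, hlin, mul_eq_zero, or_iff_right hneg.ne]
  rw [hker] at h2'
  refine unit_normal_unique (L := (bary K a).linear) h1' h2' (by rwa [norm_neg])
    (Submodule.neg_mem _ h2) ?_
  rw [hlin] at h3'
  rw [map_neg]
  have : 0 < (bary K a).linear (outwardNormal K' (K'.erase b)) := pos_of_mul_neg_right h3' hneg.le
  exact mul_pos this (by linarith)

end TwoSimplices

/-! ### Combinatorics of a conforming triangulation. -/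

namespace Triangulation

variable {d : ℕ} {M : Triangulation d} {e : Finset (Pt d)} {K K' : M.Cell} {a b x : Pt d}

theorem isSimplex (K : M.Cell) : IsSimplex K.1 := ⟨M.card_cell K.1 K.2, M.indep K.1 K.2⟩

theorem mem_faces : e ∈ M.faces ↔ ∃ K : M.Cell, e ∈ K.1.powersetCard d := by
  simp only [faces, Finset.mem_biUnion, Subtype.exists, exists_prop]

theorem mem_neighbours : K ∈ M.neighbours e ↔ e ⊆ K.1 := by simp [neighbours]

/-- `neighbours` only asks for inclusion of vertex sets; for a face the cardinality d is automatic.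
-/
theorem mem_neighbours_of_mem_faces (he : e ∈ M.faces) :
    K ∈ M.neighbours e ↔ e ∈ K.1.powersetCard d := by
  obtain ⟨K₀, hK₀⟩ := mem_faces.1 he
  rw [mem_neighbours, Finset.mem_powersetCard, and_iff_left (Finset.mem_powersetCard.1 hK₀).2]

/-- Double counting of the incidences of cells and faces; it turns element-boundary terms into face
terms throughout. -/
theorem sum_cells_faces {F : M.Cell → Finset (Pt d) → ℝ} :
    ∑ K : M.Cell, ∑ e ∈ K.1.powersetCard d, F K e = ∑ e ∈ M.faces, ∑ K ∈ M.neighbours e, F K e := by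
  refine Finset.sum_comm' fun K e => ?_
  constructor
  · rintro ⟨-, h⟩
    have he := mem_faces.2 ⟨K, h⟩
    exact ⟨(mem_neighbours_of_mem_faces he).2 h, he⟩
  · rintro ⟨h, he⟩
    exact ⟨Finset.mem_univ K, (mem_neighbours_of_mem_faces he).1 h⟩

/-- A point of a cell that is interior to a sub-simplex of another cell belongs to a cell
containing that sub-simplex. -/
theorem subset_of_mem_hull {s : Finset (Pt d)} (hs : s ⊆ K.1) (hpos : ∀ c ∈ s, 0 < bary K.1 c x)
    (hx : x ∈ hull K.1) (hx' : x ∈ hull K'.1) : s ⊆ K'.1 := by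
  classical
  intro c hc
  have h : x ∈ hull (K.1 ∩ K'.1) := by
    rw [hull, Finset.coe_inter, ← M.inter_hull K.1 K.2 K'.1 K'.2]
    exact ⟨hx, hx'⟩
  by_contra hc'
  have := (((isSimplex K).mem_hull_of_subset Finset.inter_subset_left).1 h).2 c (hs hc)
    (fun hh => hc' (Finset.mem_inter.1 hh).2)
  exact (hpos c hc).ne' this

theorem eq_of_subset (h : K.1 ⊆ K'.1) : K = K' :=
  Subtype.ext (Finset.eq_of_subset_of_card_le h (by rw [(isSimplex K).card, (isSimplex K').card]))

theorem eq_of_mem_interior (hx : x ∈ interior (hull K.1)) (hx' : x ∈ hull K'.1) : K = K' := by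
  have h := hx
  rw [(isSimplex K).interior_hull] at h
  exact eq_of_subset (subset_of_mem_hull (Finset.Subset.refl _) h (interior_subset hx) hx')

/-- Conformity reduces the intersection to the common vertices. If `a` were among them, `K` would be
contained in `K'` and the cells would coincide. -/
theorem hull_inter_subset [DecidableEq (Pt d)] (hKK' : K ≠ K') (he : K.1.erase a = K'.1.erase b) :
    hull K.1 ∩ hull K'.1 ⊆ hull (K.1.erase a) := by
  rw [M.inter_hull K.1 K.2 K'.1 K'.2]
  refine convexHull_mono fun c hc => ?_
  have hca : c ≠ a := by
    rintro rfl
    refine hKK' (eq_of_subset fun c' hc' => ?_)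
    by_cases h : c' = c
    · rw [h]; exact hc.2
    · have : c' ∈ K'.1.erase b := he ▸ Finset.mem_erase.2 ⟨h, hc'⟩
      exact Finset.mem_of_mem_erase this
  exact_mod_cast Finset.mem_erase.2 ⟨hca, hc.1⟩

theorem norm_outwardNormal (hd : 1 ≤ d) (he : e ∈ M.faces) (hK : K ∈ M.neighbours e) :
    ‖outwardNormal K.1 e‖ = 1 := by
  classical
  obtain ⟨a, ha, rfl⟩ := (isSimplex K).mem_powersetCard.1 ((mem_neighbours_of_mem_faces he).1 hK)
  exact ((isSimplex K).outwardNormal_spec hd ha).1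

theorem outwardNormal_eq_neg (hd : 1 ≤ d) (he : e ∈ M.faces) (hK : K ∈ M.neighbours e)
    (hK' : K' ∈ M.neighbours e) (hne : K ≠ K') : outwardNormal K'.1 e = -outwardNormal K.1 e := by
  classical
  obtain ⟨a, ha, h⟩ := (isSimplex K).mem_powersetCard.1 ((mem_neighbours_of_mem_faces he).1 hK)
  obtain ⟨b, hb, h'⟩ := (isSimplex K').mem_powersetCard.1 ((mem_neighbours_of_mem_faces he).1 hK')
  have hee : K.1.erase a = K'.1.erase b := h ▸ h'
  have := (isSimplex K).outwardNormal_neg hd (isSimplex K') ha hb hee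
    ((isSimplex K).bary_neg hd (isSimplex K') ha hb hee (hull_inter_subset hne hee))
  rwa [← h, ← h'] at this

theorem card_neighbours_pos (he : e ∈ M.faces) : 0 < (M.neighbours e).card := by
  obtain ⟨K, hK⟩ := mem_faces.1 he
  exact Finset.card_pos.2 ⟨K, (mem_neighbours_of_mem_faces he).2 hK⟩

/-- Three unit normals cannot be pairwise opposite. -/
theorem card_neighbours_le_two (hd : 1 ≤ d) (he : e ∈ M.faces) : (M.neighbours e).card ≤ 2 := by
  by_contra h
  obtain ⟨K₁, K₂, K₃, h1, h2, h3, h12, h13, h23⟩ := Finset.two_lt_card_iff.1 (not_le.1 h)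
  have e12 := outwardNormal_eq_neg hd he h1 h2 h12
  have e13 := outwardNormal_eq_neg hd he h1 h3 h13
  have e23 := outwardNormal_eq_neg hd he h2 h3 h23
  rw [e12, e13, neg_neg] at e23
  have h0 : outwardNormal K₁.1 e = 0 := by
    have : (2 : ℝ) • outwardNormal K₁.1 e = 0 := by
      rw [two_smul]; nth_rewrite 1 [← e23]; abel
    simpa using this
  have := norm_outwardNormal hd he h1
  rw [h0, norm_zero] at this
  exact zero_ne_one this

theorem mem_interiorFaces : e ∈ M.interiorFaces ↔ e ∈ M.faces ∧ (M.neighbours e).card = 2 := by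
  simp [interiorFaces]

theorem mem_boundaryFaces : e ∈ M.boundaryFaces ↔ e ∈ M.faces ∧ (M.neighbours e).card = 1 := by
  simp [boundaryFaces]

theorem notMem_interiorFaces_of_boundary (h : e ∈ M.boundaryFaces) : e ∉ M.interiorFaces := by
  rw [mem_boundaryFaces] at h
  rw [mem_interiorFaces]
  omega

theorem faces_eq [DecidableEq (Finset (Pt d))] (hd : 1 ≤ d) :
    M.faces = M.interiorFaces ∪ M.boundaryFaces := by
  ext e
  rw [Finset.mem_union, mem_interiorFaces, mem_boundaryFaces]
  constructor
  · intro he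
    have h1 := card_neighbours_pos he
    have h2 := card_neighbours_le_two hd he
    by_cases h : (M.neighbours e).card = 2
    · exact Or.inl ⟨he, h⟩
    · exact Or.inr ⟨he, by omega⟩
  · rintro (h | h) <;> exact h.1

/-- The sum formula is quantified over the target group, so one choice of the ordered pair serves
all scalar and vector averages and jumps in the same computation. -/
theorem exists_pair (hd : 1 ≤ d) (he : e ∈ M.interiorFaces) : ∃ K K' : M.Cell,
    K ≠ K' ∧ (∀ {F : Type} [AddCommGroup F] (f : M.Cell → F),
      ∑ K ∈ M.neighbours e, f K = f K + f K') ∧ K ∈ M.neighbours e ∧ K' ∈ M.neighbours e ∧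
      outwardNormal K'.1 e = -outwardNormal K.1 e ∧ ‖outwardNormal K.1 e‖ = 1 := by
  classical
  obtain ⟨hf, hc⟩ := mem_interiorFaces.1 he
  obtain ⟨K, K', hne, h⟩ := Finset.card_eq_two.1 hc
  have hK : K ∈ M.neighbours e := by rw [h]; simp
  have hK' : K' ∈ M.neighbours e := by rw [h]; simp
  exact ⟨K, K', hne, fun f => by rw [h, Finset.sum_pair hne], hK, hK',
    outwardNormal_eq_neg hd hf hK hK' hne, norm_outwardNormal hd hf hK⟩

theorem exists_single (hd : 1 ≤ d) (he : e ∈ M.boundaryFaces) : ∃ K : M.Cell,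
    (∀ {F : Type} [AddCommGroup F] (f : M.Cell → F), ∑ K ∈ M.neighbours e, f K = f K) ∧
      K ∈ M.neighbours e ∧ ‖outwardNormal K.1 e‖ = 1 := by
  obtain ⟨hf, hc⟩ := mem_boundaryFaces.1 he
  obtain ⟨K, h⟩ := Finset.card_eq_one.1 hc
  have hK : K ∈ M.neighbours e := by rw [h]; simp
  exact ⟨K, fun f => by rw [h, Finset.sum_singleton], hK, norm_outwardNormal hd hf hK⟩

theorem interior_hull_subset_domain (K : M.Cell) : interior (hull K.1) ⊆ M.domain :=
  interior_mono (Set.subset_iUnion (fun K : M.Cell => hull K.1) K)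

/-- A closed cell need not lie in the open set Ω, but its interior does, and the two differ by a
null set. -/
theorem memLp_of_domain {f : Pt d → ℝ} (hf : MemLp f 2 (volume.restrict M.domain)) (K : M.Cell) :
    MemLp f 2 (volume.restrict (hull K.1)) := by
  have h := hf.mono_measure (Measure.restrict_mono (interior_hull_subset_domain K) le_rfl)
  have hae : (interior (hull K.1) : Set (Pt d)) =ᵐ[volume] hull K.1 :=
    interior_ae_eq_of_null_frontier ((convex_hull K.1).addHaar_frontier volume)
  rwa [Measure.restrict_congr_set hae] at h

/-- An open set containing the relative interior of the interior face `e`, but no point of another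
face. -/
def faceNeighbourhood (M : Triangulation d) (e : Finset (Pt d)) : Set (Pt d) :=
  M.domain ∩ ⋂ e' ∈ {e' ∈ M.faces | e' ≠ e}, (hull e')ᶜ

theorem isOpen_faceNeighbourhood : IsOpen (M.faceNeighbourhood e) :=
  isOpen_interior.inter (isOpen_biInter_finset fun e' _ => (isClosed_hull e').isOpen_compl)

theorem faceNeighbourhood_disjoint {e' : Finset (Pt d)} (he' : e' ∈ M.faces) (h : e' ≠ e)
    (hx : x ∈ M.faceNeighbourhood e) : x ∉ hull e' :=
  Set.mem_iInter₂.1 hx.2 e' (by simp [he', h])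

/-- Almost every point of `e` lies in its relative interior. Such a point is interior to the union
of the two neighbours, and by conformity it belongs to no other face. -/
theorem ae_mem_faceNeighbourhood (hd : 1 ≤ d) (he : e ∈ M.interiorFaces) :
    ∀ᵐ x ∂faceMeasure e, x ∈ M.faceNeighbourhood e := by
  classical
  obtain ⟨hf, -⟩ := mem_interiorFaces.1 he
  obtain ⟨K, K', hne, -, hKn, hKn', -⟩ := exists_pair hd he
  have hK := isSimplex K
  have hK' := isSimplex K'
  obtain ⟨a, ha, h⟩ := hK.mem_powersetCard.1 ((mem_neighbours_of_mem_faces hf).1 hKn)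
  obtain ⟨b, hb, h'⟩ := hK'.mem_powersetCard.1 ((mem_neighbours_of_mem_faces hf).1 hKn')
  have hee : K.1.erase a = K'.1.erase b := h ▸ h'
  have hneg := hK.bary_neg hd hK' ha hb hee (hull_inter_subset hne hee)
  have hae := hK.ae_faceMeasure hd ha
  rw [← h] at hae
  filter_upwards [hae] with x hx
  obtain ⟨hx0, hxpos⟩ := hx
  have heK : e ⊆ K.1 := mem_neighbours.1 hKn
  have hxout : ∀ c ∈ K.1, c ∉ e → bary K.1 c x = 0 := by
    intro c hc hce
    by_cases hca : c = a
    · rw [hca, hx0]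
    · exact absurd (h ▸ Finset.mem_erase.2 ⟨hca, hc⟩) hce
  have hxK : x ∈ hull K.1 := by
    rw [hK.mem_hull]
    intro c hc
    by_cases hce : c ∈ e
    · exact (hxpos c hce).le
    · rw [hxout c hc hce]
  have hcong : ∀ {K₁ : M.Cell}, e ⊆ K₁.1 → ∀ c ∈ e, 0 < bary K₁.1 c x := fun {K₁} hs c hc => by
    rw [hK.bary_congr (isSimplex K₁) heK hs hxout hc]; exact hxpos c hc
  refine ⟨?_, ?_⟩
  · rw [domain, mem_interior_iff_mem_nhds]
    have hev : ∀ {K₁ : M.Cell}, e ⊆ K₁.1 → ∀ᶠ y in 𝓝 x, ∀ c ∈ e, 0 < bary K₁.1 c y := by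
      intro K₁ hs
      rw [Finset.eventually_all]
      exact fun c hc => ((continuous_bary K₁.1 c).tendsto x).eventually_const_lt (hcong hs c hc)
    filter_upwards [hev heK, hev (mem_neighbours.1 hKn')] with y hy hy'
    rw [Set.mem_iUnion]
    -- Near `x` the coordinates of the vertices of `e` stay positive for both cells, so the sign of
    -- λ_a alone decides which of the two contains `y`.
    by_cases hya : 0 ≤ bary K.1 a y
    · refine ⟨K, hK.mem_hull.2 fun c hc => ?_⟩
      by_cases hca : c = a
      · rw [hca]; exact hya
      · exact (hy c (h ▸ Finset.mem_erase.2 ⟨hca, hc⟩)).le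
    · refine ⟨K', hK'.mem_hull.2 fun c hc => ?_⟩
      by_cases hcb : c = b
      · rw [hcb, hK.bary_eq_mul hK' ha hb hee]
        exact mul_nonneg_of_nonpos_of_nonpos hneg.le (not_le.1 hya).le
      · exact (hy' c (h' ▸ Finset.mem_erase.2 ⟨hcb, hc⟩)).le
  -- If `x` were on another face e' of a cell K₁, then K₁ would contain `e`, and the positive
  -- coordinates of `x` would force e ⊆ e'; both have d vertices.
  · simp only [Set.mem_iInter, Finset.mem_filter, Set.mem_compl_iff]
    rintro e' ⟨he', hne'⟩ hxe'
    obtain ⟨K₁, hK₁⟩ := mem_faces.1 he'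
    obtain ⟨hs₁, hc₁⟩ := Finset.mem_powersetCard.1 hK₁
    have heK₁ : e ⊆ K₁.1 := subset_of_mem_hull heK hxpos hxK (hull_mono hs₁ hxe')
    have hsub : e ⊆ e' := by
      intro c hc
      by_contra hce'
      exact (hcong heK₁ c hc).ne'
        ((((isSimplex K₁).mem_hull_of_subset hs₁).1 hxe').2 c (heK₁ hc) hce')
    refine hne' (Finset.eq_of_subset_of_card_le hsub ?_).symm
    rw [hc₁, h, Finset.card_erase_of_mem ha, hK.card, Nat.add_sub_cancel]

end Triangulation

/-! ### Traces on faces and the broken Green formula. -/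

namespace Triangulation

variable {d : ℕ} {M : Triangulation d} {e : Finset (Pt d)}

variable (M) in
/-- Square integrability of elementwise given traces on all faces of the elements. -/
def L2Trace {F : Type*} [NormedAddCommGroup F] (t : M.Cell → Pt d → F) : Prop :=
  ∀ K : M.Cell, ∀ e ∈ K.1.powersetCard d, MemLp (t K) 2 (faceMeasure e)

section L2Trace

variable {F : Type*} [NormedAddCommGroup F]

theorem L2Trace.memLp {t : M.Cell → Pt d → F} (ht : M.L2Trace t) (he : e ∈ M.faces) {K : M.Cell}
    (hK : K ∈ M.neighbours e) : MemLp (t K) 2 (faceMeasure e) :=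
  ht K e ((mem_neighbours_of_mem_faces he).1 hK)

theorem L2Trace.avg [NormedSpace ℝ F] {t : M.Cell → Pt d → F} (ht : M.L2Trace t)
    (he : e ∈ M.faces) : MemLp (M.avg t e) 2 (faceMeasure e) :=
  (memLp_finsetSum _ fun _ hK => ht.memLp he hK).const_smul (1 / 2 : ℝ)

theorem L2Trace.bdry {t : M.Cell → Pt d → F} (ht : M.L2Trace t) (he : e ∈ M.faces) :
    MemLp (M.bdry t e) 2 (faceMeasure e) :=
  memLp_finsetSum _ fun _ hK => ht.memLp he hK

theorem L2Trace.jump {t : M.Cell → Pt d → ℝ} (ht : M.L2Trace t) (he : e ∈ M.faces) :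
    MemLp (M.jump t e) 2 (faceMeasure e) :=
  memLp_finsetSum _ fun K hK => by
    have h := (ContinuousLinearMap.toSpanSingleton ℝ (outwardNormal K.1 e)).comp_memLp'
      (ht.memLp he hK)
    simpa [Function.comp_def, ContinuousLinearMap.toSpanSingleton_apply] using h

theorem L2Trace.normalJump {t : M.Cell → Pt d → Pt d} (ht : M.L2Trace t) (he : e ∈ M.faces) :
    MemLp (M.normalJump t e) 2 (faceMeasure e) :=
  memLp_finsetSum _ fun _ hK => (ht.memLp he hK).inner_const _

theorem L2Trace.bdry_inner {t : M.Cell → Pt d → Pt d} (ht : M.L2Trace t) (he : e ∈ M.faces) :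
    MemLp (fun x => ⟪M.bdry t e x, M.bdryNormal e⟫) 2 (faceMeasure e) :=
  (ht.bdry he).inner_const _

theorem avg_add {F : Type*} [AddCommGroup F] [Module ℝ F] (t s : M.Cell → Pt d → F) (x : Pt d) :
    M.avg (t + s) e x = M.avg t e x + M.avg s e x := by
  simp only [Triangulation.avg, Pi.add_apply, Finset.sum_add_distrib, smul_add]

theorem avg_smul {F : Type*} [AddCommGroup F] [Module ℝ F] (c : ℝ) (t : M.Cell → Pt d → F)
    (x : Pt d) : M.avg (c • t) e x = c • M.avg t e x := by
  simp only [Triangulation.avg, Pi.smul_apply, ← Finset.smul_sum, smul_comm c]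

theorem bdry_add {F : Type*} [AddCommGroup F] (t s : M.Cell → Pt d → F) (x : Pt d) :
    M.bdry (t + s) e x = M.bdry t e x + M.bdry s e x := by
  simp only [Triangulation.bdry, Pi.add_apply, Finset.sum_add_distrib]

theorem bdry_smul {F : Type*} [AddCommGroup F] [Module ℝ F] (c : ℝ) (t : M.Cell → Pt d → F)
    (x : Pt d) : M.bdry (c • t) e x = c • M.bdry t e x := by
  simp only [Triangulation.bdry, Pi.smul_apply, ← Finset.smul_sum]

theorem normalJump_add (t s : M.Cell → Pt d → Pt d) (x : Pt d) :
    M.normalJump (t + s) e x = M.normalJump t e x + M.normalJump s e x := by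
  simp only [Triangulation.normalJump, Pi.add_apply, inner_add_left, Finset.sum_add_distrib]

theorem normalJump_smul (c : ℝ) (t : M.Cell → Pt d → Pt d) (x : Pt d) :
    M.normalJump (c • t) e x = c * M.normalJump t e x := by
  simp only [Triangulation.normalJump, Pi.smul_apply, inner_smul_left, conj_trivial,
    Finset.mul_sum]

end L2Trace

/-- The basic identity of discontinuous Galerkin methods: with n⁻ = −n⁺ the flux t⁺δ⁺·n⁺ + t⁻δ⁻·n⁻
separates into jump times average and average times jump. -/
theorem sum_flux_interior (hd : 1 ≤ d) (he : e ∈ M.interiorFaces) (t : M.Cell → Pt d → ℝ)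
    (δ : M.Cell → Pt d → Pt d) (x : Pt d) :
    ∑ K ∈ M.neighbours e, t K x * ⟪δ K x, outwardNormal K.1 e⟫ =
      ⟪M.jump t e x, M.avg δ e x⟫ + M.avg t e x * M.normalJump δ e x := by
  obtain ⟨K, K', -, h, -, -, hn, -⟩ := exists_pair hd he
  rw [Triangulation.jump, Triangulation.avg, Triangulation.avg, Triangulation.normalJump,
    h, h, h, h, h, hn]
  simp only [inner_add_left, inner_add_right, inner_smul_left, inner_smul_right, inner_neg_right,
    smul_neg, inner_neg_left, smul_eq_mul, conj_trivial]
  rw [real_inner_comm (δ K x), real_inner_comm (δ K' x)]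
  ring

theorem sum_flux_boundary (hd : 1 ≤ d) (he : e ∈ M.boundaryFaces) (t : M.Cell → Pt d → ℝ)
    (δ : M.Cell → Pt d → Pt d) (x : Pt d) :
    ∑ K ∈ M.neighbours e, t K x * ⟪δ K x, outwardNormal K.1 e⟫ =
      M.bdry t e x * ⟪M.bdry δ e x, M.bdryNormal e⟫ := by
  obtain ⟨K, h, -⟩ := exists_single hd he
  rw [Triangulation.bdry, Triangulation.bdry, Triangulation.bdryNormal, h, h, h, h]

theorem norm_bdryNormal (hd : 1 ≤ d) (he : e ∈ M.boundaryFaces) : ‖M.bdryNormal e‖ = 1 := by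
  obtain ⟨K, h, -, hn⟩ := exists_single hd he
  rw [Triangulation.bdryNormal, h, hn]

/-- Green's formula on all elements at once. -/
theorem broken_green (hd : 1 ≤ d) {v γ : M.Cell → Pt d → ℝ} {G τ δ : M.Cell → Pt d → Pt d}
    {H : M.Cell → Fin d → Pt d → Pt d} (hv : ∀ K : M.Cell, HasH1Trace K.1 (v K) (G K) (γ K))
    (hτ : ∀ (K : M.Cell) i, HasH1Trace K.1 (fun x => τ K x i) (H K i) (fun x => δ K x i)) :
    (M.integral fun K x => ⟪G K x, τ K x⟫) + (M.integral fun K x => v K x * ∑ i, H K i x i)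
      = ∑ e ∈ M.faces, ∫ x, ∑ K ∈ M.neighbours e,
          γ K x * ⟪δ K x, outwardNormal K.1 e⟫ ∂faceMeasure e := by
  have hγ : M.L2Trace γ := fun K e he => (hv K).2.2.2.1 e he
  have hδ : M.L2Trace δ := fun K e he => MemLp.of_eval_piLp fun i => (hτ K i).2.2.2.1 e he
  rw [Triangulation.integral, Triangulation.integral, ← Finset.sum_add_distrib,
    Finset.sum_congr rfl fun K _ => (isSimplex K).green_vector hd (hv K) (hτ K), sum_cells_faces]
  refine Finset.sum_congr rfl fun e he => ?_
  rw [integral_finsetSum _ fun K hK =>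
    (hγ.memLp he hK).integrable_mul_two ((hδ.memLp he hK).inner_const _)]

end Triangulation

/-! ### Face-wise and global liftings. -/

namespace Discretization

open Triangulation

variable {d : ℕ} {D : Discretization d} {e : Finset (Pt d)}

theorem interior_mem_faces (he : e ∈ D.interiorFaces) : e ∈ D.faces := (mem_interiorFaces.1 he).1

theorem dirichlet_mem_faces (he : e ∈ D.dirichletFaces) : e ∈ D.faces :=
  (mem_boundaryFaces.1 (D.dirichlet_subset he)).1

theorem neumann_mem_boundary (he : e ∈ D.neumannFaces) : e ∈ D.boundaryFaces := by
  classical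
  rw [neumannFaces, Finset.mem_sdiff] at he; exact he.1

theorem notMem_interior_of_dirichlet (he : e ∈ D.dirichletFaces) : e ∉ D.interiorFaces :=
  notMem_interiorFaces_of_boundary (D.dirichlet_subset he)

theorem notMem_dirichlet_of_interior (he : e ∈ D.interiorFaces) : e ∉ D.dirichletFaces :=
  fun h => notMem_interior_of_dirichlet h he

theorem notMem_of_neumann (he : e ∈ D.neumannFaces) :
    e ∉ D.interiorFaces ∧ e ∉ D.dirichletFaces := by
  refine ⟨notMem_interiorFaces_of_boundary (neumann_mem_boundary he), ?_⟩
  rw [neumannFaces, Finset.mem_sdiff] at he; exact he.2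

theorem sum_faces (hd : 1 ≤ d) (F : Finset (Pt d) → ℝ) : ∑ e ∈ D.faces, F e =
    ∑ e ∈ D.interiorFaces, F e + ∑ e ∈ D.dirichletFaces, F e + ∑ e ∈ D.neumannFaces, F e := by
  classical
  rw [faces_eq hd, Finset.sum_union, add_assoc]
  · congr 1
    rw [neumannFaces, add_comm]
    convert (Finset.sum_sdiff D.dirichlet_subset).symm
  · rw [Finset.disjoint_left]
    exact fun e h h' => notMem_interiorFaces_of_boundary h' h

theorem sum_activeFaces (F : Finset (Pt d) → ℝ) : ∑ e ∈ D.activeFaces, F e =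
    ∑ e ∈ D.interiorFaces, F e + ∑ e ∈ D.dirichletFaces, F e := by
  rw [activeFaces, Finset.sum_union]
  rw [Finset.disjoint_left]
  exact fun e h h' => notMem_interior_of_dirichlet h' h

theorem l2Trace_of_mem (hd : 1 ≤ d) {τ : D.Field} (hτ : τ ∈ D.Sigmah) : D.L2Trace τ :=
  fun K _ he => (D.isSimplex K).memLp_face hd he
    (continuous_of_mem_polyFieldSpace (mem_Sigmah.1 hτ K))

theorem l2Trace_of_mem_Vh (hd : 1 ≤ d) {v : D.Cell → Pt d → ℝ} (hv : v ∈ D.Vh) : D.L2Trace v :=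
  fun K _ he =>
    (D.isSimplex K).memLp_face hd he (contDiff_of_mem_polySpace (mem_Vh.1 hv K)).continuous

theorem l2Trace_kmul {τ : D.Field} (hτ : D.L2Trace τ) : D.L2Trace (D.kmul τ) :=
  fun K e he => (hτ K e he).const_smul (D.κ K)

theorem l2Trace_C12 {t : D.Cell → Pt d → ℝ} (ht : D.L2Trace t) (he : e ∈ D.faces) :
    MemLp (fun x => ⟪D.C12 e, D.jump t e x⟫) 2 (faceMeasure e) :=
  (ht.jump he).const_inner _

theorem linear_rFun (hd : 1 ≤ d) (he : e ∈ D.faces) {φ : Pt d → Pt d}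
    (hφ : MemLp φ 2 (faceMeasure e)) : D.LinearOnSigmah (D.rFun e φ) where
  add σ hσ τ hτ := by
    simp only [rFun, avg_add, inner_add_right]
    rw [integral_add (hφ.inner_two ((l2Trace_of_mem hd hσ).avg he))
      (hφ.inner_two ((l2Trace_of_mem hd hτ).avg he)), neg_add]
  smul c τ _ := by
    simp only [rFun, avg_smul, inner_smul_right, integral_const_mul, mul_neg]

theorem linear_lFun (hd : 1 ≤ d) (he : e ∈ D.faces) {q : Pt d → ℝ}
    (hq : MemLp q 2 (faceMeasure e)) : D.LinearOnSigmah (D.lFun e q) where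
  add σ hσ τ hτ := by
    simp only [lFun, normalJump_add, mul_add]
    rw [integral_add (hq.integrable_mul_two ((l2Trace_of_mem hd hσ).normalJump he))
      (hq.integrable_mul_two ((l2Trace_of_mem hd hτ).normalJump he)), neg_add]
  smul c τ _ := by
    simp only [lFun, normalJump_smul, mul_left_comm _ c, integral_const_mul, mul_neg]

theorem linear_rDFun (hd : 1 ≤ d) (he : e ∈ D.faces) {q : Pt d → ℝ}
    (hq : MemLp q 2 (faceMeasure e)) : D.LinearOnSigmah (D.rDFun e q) where
  add σ hσ τ hτ := by
    simp only [rDFun, bdry_add, inner_add_left, mul_add]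
    rw [integral_add (hq.integrable_mul_two ((l2Trace_of_mem hd hσ).bdry_inner he))
      (hq.integrable_mul_two ((l2Trace_of_mem hd hτ).bdry_inner he)), neg_add]
  smul c τ _ := by
    simp only [rDFun, bdry_smul, inner_smul_left, conj_trivial, mul_left_comm _ c,
      integral_const_mul, mul_neg]

theorem rE_eq (he : e ∈ D.interiorFaces) (φ : Pt d → Pt d) :
    D.rE e φ = D.represent (D.rFun e φ) := if_pos he

theorem lE_eq (he : e ∈ D.interiorFaces) (q : Pt d → ℝ) :
    D.lE e q = D.represent (D.lFun e q) := if_pos he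

theorem rDE_eq (he : e ∈ D.dirichletFaces) (q : Pt d → ℝ) :
    D.rDE e q = D.represent (D.rDFun e q) := if_pos he

theorem rE_eq_zero (he : e ∉ D.interiorFaces) (φ : Pt d → Pt d) : D.rE e φ = 0 := if_neg he

theorem lE_eq_zero (he : e ∉ D.interiorFaces) (q : Pt d → ℝ) : D.lE e q = 0 := if_neg he

theorem rDE_eq_zero (he : e ∉ D.dirichletFaces) (q : Pt d → ℝ) : D.rDE e q = 0 := if_neg he

theorem rE_mem (hd : 1 ≤ d) (he : e ∈ D.interiorFaces) {φ : Pt d → Pt d}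
    (hφ : MemLp φ 2 (faceMeasure e)) : D.rE e φ ∈ D.Sigmah := by
  rw [rE_eq he]; exact (linear_rFun hd (interior_mem_faces he) hφ).represent_mem

theorem lE_mem (hd : 1 ≤ d) (he : e ∈ D.interiorFaces) {q : Pt d → ℝ}
    (hq : MemLp q 2 (faceMeasure e)) : D.lE e q ∈ D.Sigmah := by
  rw [lE_eq he]; exact (linear_lFun hd (interior_mem_faces he) hq).represent_mem

theorem rDE_mem (hd : 1 ≤ d) (he : e ∈ D.dirichletFaces) {q : Pt d → ℝ}
    (hq : MemLp q 2 (faceMeasure e)) : D.rDE e q ∈ D.Sigmah := by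
  rw [rDE_eq he]; exact (linear_rDFun hd (dirichlet_mem_faces he) hq).represent_mem

theorem dot_rE (hd : 1 ≤ d) (he : e ∈ D.interiorFaces) {φ : Pt d → Pt d}
    (hφ : MemLp φ 2 (faceMeasure e)) {τ : D.Field} (hτ : τ ∈ D.Sigmah) :
    D.dot (D.rE e φ) τ = D.rFun e φ τ := by
  rw [rE_eq he]; exact (linear_rFun hd (interior_mem_faces he) hφ).dot_represent hτ

theorem dot_lE (hd : 1 ≤ d) (he : e ∈ D.interiorFaces) {q : Pt d → ℝ}
    (hq : MemLp q 2 (faceMeasure e)) {τ : D.Field} (hτ : τ ∈ D.Sigmah) :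
    D.dot (D.lE e q) τ = D.lFun e q τ := by
  rw [lE_eq he]; exact (linear_lFun hd (interior_mem_faces he) hq).dot_represent hτ

theorem dot_rDE (hd : 1 ≤ d) (he : e ∈ D.dirichletFaces) {q : Pt d → ℝ}
    (hq : MemLp q 2 (faceMeasure e)) {τ : D.Field} (hτ : τ ∈ D.Sigmah) :
    D.dot (D.rDE e q) τ = D.rDFun e q τ := by
  rw [rDE_eq he]; exact (linear_rDFun hd (dirichlet_mem_faces he) hq).dot_represent hτ

theorem dot_sum_left {ι : Type*} {s : Finset ι} {σ : ι → D.Field} {τ : D.Field}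
    (hσ : ∀ i ∈ s, D.L2Field (σ i)) (hτ : D.L2Field τ) :
    D.dot (∑ i ∈ s, σ i) τ = ∑ i ∈ s, D.dot (σ i) τ := by
  simp only [dot, Triangulation.integral]
  rw [Finset.sum_comm]
  refine Finset.sum_congr rfl fun K _ => ?_
  rw [← integral_finsetSum _ fun i hi => (hσ i hi K).inner_two (hτ K)]
  simp only [Finset.sum_apply, sum_inner]

/-- The sum of the face-wise liftings represents the sum of the functionals, so uniqueness
identifies it with the global lifting. -/
theorem rGlobal_eq_sum (hd : 1 ≤ d) {φ : Finset (Pt d) → Pt d → Pt d}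
    (hφ : ∀ e ∈ D.interiorFaces, MemLp (φ e) 2 (faceMeasure e)) :
    D.rGlobal φ = ∑ e ∈ D.interiorFaces, D.rE e (φ e) := by
  refine (((LinearOnSigmah.finsetSum fun e he =>
    linear_rFun hd (interior_mem_faces he) (hφ e he)).represent_iff _).1 ⟨?_, fun τ hτ => ?_⟩).symm
  · exact D.Sigmah.sum_mem fun e he => rE_mem hd he (hφ e he)
  · rw [dot_sum_left (fun e he => l2Field_of_mem (rE_mem hd he (hφ e he))) (l2Field_of_mem hτ)]
    exact Finset.sum_congr rfl fun e he => dot_rE hd he (hφ e he) hτ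

theorem lGlobal_eq_sum (hd : 1 ≤ d) {q : Finset (Pt d) → Pt d → ℝ}
    (hq : ∀ e ∈ D.interiorFaces, MemLp (q e) 2 (faceMeasure e)) :
    D.lGlobal q = ∑ e ∈ D.interiorFaces, D.lE e (q e) := by
  refine (((LinearOnSigmah.finsetSum fun e he =>
    linear_lFun hd (interior_mem_faces he) (hq e he)).represent_iff _).1 ⟨?_, fun τ hτ => ?_⟩).symm
  · exact D.Sigmah.sum_mem fun e he => lE_mem hd he (hq e he)
  · rw [dot_sum_left (fun e he => l2Field_of_mem (lE_mem hd he (hq e he))) (l2Field_of_mem hτ)]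
    exact Finset.sum_congr rfl fun e he => dot_lE hd he (hq e he) hτ

theorem rDGlobal_eq_sum (hd : 1 ≤ d) {q : Finset (Pt d) → Pt d → ℝ}
    (hq : ∀ e ∈ D.dirichletFaces, MemLp (q e) 2 (faceMeasure e)) :
    D.rDGlobal q = ∑ e ∈ D.dirichletFaces, D.rDE e (q e) := by
  refine (((LinearOnSigmah.finsetSum fun e he =>
    linear_rDFun hd (dirichlet_mem_faces he) (hq e he)).represent_iff _).1
      ⟨?_, fun τ hτ => ?_⟩).symm
  · exact D.Sigmah.sum_mem fun e he => rDE_mem hd he (hq e he)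
  · rw [dot_sum_left (fun e he => l2Field_of_mem (rDE_mem hd he (hq e he))) (l2Field_of_mem hτ)]
    exact Finset.sum_congr rfl fun e he => dot_rDE hd he (hq e he) hτ

theorem rDE_sub (hd : 1 ≤ d) (he : e ∈ D.dirichletFaces) {q q' : Pt d → ℝ}
    (hq : MemLp q 2 (faceMeasure e)) (hq' : MemLp q' 2 (faceMeasure e)) :
    D.rDE e (fun x => q x - q' x) = D.rDE e q - D.rDE e q' := by
  have h1 := rDE_mem hd he hq
  have h2 := rDE_mem hd he hq'
  refine Sigmah_ext (rDE_mem hd he (hq.sub hq')) (D.Sigmah.sub_mem h1 h2) fun τ hτ => ?_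
  rw [dot_sub_left (l2Field_of_mem h1) (l2Field_of_mem h2) (l2Field_of_mem hτ),
    dot_rDE hd he hq hτ, dot_rDE hd he hq' hτ]
  refine (dot_rDE hd he (hq.sub hq') hτ).trans ?_
  have hτe := (l2Trace_of_mem hd hτ).bdry_inner (dirichlet_mem_faces he)
  simp only [rDFun, Pi.sub_apply, sub_mul]
  rw [integral_sub (hq.integrable_mul_two hτe) (hq'.integrable_mul_two hτe)]
  ring

/-- The represented functionals are equal for every field, so no integrability is needed. This lets
a boundary condition valid almost everywhere be inserted into a lifting. -/
theorem rDE_congr (he : e ∈ D.dirichletFaces) {q q' : Pt d → ℝ} (h : q =ᵐ[faceMeasure e] q') :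
    D.rDE e q = D.rDE e q' := by
  rw [rDE_eq he, rDE_eq he]
  congr 1
  funext τ
  rw [rDFun, rDFun]
  congr 1
  exact integral_congr_ae (by filter_upwards [h] with x hx; rw [hx])

theorem faceLift_interior (he : e ∈ D.interiorFaces) (u : D.BrokenFn) :
    D.faceLift u e = D.rE e (D.jump u.tr e) + D.lE e (fun x => ⟪D.C12 e, D.jump u.tr e x⟫) := by
  rw [faceLift, rDE_eq_zero (notMem_dirichlet_of_interior he), add_zero]

theorem faceLift_dirichlet (he : e ∈ D.dirichletFaces) (u : D.BrokenFn) :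
    D.faceLift u e = D.rDE e (D.bdry u.tr e) := by
  rw [faceLift, rE_eq_zero (notMem_interior_of_dirichlet he),
    lE_eq_zero (notMem_interior_of_dirichlet he), add_zero, zero_add]

theorem faceLift_mem_interior (hd : 1 ≤ d) (he : e ∈ D.interiorFaces) {u : D.BrokenFn}
    (hu : D.L2Trace u.tr) : D.faceLift u e ∈ D.Sigmah := by
  rw [faceLift_interior he]
  exact D.Sigmah.add_mem (rE_mem hd he (hu.jump (interior_mem_faces he)))
    (lE_mem hd he (l2Trace_C12 hu (interior_mem_faces he)))

theorem faceLift_mem_dirichlet (hd : 1 ≤ d) (he : e ∈ D.dirichletFaces) {u : D.BrokenFn}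
    (hu : D.L2Trace u.tr) : D.faceLift u e ∈ D.Sigmah := by
  rw [faceLift_dirichlet he]
  exact rDE_mem hd he (hu.bdry (dirichlet_mem_faces he))

theorem faceLift_mem (hd : 1 ≤ d) (he : e ∈ D.activeFaces) {u : D.BrokenFn}
    (hu : D.L2Trace u.tr) : D.faceLift u e ∈ D.Sigmah := by
  rw [activeFaces, Finset.mem_union] at he
  exact he.elim (fun h => faceLift_mem_interior hd h hu) fun h => faceLift_mem_dirichlet hd h hu

/-- Used in both directions: with τ = κR^e of the other argument it converts a product of liftings
into integrals over e and back. -/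
theorem dot_faceLift_interior (hd : 1 ≤ d) (he : e ∈ D.interiorFaces) {u : D.BrokenFn}
    (hu : D.L2Trace u.tr) {τ : D.Field} (hτ : τ ∈ D.Sigmah) :
    D.dot (D.faceLift u e) τ = -(∫ x, ⟪D.jump u.tr e x, D.avg τ e x⟫ ∂faceMeasure e)
      - ∫ x, ⟪D.C12 e, D.jump u.tr e x⟫ * D.normalJump τ e x ∂faceMeasure e := by
  have hj := hu.jump (interior_mem_faces he)
  have hc := l2Trace_C12 hu (interior_mem_faces he)
  rw [faceLift_interior he, dot_add_left (l2Field_of_mem (rE_mem hd he hj))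
    (l2Field_of_mem (lE_mem hd he hc)) (l2Field_of_mem hτ), dot_rE hd he hj hτ, dot_lE hd he hc hτ,
    rFun, lFun, sub_eq_add_neg]

theorem dot_faceLift_dirichlet (hd : 1 ≤ d) (he : e ∈ D.dirichletFaces) {u : D.BrokenFn}
    (hu : D.L2Trace u.tr) {τ : D.Field} (hτ : τ ∈ D.Sigmah) :
    D.dot (D.faceLift u e) τ =
      -∫ x, D.bdry u.tr e x * ⟪D.bdry τ e x, D.bdryNormal e⟫ ∂faceMeasure e := by
  rw [faceLift_dirichlet he, dot_rDE hd he (hu.bdry (dirichlet_mem_faces he)) hτ, rDFun]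

theorem globalLift_eq_sum (hd : 1 ≤ d) {u : D.BrokenFn} (hu : D.L2Trace u.tr) :
    D.globalLift u = ∑ e ∈ D.activeFaces, D.faceLift u e := by
  rw [globalLift, rGlobal_eq_sum hd fun e he => hu.jump (interior_mem_faces he),
    lGlobal_eq_sum hd fun e he => l2Trace_C12 hu (interior_mem_faces he),
    rDGlobal_eq_sum hd fun e he => hu.bdry (dirichlet_mem_faces he), activeFaces, Finset.sum_union,
    Finset.sum_congr rfl fun e he => faceLift_interior he u, Finset.sum_add_distrib,
    Finset.sum_congr (s₁ := D.dirichletFaces) rfl fun e he => faceLift_dirichlet he u]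
  rw [Finset.disjoint_left]
  exact fun e h h' => notMem_interior_of_dirichlet h' h

end Discretization

/-! ### Broken functions with square integrable traces. -/

namespace Triangulation

variable {d : ℕ} {M : Triangulation d} {e : Finset (Pt d)}

/-- The traces of a broken function and of its gradient are square integrable. -/
structure BrokenFn.IsL2 (u : M.BrokenFn) : Prop where
  tr : M.L2Trace u.tr
  gradTr : M.L2Trace u.gradTr

theorem BrokenFn.IsH2.isL2 {u : M.BrokenFn} (hu : u.IsH2) : u.IsL2 where
  tr K e he := (hu K).1.2.2.2.1 e he
  gradTr K e he := MemLp.of_eval_piLp fun i => by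
    obtain ⟨H, hH⟩ := (hu K).2 i
    exact hH.2.2.2.1 e he

/-- With a single neighbour the jump is the outward flux, so interior and boundary faces can be
treated in one sum over all faces. -/
theorem normalJump_boundary (hd : 1 ≤ d) (he : e ∈ M.boundaryFaces) (δ : M.Cell → Pt d → Pt d)
    (x : Pt d) : M.normalJump δ e x = ⟪M.bdry δ e x, M.bdryNormal e⟫ := by
  obtain ⟨K, h, -⟩ := exists_single hd he
  rw [Triangulation.bdry, Triangulation.bdryNormal, Triangulation.normalJump, h, h, h]

theorem jump_boundary (hd : 1 ≤ d) (he : e ∈ M.boundaryFaces) (t : M.Cell → Pt d → ℝ)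
    (x : Pt d) : M.jump t e x = M.bdry t e x • M.bdryNormal e := by
  obtain ⟨K, h, -⟩ := exists_single hd he
  rw [Triangulation.bdry, Triangulation.bdryNormal, Triangulation.jump, h, h, h]

theorem sum_inner_normal (t : M.Cell → Pt d → ℝ) (s : Pt d) (x : Pt d) :
    ∑ K ∈ M.neighbours e, ⟪s, outwardNormal K.1 e⟫ * t K x = ⟪s, M.jump t e x⟫ := by
  rw [Triangulation.jump, inner_sum]
  exact Finset.sum_congr rfl fun K _ => by rw [inner_smul_right, mul_comm]

end Triangulation

theorem _root_.MeasureTheory.MemLp.smul_const_two {X : Type*} [MeasurableSpace X] {μ : Measure X}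
    {d : ℕ} {f : X → ℝ} (hf : MemLp f 2 μ) (c : Pt d) : MemLp (fun x => f x • c) 2 μ := by
  have h := (ContinuousLinearMap.toSpanSingleton ℝ c).comp_memLp' hf
  simpa [Function.comp_def, ContinuousLinearMap.toSpanSingleton_apply] using h

/-- Testing on each element separately is the same as testing on all elements together. -/
theorem forall_cells_iff {ι X : Type*} [Fintype ι] [AddCommGroup X] [Module ℝ X]
    (W : Submodule ℝ X) (E : ι → X → ℝ) (h0 : ∀ K, E K 0 = 0) :
    (∀ K, ∀ w ∈ W, E K w = 0) ↔ ∀ T : ι → X, (∀ K, T K ∈ W) → ∑ K, E K (T K) = 0 := by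
  classical
  constructor
  · exact fun h T hT => Finset.sum_eq_zero fun K _ => h K _ (hT K)
  · intro h K w hw
    have := h (Pi.single K w) fun K' => by
      by_cases hK : K' = K
      · subst hK; simpa using hw
      · rw [Pi.single_eq_of_ne hK]; exact W.zero_mem
    rw [Finset.sum_eq_single K] at this
    · simpa using this
    · intro K' _ hK'; rw [Pi.single_eq_of_ne hK', h0]
    · simp

/-! ### The first equation of the scheme: elimination of the stress. -/

namespace Discretization

open Triangulation

variable {d : ℕ} {D : Discretization d} {e : Finset (Pt d)}

theorem isH2_smooth (hd : 1 ≤ d) {v : D.Cell → Pt d → ℝ} (hv : v ∈ D.Vh) :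
    (BrokenFn.smooth v : D.BrokenFn).IsH2 := fun K =>
  ⟨(D.isSimplex K).hasH1Trace_smooth hd (contDiff_of_mem_polySpace (mem_Vh.1 hv K)), fun i =>
    ⟨_, hasH1Trace_of_mem_polyFieldSpace hd (D.isSimplex K)
      (gradient_mem_polyFieldSpace (mem_Vh.1 hv K)) i⟩⟩

theorem memLp_uHat {gD : Pt d → ℝ}
    (hgD : ∀ e ∈ D.dirichletFaces, MemLp gD 2 (faceMeasure e)) {u : D.BrokenFn}
    (hu : D.L2Trace u.tr) (he : e ∈ D.faces) : MemLp (D.uHat gD u e) 2 (faceMeasure e) := by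
  unfold uHat
  split_ifs with h1 h2
  · exact (hu.avg he).sub (l2Trace_C12 hu he)
  · exact hgD e h2
  · exact hu.bdry he

/-- On a face of the wrong type a lifting is zero by definition; otherwise it is a polynomial field,
whose traces are square integrable. -/
theorem memLp_sigmaE (hd : 1 ≤ d) {gD : Pt d → ℝ}
    (hgD : ∀ e ∈ D.dirichletFaces, MemLp gD 2 (faceMeasure e)) {u : D.BrokenFn}
    (hu : u.IsL2) (he : e ∈ D.faces) : D.L2Trace (D.sigmaE gD u e) := by
  have hmem : ∀ {ρ : D.Field}, ρ ∈ D.Sigmah → D.L2Trace (D.kmul ρ) := fun h =>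
    l2Trace_of_mem hd (kmul_mem h)
  have h1 : D.rE e (D.jump u.tr e) ∈ D.Sigmah := by
    by_cases h : e ∈ D.interiorFaces
    · exact rE_mem hd h (hu.tr.jump he)
    · rw [rE_eq_zero h]; exact D.Sigmah.zero_mem
  have h2 : D.lE e (fun x => ⟪D.C12 e, D.jump u.tr e x⟫) ∈ D.Sigmah := by
    by_cases h : e ∈ D.interiorFaces
    · exact lE_mem hd h (l2Trace_C12 hu.tr he)
    · rw [lE_eq_zero h]; exact D.Sigmah.zero_mem
  have h3 : D.rDE e (fun x => gD x - D.bdry u.tr e x) ∈ D.Sigmah := by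
    by_cases h : e ∈ D.dirichletFaces
    · exact rDE_mem hd h ((hgD e h).sub (hu.tr.bdry he))
    · rw [rDE_eq_zero h]; exact D.Sigmah.zero_mem
  exact fun K e' he' => (((l2Trace_kmul hu.gradTr K e' he').add (hmem h1 K e' he')).add
    (hmem h2 K e' he')).sub (hmem h3 K e' he')

theorem memLp_sigmaHat (hd : 1 ≤ d) {gD gN : Pt d → ℝ}
    (hgD : ∀ e ∈ D.dirichletFaces, MemLp gD 2 (faceMeasure e))
    (hgN : ∀ e ∈ D.neumannFaces, MemLp gN 2 (faceMeasure e)) {u : D.BrokenFn}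
    (hu : u.IsL2) (he : e ∈ D.faces) : MemLp (D.sigmaHat gD gN u e) 2 (faceMeasure e) := by
  have hs := memLp_sigmaE hd hgD hu he
  unfold sigmaHat
  split_ifs with h1 h2
  · exact ((hs.avg he).sub ((hu.tr.jump he).const_smul D.C11)).add
      ((hs.normalJump he).smul_const_two _)
  · exact (hs.bdry he).sub
      ((((hu.tr.bdry he).sub (hgD e h2)).const_mul D.C11).smul_const_two _)
  · refine (hgN e ?_).smul_const_two _
    rw [faces_eq hd, Finset.mem_union] at he
    rw [neumannFaces, Finset.mem_sdiff]
    exact ⟨he.resolve_left h1, h2⟩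

theorem stress_mem (hd : 1 ≤ d) {gD : Pt d → ℝ}
    (hgD : ∀ e ∈ D.dirichletFaces, MemLp gD 2 (faceMeasure e)) {u : D.Cell → Pt d → ℝ}
    (hu : u ∈ D.Vh) : D.stress gD (.smooth u) ∈ D.Sigmah := by
  have ht := l2Trace_of_mem_Vh hd hu
  refine D.Sigmah.sub_mem (D.Sigmah.add_mem (D.Sigmah.add_mem (kmul_mem (gradient_mem hu))
    (kmul_mem ?_)) (kmul_mem ?_)) (kmul_mem ?_)
  · exact (LinearOnSigmah.finsetSum fun e he => linear_rFun hd (interior_mem_faces he)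
      (ht.jump (interior_mem_faces he))).represent_mem
  · exact (LinearOnSigmah.finsetSum fun e he => linear_lFun hd (interior_mem_faces he)
      (l2Trace_C12 ht (interior_mem_faces he))).represent_mem
  · exact (LinearOnSigmah.finsetSum fun e he => linear_rDFun hd (dirichlet_mem_faces he)
      ((hgD e he).sub (ht.bdry (dirichlet_mem_faces he)))).represent_mem

/-- κ is moved onto the test field, which stays in `Sigmah`, and the defining identities of the
three liftings are applied to κT. -/
theorem dot_stress (hd : 1 ≤ d) {gD : Pt d → ℝ}
    (hgD : ∀ e ∈ D.dirichletFaces, MemLp gD 2 (faceMeasure e)) {u : D.Cell → Pt d → ℝ}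
    (hu : u ∈ D.Vh) {T : D.Field} (hT : T ∈ D.Sigmah) :
    D.dot (D.stress gD (.smooth u)) T = D.dot (fun K => gradient (u K)) (D.kmul T)
      + ∑ e ∈ D.interiorFaces,
          (-(∫ x, ⟪D.jump u e x, D.avg (D.kmul T) e x⟫ ∂faceMeasure e)
            - ∫ x, ⟪D.C12 e, D.jump u e x⟫ * D.normalJump (D.kmul T) e x ∂faceMeasure e)
      + ∑ e ∈ D.dirichletFaces,
          ∫ x, (gD x - D.bdry u e x) * ⟪D.bdry (D.kmul T) e x, D.bdryNormal e⟫ ∂faceMeasure e := by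
  have ht := l2Trace_of_mem_Vh hd hu
  have hkT := kmul_mem hT
  have L1 := LinearOnSigmah.finsetSum fun e he => linear_rFun hd (interior_mem_faces he)
      (ht.jump (interior_mem_faces (D := D) he))
  have L2 := LinearOnSigmah.finsetSum fun e he => linear_lFun hd (interior_mem_faces he)
      (l2Trace_C12 ht (interior_mem_faces (D := D) he))
  have L3 := LinearOnSigmah.finsetSum fun e he => linear_rDFun hd (dirichlet_mem_faces he)
      ((hgD e he).sub (ht.bdry (dirichlet_mem_faces (D := D) he)))
  have m0 := l2Field_of_mem (kmul_mem (gradient_mem hu))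
  have m1 := l2Field_of_mem (kmul_mem L1.represent_mem)
  have m2 := l2Field_of_mem (kmul_mem L2.represent_mem)
  have m3 := l2Field_of_mem (kmul_mem L3.represent_mem)
  have mT := l2Field_of_mem hT
  have hst : D.stress gD (.smooth u) = D.kmul (fun K => gradient (u K))
      + D.kmul (D.represent fun τ => ∑ e ∈ D.interiorFaces, D.rFun e (D.jump u e) τ)
      + D.kmul (D.represent fun τ => ∑ e ∈ D.interiorFaces,
          D.lFun e (fun x => ⟪D.C12 e, D.jump u e x⟫) τ)
      - D.kmul (D.represent fun τ => ∑ e ∈ D.dirichletFaces,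
          D.rDFun e (gD - D.bdry u e) τ) := rfl
  rw [hst, dot_sub_left ((m0.add m1).add m2) m3 mT,
    dot_add_left (m0.add m1) m2 mT, dot_add_left m0 m1 mT]
  simp only [dot_kmul]
  rw [L1.dot_represent hkT, L2.dot_represent hkT, L3.dot_represent hkT, add_assoc (D.dot _ _),
    ← Finset.sum_add_distrib, sub_eq_add_neg, ← Finset.sum_neg_distrib]
  simp only [rFun, lFun, rDFun, neg_neg, Pi.sub_apply, sub_eq_add_neg]

theorem divergence_eq (τ : Pt d → Pt d) (x : Pt d) :
    divergence τ x = ∑ i, gradient (fun y => τ y i) x i := by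
  simp only [divergence, gradient_apply]

/-- The sum over all elements of the residuals of the first equation of the scheme. -/
theorem sum_residual_stress (hd : 1 ≤ d) {gD : Pt d → ℝ}
    (hgD : ∀ e ∈ D.dirichletFaces, MemLp gD 2 (faceMeasure e)) {u : D.Cell → Pt d → ℝ}
    (hu : u ∈ D.Vh) {σ T : D.Field} (hT : T ∈ D.Sigmah) :
    ∑ K : D.Cell, ((∫ x in hull K.1, ⟪σ K x, T K x⟫) -
        (-(∫ x in hull K.1, u K x * divergence (fun y => D.κ K • T K y) x)
        + ∑ e ∈ K.1.powersetCard d, ∫ x, D.uHat gD (.smooth u) e x *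
            ⟪D.κ K • T K x, outwardNormal K.1 e⟫ ∂faceMeasure e))
      = D.dot σ T - D.dot (D.stress gD (.smooth u)) T := by
  have ht := l2Trace_of_mem_Vh hd hu
  have hkT := kmul_mem hT
  have hkt := l2Trace_of_mem hd hkT
  have hgreen := broken_green (M := D.toTriangulation) hd (v := u) (γ := u)
    (G := fun K => gradient (u K)) (τ := D.kmul T) (δ := D.kmul T)
    (H := fun K i => gradient fun x => D.kmul T K x i)
    (fun K => ((isH2_smooth hd hu) K).1)
    (fun K i => hasH1Trace_of_mem_polyFieldSpace hd (D.isSimplex K) (mem_Sigmah.1 hkT K) i)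
  have hdiv : (D.integral fun K x => u K x * ∑ i, gradient (fun x => D.kmul T K x i) x i)
      = ∑ K : D.Cell, ∫ x in hull K.1, u K x * divergence (fun y => D.κ K • T K y) x := by
    simp only [Triangulation.integral, divergence_eq]
    rfl
  have hflux : ∑ K : D.Cell, ∑ e ∈ K.1.powersetCard d, ∫ x, D.uHat gD (.smooth u) e x *
            ⟪D.κ K • T K x, outwardNormal K.1 e⟫ ∂faceMeasure e
      = ∑ e ∈ D.faces, ∫ x, D.uHat gD (.smooth u) e x * D.normalJump (D.kmul T) e x
          ∂faceMeasure e := by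
    refine sum_cells_faces.trans (Finset.sum_congr rfl fun e he => ?_)
    refine (integral_finsetSum _ fun K hK =>
      (memLp_uHat hgD (u := .smooth u) ht he).integrable_mul_two
        ((hkt.memLp he hK).inner_const _)).symm.trans ?_
    refine integral_congr_ae (Eventually.of_forall fun x => ?_)
    simp only [Triangulation.normalJump, Finset.mul_sum, kmul]
  rw [Finset.sum_sub_distrib, Finset.sum_add_distrib, Finset.sum_neg_distrib, hflux, ← hdiv,
    dot_stress hd hgD hu hT]
  have hg2 : (D.integral fun K x => u K x * ∑ i, gradient (fun x => D.kmul T K x i) x i) =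
    ∑ e ∈ D.faces, (∫ x, ∑ K ∈ D.neighbours e, u K x * ⟪D.kmul T K x, outwardNormal K.1 e⟫
      ∂faceMeasure e) - D.dot (fun K => gradient (u K)) (D.kmul T) := eq_sub_of_add_eq' hgreen
  rw [hg2, sum_faces hd, sum_faces hd]
  -- The element fluxes sum to [u]·{κT} + {u}[κT]. Subtracting û[κT], with û = {u} − C₁₂·[u], leaves
  -- [u]·{κT} + C₁₂·[u][κT], the negative of the integrands of r and l.
  have hI : ∀ e ∈ D.interiorFaces, (∫ x, ∑ K ∈ D.neighbours e,
        u K x * ⟪D.kmul T K x, outwardNormal K.1 e⟫ ∂faceMeasure e) =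
      (∫ x, D.uHat gD (.smooth u) e x * D.normalJump (D.kmul T) e x ∂faceMeasure e)
      - (-(∫ x, ⟪D.jump u e x, D.avg (D.kmul T) e x⟫ ∂faceMeasure e)
          - ∫ x, ⟪D.C12 e, D.jump u e x⟫ * D.normalJump (D.kmul T) e x ∂faceMeasure e) := by
    intro e he
    have hf := interior_mem_faces he
    have i1 : Integrable (fun x => -⟪D.jump u e x, D.avg (D.kmul T) e x⟫) (faceMeasure e) :=
      ((ht.jump hf).inner_two (hkt.avg hf)).neg
    have i2 := (l2Trace_C12 ht hf).integrable_mul_two (hkt.normalJump hf)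
    have i3 := (memLp_uHat hgD (u := .smooth u) ht hf).integrable_mul_two (hkt.normalJump hf)
    have i12 : Integrable (fun x => -⟪D.jump u e x, D.avg (D.kmul T) e x⟫
        - ⟪D.C12 e, D.jump u e x⟫ * D.normalJump (D.kmul T) e x) (faceMeasure e) := i1.sub i2
    rw [← integral_neg, ← integral_sub i1 i2, ← integral_sub i3 i12]
    refine integral_congr_ae (Eventually.of_forall fun x => ?_)
    simp only [sum_flux_interior hd he, uHat, if_pos he, BrokenFn.smooth]
    ring
  -- Here û = gD, so the defect is (gD − u)κT·n, the integrand of r_D; on Neumann faces û = u leaves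
  -- no defect.
  have hD : ∀ e ∈ D.dirichletFaces, (∫ x, ∑ K ∈ D.neighbours e,
        u K x * ⟪D.kmul T K x, outwardNormal K.1 e⟫ ∂faceMeasure e) =
      (∫ x, D.uHat gD (.smooth u) e x * D.normalJump (D.kmul T) e x ∂faceMeasure e)
      - ∫ x, (gD x - D.bdry u e x) * ⟪D.bdry (D.kmul T) e x, D.bdryNormal e⟫ ∂faceMeasure e := by
    intro e he
    have hf := dirichlet_mem_faces he
    have i1 : Integrable (fun x => (gD x - D.bdry u e x) *
        ⟪D.bdry (D.kmul T) e x, D.bdryNormal e⟫) (faceMeasure e) :=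
      ((hgD e he).sub (ht.bdry hf)).integrable_mul_two (hkt.bdry_inner hf)
    have i3 := (memLp_uHat hgD (u := .smooth u) ht hf).integrable_mul_two (hkt.normalJump hf)
    rw [← integral_sub i3 i1]
    refine integral_congr_ae (Eventually.of_forall fun x => ?_)
    simp only [sum_flux_boundary hd (D.dirichlet_subset he), uHat,
      if_neg (notMem_interior_of_dirichlet he), if_pos he, normalJump_boundary hd
        (D.dirichlet_subset he), BrokenFn.smooth]
    ring
  have hN : ∀ e ∈ D.neumannFaces, (∫ x, ∑ K ∈ D.neighbours e,
        u K x * ⟪D.kmul T K x, outwardNormal K.1 e⟫ ∂faceMeasure e) =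
      (∫ x, D.uHat gD (.smooth u) e x * D.normalJump (D.kmul T) e x ∂faceMeasure e) := by
    intro e he
    refine integral_congr_ae (Eventually.of_forall fun x => ?_)
    simp only [sum_flux_boundary hd (neumann_mem_boundary he), uHat,
      if_neg (notMem_of_neumann he).1, if_neg (notMem_of_neumann he).2, normalJump_boundary hd
        (neumann_mem_boundary he), BrokenFn.smooth]
  rw [Finset.sum_congr rfl hI, Finset.sum_congr rfl hD, Finset.sum_congr rfl hN,
    Finset.sum_sub_distrib (s := D.interiorFaces), Finset.sum_sub_distrib (s := D.dirichletFaces)]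
  simp only [dot, Triangulation.integral]
  ring

end Discretization

/-! ### The second equation of the scheme: the primal form. -/

namespace Discretization

open Triangulation

variable {d : ℕ} {D : Discretization d} {e : Finset (Pt d)}

theorem kmul_add (σ τ : D.Field) : D.kmul (σ + τ) = D.kmul σ + D.kmul τ := by
  funext K x; simp only [kmul, Pi.add_apply, smul_add]

theorem sigmaE_interior (he : e ∈ D.interiorFaces) (gD : Pt d → ℝ) (u : D.BrokenFn) :
    D.sigmaE gD u e = D.kmul u.gradTr + D.kmul (D.faceLift u e) := by
  rw [sigmaE, faceLift_interior he, rDE_eq_zero (notMem_dirichlet_of_interior he), kmul_add]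
  funext K x
  simp [kmul, add_assoc]

theorem sigmaE_dirichlet (hd : 1 ≤ d) (he : e ∈ D.dirichletFaces) {gD : Pt d → ℝ}
    (hgD : MemLp gD 2 (faceMeasure e)) {u : D.BrokenFn} (hu : D.L2Trace u.tr) :
    D.sigmaE gD u e = D.kmul u.gradTr + D.kmul (D.faceLift u e)
      + (-1 : ℝ) • D.kmul (D.rDE e gD) := by
  rw [sigmaE, faceLift_dirichlet he, rDE_sub hd he hgD (hu.bdry (dirichlet_mem_faces he)),
    rE_eq_zero (notMem_interior_of_dirichlet he), lE_eq_zero (notMem_interior_of_dirichlet he)]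
  funext K x
  simp only [kmul, Pi.add_apply, Pi.sub_apply, Pi.zero_apply, smul_zero, add_zero, smul_sub,
    Pi.smul_apply]
  module

/-- The lifting inside the flux on e is κR^e(u) of that face only. Pairing it with {·} and [·] of
the jump of v is the defining identity of R^e(v), hence the single diagonal product. -/
theorem integral_flux_interior (hd : 1 ≤ d) (he : e ∈ D.interiorFaces) (gD gN : Pt d → ℝ)
    {u v : D.BrokenFn} (hu : u.IsL2) (hv : D.L2Trace v.tr) :
    ∫ x, ⟪D.sigmaHat gD gN u e x, D.jump v.tr e x⟫ ∂faceMeasure e =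
      (∫ x, ⟪D.avg (D.kmul u.gradTr) e x, D.jump v.tr e x⟫ ∂faceMeasure e)
      + (∫ x, D.normalJump (D.kmul u.gradTr) e x * ⟪D.C12 e, D.jump v.tr e x⟫ ∂faceMeasure e)
      - (∫ x, D.C11 * ⟪D.jump u.tr e x, D.jump v.tr e x⟫ ∂faceMeasure e)
      - D.dot (D.kmul (D.faceLift u e)) (D.faceLift v e) := by
  have hf := interior_mem_faces he
  have hku := l2Trace_kmul hu.gradTr
  have hkR := kmul_mem (faceLift_mem_interior hd he hu.tr)
  have htR := l2Trace_of_mem hd hkR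
  have hj := hv.jump hf
  have hc := l2Trace_C12 hv hf
  have i1 : Integrable (fun x => ⟪D.avg (D.kmul u.gradTr) e x, D.jump v.tr e x⟫)
    (faceMeasure e) := (hku.avg hf).inner_two hj
  have i2 : Integrable (fun x => D.normalJump (D.kmul u.gradTr) e x *
    ⟪D.C12 e, D.jump v.tr e x⟫) (faceMeasure e) := (hku.normalJump hf).integrable_mul_two hc
  have i3 : Integrable (fun x => D.C11 * ⟪D.jump u.tr e x, D.jump v.tr e x⟫) (faceMeasure e) :=
    ((hu.tr.jump hf).inner_two hj).const_mul _
  have i4 : Integrable (fun x => ⟪D.jump v.tr e x, D.avg (D.kmul (D.faceLift u e)) e x⟫)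
    (faceMeasure e) := hj.inner_two (htR.avg hf)
  have i5 : Integrable (fun x => ⟪D.C12 e, D.jump v.tr e x⟫ *
    D.normalJump (D.kmul (D.faceLift u e)) e x) (faceMeasure e) :=
    hc.integrable_mul_two (htR.normalJump hf)
  rw [dot_comm, dot_faceLift_interior hd he hv hkR, ← integral_add i1 i2,
    ← integral_sub (i1.fun_add i2) i3]
  have i123 : Integrable (fun x => ⟪D.avg (D.kmul u.gradTr) e x, D.jump v.tr e x⟫
    + D.normalJump (D.kmul u.gradTr) e x * ⟪D.C12 e, D.jump v.tr e x⟫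
    - D.C11 * ⟪D.jump u.tr e x, D.jump v.tr e x⟫) (faceMeasure e) := (i1.fun_add i2).sub i3
  have i45 : Integrable (fun x => ⟪D.jump v.tr e x, D.avg (D.kmul (D.faceLift u e)) e x⟫
    + ⟪D.C12 e, D.jump v.tr e x⟫ * D.normalJump (D.kmul (D.faceLift u e)) e x)
    (faceMeasure e) := i4.fun_add i5
  rw [← neg_add', ← integral_add i4 i5, sub_neg_eq_add, ← integral_add i123 i45]
  refine integral_congr_ae (Eventually.of_forall fun x => ?_)
  simp only [sigmaHat, if_pos he, sigmaE_interior he, avg_add, normalJump_add, inner_add_left,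
    inner_sub_left, inner_smul_left, conj_trivial]
  rw [real_inner_comm (D.avg (D.kmul (D.faceLift u e)) e x)]
  ring

/-- The lifting of gD − u splits by linearity: the part with u gives the diagonal product, the part
with gD belongs to the load. -/
theorem integral_flux_dirichlet (hd : 1 ≤ d) (he : e ∈ D.dirichletFaces) {gD : Pt d → ℝ}
    (hgD : MemLp gD 2 (faceMeasure e)) (gN : Pt d → ℝ)
    {u v : D.BrokenFn} (hu : u.IsL2) (hv : D.L2Trace v.tr) :
    ∫ x, ⟪D.sigmaHat gD gN u e x, D.jump v.tr e x⟫ ∂faceMeasure e =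
      (∫ x, ⟪D.bdry (D.kmul u.gradTr) e x, D.bdryNormal e⟫ * D.bdry v.tr e x ∂faceMeasure e)
      - (∫ x, D.C11 * (D.bdry u.tr e x * D.bdry v.tr e x) ∂faceMeasure e)
      - D.dot (D.kmul (D.faceLift u e)) (D.faceLift v e)
      - (∫ x, D.bdry v.tr e x * ⟪D.bdry (D.kmul (D.rDE e gD)) e x, D.bdryNormal e⟫
          ∂faceMeasure e)
      + ∫ x, D.C11 * (gD x * D.bdry v.tr e x) ∂faceMeasure e := by
  have hf := dirichlet_mem_faces he
  have hb := D.dirichlet_subset he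
  have hku := l2Trace_kmul hu.gradTr
  have hkR := kmul_mem (faceLift_mem_dirichlet hd he hu.tr)
  have htR := l2Trace_of_mem hd hkR
  have htg := l2Trace_of_mem hd (kmul_mem (rDE_mem hd he hgD))
  have hj := hv.bdry hf
  have i1 : Integrable (fun x => ⟪D.bdry (D.kmul u.gradTr) e x, D.bdryNormal e⟫ *
    D.bdry v.tr e x) (faceMeasure e) := (hku.bdry_inner hf).integrable_mul_two hj
  have i2 : Integrable (fun x => D.C11 * (D.bdry u.tr e x * D.bdry v.tr e x)) (faceMeasure e) :=
    ((hu.tr.bdry hf).integrable_mul_two hj).const_mul _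
  have i3 : Integrable (fun x => D.bdry v.tr e x *
    ⟪D.bdry (D.kmul (D.faceLift u e)) e x, D.bdryNormal e⟫) (faceMeasure e) :=
    hj.integrable_mul_two (htR.bdry_inner hf)
  have i4 : Integrable (fun x => D.bdry v.tr e x *
    ⟪D.bdry (D.kmul (D.rDE e gD)) e x, D.bdryNormal e⟫) (faceMeasure e) :=
    hj.integrable_mul_two (htg.bdry_inner hf)
  have i5 : Integrable (fun x => D.C11 * (gD x * D.bdry v.tr e x)) (faceMeasure e) :=
    (hgD.integrable_mul_two hj).const_mul _
  have i12 : Integrable (fun x => ⟪D.bdry (D.kmul u.gradTr) e x, D.bdryNormal e⟫ *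
    D.bdry v.tr e x - D.C11 * (D.bdry u.tr e x * D.bdry v.tr e x)) (faceMeasure e) := i1.sub i2
  have i123 := i12.fun_add i3
  have i1234 : Integrable (fun x => ⟪D.bdry (D.kmul u.gradTr) e x, D.bdryNormal e⟫ *
    D.bdry v.tr e x - D.C11 * (D.bdry u.tr e x * D.bdry v.tr e x)
    + D.bdry v.tr e x * ⟪D.bdry (D.kmul (D.faceLift u e)) e x, D.bdryNormal e⟫
    - D.bdry v.tr e x * ⟪D.bdry (D.kmul (D.rDE e gD)) e x, D.bdryNormal e⟫) (faceMeasure e) :=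
    i123.sub i4
  have hn : ⟪D.bdryNormal e, D.bdryNormal e⟫ = 1 := by
    rw [real_inner_self_eq_norm_sq, norm_bdryNormal hd hb, one_pow]
  rw [dot_comm, dot_faceLift_dirichlet hd he hv hkR, sub_neg_eq_add, ← integral_sub i1 i2,
    ← integral_add i12 i3, ← integral_sub i123 i4, ← integral_add i1234 i5]
  refine integral_congr_ae (Eventually.of_forall fun x => ?_)
  simp only [sigmaHat, if_neg (notMem_interior_of_dirichlet he), if_pos he,
    sigmaE_dirichlet hd he hgD hu.tr, jump_boundary hd hb, bdry_add, bdry_smul, inner_add_left,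
    inner_sub_left, inner_smul_left, inner_smul_right, conj_trivial, hn]
  ring

theorem integral_flux_neumann (hd : 1 ≤ d) (he : e ∈ D.neumannFaces) (gD gN : Pt d → ℝ)
    (u v : D.BrokenFn) :
    ∫ x, ⟪D.sigmaHat gD gN u e x, D.jump v.tr e x⟫ ∂faceMeasure e =
      ∫ x, D.bdry v.tr e x * gN x ∂faceMeasure e := by
  have hb := neumann_mem_boundary he
  have hn : ⟪D.bdryNormal e, D.bdryNormal e⟫ = 1 := by
    rw [real_inner_self_eq_norm_sq, norm_bdryNormal hd hb, one_pow]
  refine integral_congr_ae (Eventually.of_forall fun x => ?_)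
  simp only [sigmaHat, if_neg (notMem_of_neumann he).1, if_neg (notMem_of_neumann he).2,
    jump_boundary hd hb, inner_smul_left, inner_smul_right, conj_trivial, hn]
  ring

/-- The bilinear form with the face terms separated into single products. -/
theorem baseForm_eq {u v : D.BrokenFn} (hu : u.IsL2) (hv : v.IsL2) :
    D.baseForm u v = D.dot u.grad (D.kmul v.grad)
      + (∑ e ∈ D.interiorFaces,
          (-(∫ x, ⟪D.jump u.tr e x, D.avg (D.kmul v.gradTr) e x⟫ ∂faceMeasure e)
            - ∫ x, ⟪D.C12 e, D.jump u.tr e x⟫ * D.normalJump (D.kmul v.gradTr) e x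
                ∂faceMeasure e))
      - (∑ e ∈ D.interiorFaces,
          ((∫ x, ⟪D.avg (D.kmul u.gradTr) e x, D.jump v.tr e x⟫ ∂faceMeasure e)
            + ∫ x, D.normalJump (D.kmul u.gradTr) e x * ⟪D.C12 e, D.jump v.tr e x⟫
                ∂faceMeasure e))
      - (∑ e ∈ D.dirichletFaces,
          ∫ x, D.bdry u.tr e x * ⟪D.bdry (D.kmul v.gradTr) e x, D.bdryNormal e⟫ ∂faceMeasure e)
      - (∑ e ∈ D.dirichletFaces,
          ∫ x, ⟪D.bdry (D.kmul u.gradTr) e x, D.bdryNormal e⟫ * D.bdry v.tr e x ∂faceMeasure e)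
      + (∑ e ∈ D.interiorFaces, ∫ x, D.C11 * ⟪D.jump u.tr e x, D.jump v.tr e x⟫ ∂faceMeasure e)
      + (∑ e ∈ D.dirichletFaces,
          ∫ x, D.C11 * (D.bdry u.tr e x * D.bdry v.tr e x) ∂faceMeasure e) := by
  have hku := l2Trace_kmul hu.gradTr
  have hkv := l2Trace_kmul hv.gradTr
  have h0 : (D.integral fun K x => ⟪v.grad K x, D.κ K • u.grad K x⟫)
      = D.dot u.grad (D.kmul v.grad) := by
    rw [dot_comm, dot_kmul]; rfl
  have h1 : ∀ e ∈ D.interiorFaces, ∫ x, (⟪D.jump u.tr e x, D.avg (D.kmul v.gradTr) e x⟫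
        + ⟪D.avg (D.kmul u.gradTr) e x, D.jump v.tr e x⟫) ∂faceMeasure e = _ := fun e he =>
    integral_add ((hu.tr.jump (interior_mem_faces he)).inner_two (hkv.avg (interior_mem_faces he)))
      ((hku.avg (interior_mem_faces he)).inner_two (hv.tr.jump (interior_mem_faces he)))
  have h2 : ∀ e ∈ D.interiorFaces, ∫ x,
      (⟪D.C12 e, D.jump u.tr e x⟫ * D.normalJump (D.kmul v.gradTr) e x
        + D.normalJump (D.kmul u.gradTr) e x * ⟪D.C12 e, D.jump v.tr e x⟫) ∂faceMeasure e = _ :=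
    fun e he => integral_add ((l2Trace_C12 hu.tr (interior_mem_faces he)).integrable_mul_two
        (hkv.normalJump (interior_mem_faces he)))
      ((hku.normalJump (interior_mem_faces he)).integrable_mul_two
        (l2Trace_C12 hv.tr (interior_mem_faces he)))
  have h3 : ∀ e ∈ D.dirichletFaces, ∫ x,
      (⟪D.bdry (D.kmul u.gradTr) e x, D.bdryNormal e⟫ * D.bdry v.tr e x
        + D.bdry u.tr e x * ⟪D.bdry (D.kmul v.gradTr) e x, D.bdryNormal e⟫) ∂faceMeasure e = _ :=
    fun e he => integral_add ((hku.bdry_inner (dirichlet_mem_faces he)).integrable_mul_two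
        (hv.tr.bdry (dirichlet_mem_faces he)))
      ((hu.tr.bdry (dirichlet_mem_faces he)).integrable_mul_two
        (hkv.bdry_inner (dirichlet_mem_faces he)))
  rw [baseForm, h0, Finset.sum_congr rfl h1, Finset.sum_congr rfl h2, Finset.sum_congr rfl h3]
  simp only [Finset.sum_add_distrib, Finset.sum_sub_distrib, Finset.sum_neg_distrib]
  ring

theorem isL2_smooth (hd : 1 ≤ d) {v : D.Cell → Pt d → ℝ} (hv : v ∈ D.Vh) :
    (BrokenFn.smooth v : D.BrokenFn).IsL2 := (isH2_smooth hd hv).isL2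

/-- The sum over all elements of the residuals of the second equation of the scheme. -/
theorem sum_residual_load (hd : 1 ≤ d) (f : Pt d → ℝ) {gD gN : Pt d → ℝ}
    (hgD : ∀ e ∈ D.dirichletFaces, MemLp gD 2 (faceMeasure e))
    (hgN : ∀ e ∈ D.neumannFaces, MemLp gN 2 (faceMeasure e)) {u v : D.Cell → Pt d → ℝ}
    (hu : u ∈ D.Vh) (hv : v ∈ D.Vh) :
    ∑ K : D.Cell, ((∫ x in hull K.1, ⟪D.stress gD (.smooth u) K x, gradient (v K) x⟫) -
        ((∫ x in hull K.1, f x * v K x)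
        + ∑ e ∈ K.1.powersetCard d,
            ∫ x, ⟪D.sigmaHat gD gN (.smooth u) e x, outwardNormal K.1 e⟫ * v K x ∂faceMeasure e))
      = D.cdgForm (.smooth u) (.smooth v) - D.cdgLoad f gD gN (.smooth v) := by
  have lu := isL2_smooth hd hu
  have lv := isL2_smooth hd hv
  have hflux : ∑ K : D.Cell, ∑ e ∈ K.1.powersetCard d,
        ∫ x, ⟪D.sigmaHat gD gN (.smooth u) e x, outwardNormal K.1 e⟫ * v K x ∂faceMeasure e
      = ∑ e ∈ D.faces, ∫ x, ⟪D.sigmaHat gD gN (.smooth u) e x,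
          D.jump (BrokenFn.smooth v).tr e x⟫ ∂faceMeasure e := by
    refine sum_cells_faces.trans (Finset.sum_congr rfl fun e he => ?_)
    refine (integral_finsetSum _ fun K hK =>
      ((memLp_sigmaHat hd hgD hgN lu he).inner_const _).integrable_mul_two
        (lv.tr.memLp he hK)).symm.trans ?_
    exact integral_congr_ae (Eventually.of_forall fun x => sum_inner_normal v _ x)
  have hst := dot_stress hd hgD hu (gradient_mem hv)
  have hgd : ∀ e ∈ D.dirichletFaces, ∫ x, (gD x - D.bdry u e x) *
        ⟪D.bdry (D.kmul fun K => gradient (v K)) e x, D.bdryNormal e⟫ ∂faceMeasure e =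
      (∫ x, gD x * ⟪D.bdry (D.kmul fun K => gradient (v K)) e x, D.bdryNormal e⟫ ∂faceMeasure e)
      - ∫ x, D.bdry u e x * ⟪D.bdry (D.kmul fun K => gradient (v K)) e x, D.bdryNormal e⟫
          ∂faceMeasure e := by
    intro e he
    have hf := dirichlet_mem_faces he
    have hk := l2Trace_kmul lv.gradTr
    have i1 : Integrable (fun x => gD x *
        ⟪D.bdry (D.kmul fun K => gradient (v K)) e x, D.bdryNormal e⟫) (faceMeasure e) :=
      (hgD e he).integrable_mul_two (hk.bdry_inner hf)
    have i2 : Integrable (fun x => D.bdry u e x *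
        ⟪D.bdry (D.kmul fun K => gradient (v K)) e x, D.bdryNormal e⟫) (faceMeasure e) :=
      (lu.tr.bdry hf).integrable_mul_two (hk.bdry_inner hf)
    simp only [sub_mul]
    exact integral_sub i1 i2
  rw [Finset.sum_congr rfl hgd, Finset.sum_sub_distrib] at hst
  rw [Finset.sum_sub_distrib, Finset.sum_add_distrib, hflux, sum_faces hd,
    Finset.sum_congr rfl fun e he => integral_flux_interior hd he gD gN lu lv.tr,
    Finset.sum_congr (s₁ := D.dirichletFaces) rfl fun e he =>
      integral_flux_dirichlet hd he (hgD e he) gN lu lv.tr,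
    Finset.sum_congr (s₁ := D.neumannFaces) rfl fun e he => integral_flux_neumann hd he gD gN _ _,
    cdgForm, baseForm_eq lu lv, cdgLoad, sum_activeFaces]
  have hst' : ∑ K : D.Cell, ∫ x in hull K.1, ⟪D.stress gD (.smooth u) K x, gradient (v K) x⟫
      = D.dot (D.stress gD (.smooth u)) fun K => gradient (v K) := rfl
  rw [hst', hst]
  simp only [Finset.sum_add_distrib, Finset.sum_sub_distrib, Triangulation.integral,
    BrokenFn.smooth]
  ring

/-- Both families of local equations become global ones. The first is nondegenerate in σ and
determines it; only then does the second become the primal problem. -/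
theorem isCDGSolution_iff (hd : 1 ≤ d) (f : Pt d → ℝ) {gD gN : Pt d → ℝ}
    (hgD : ∀ e ∈ D.dirichletFaces, MemLp gD 2 (faceMeasure e))
    (hgN : ∀ e ∈ D.neumannFaces, MemLp gN 2 (faceMeasure e)) {u : D.Cell → Pt d → ℝ}
    (hu : u ∈ D.Vh) {σ : D.Field} (hσ : σ ∈ D.Sigmah) :
    D.IsCDGSolution f gD gN u σ ↔ σ = D.stress gD (.smooth u) ∧
      ∀ v ∈ D.Vh, D.cdgForm (.smooth u) (.smooth v) = D.cdgLoad f gD gN (.smooth v) := by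
  have h1 := forall_cells_iff (polyFieldSpace d D.p)
    (fun (K : D.Cell) τ => (∫ x in hull K.1, ⟪σ K x, τ x⟫) -
        (-(∫ x in hull K.1, u K x * divergence (fun y => D.κ K • τ y) x)
        + ∑ e ∈ K.1.powersetCard d, ∫ x, D.uHat gD (.smooth u) e x *
            ⟪D.κ K • τ x, outwardNormal K.1 e⟫ ∂faceMeasure e))
    (fun K => by simp [divergence])
  have h2 := forall_cells_iff (polySpace d D.p)
    (fun (K : D.Cell) v => (∫ x in hull K.1, ⟪σ K x, gradient v x⟫) -
        ((∫ x in hull K.1, f x * v x)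
        + ∑ e ∈ K.1.powersetCard d,
            ∫ x, ⟪D.sigmaHat gD gN (.smooth u) e x, outwardNormal K.1 e⟫ * v x ∂faceMeasure e))
    (fun K => by
      have h0 : gradient (0 : Pt d → ℝ) = 0 := by
        funext x; exact gradient_const x (0 : ℝ)
      simp [h0])
  have hs : (∀ T : D.Field, (∀ K, T K ∈ polyFieldSpace d D.p) →
      D.dot σ T - D.dot (D.stress gD (.smooth u)) T = 0) ↔ σ = D.stress gD (.smooth u) :=
    ⟨fun h => Sigmah_ext hσ (stress_mem hd hgD hu) fun τ hτ =>
      sub_eq_zero.1 (h τ (mem_Sigmah.1 hτ)), fun h T _ => by rw [h, sub_self]⟩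
  have h1' := h1.trans ((forall₂_congr fun T hT => Iff.of_eq (congrArg (· = 0)
    (sum_residual_stress hd hgD hu (mem_Sigmah.2 hT)))).trans hs)
  rw [IsCDGSolution, forall_and]
  refine (and_congr ((forall₃_congr fun _ _ _ => sub_eq_zero.symm).trans h1')
    ((forall₃_congr fun _ _ _ => sub_eq_zero.symm).trans h2)).trans (and_congr_right fun hσ' => ?_)
  -- The second equation is compared with the primal form only after σ has been replaced by the
  -- stress.
  subst hσ'
  refine forall_congr' fun v => ?_
  rw [mem_Vh]
  refine forall_congr' fun hv => ?_
  rw [sum_residual_load hd f hgD hgN hu (mem_Vh.2 hv), sub_eq_zero]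

end Discretization

/-! ### Symmetry, linearity and comparison with LDG. -/

namespace Discretization

open Triangulation

variable {d : ℕ} {D : Discretization d} {e : Finset (Pt d)}

/-- Every integrand is symmetric pointwise, so the identity holds for all broken functions without
integrability. -/
theorem cdgForm_comm (u v : D.BrokenFn) : D.cdgForm u v = D.cdgForm v u := by
  have hdot : ∀ σ τ : D.Field, D.dot (D.kmul σ) τ = D.dot (D.kmul τ) σ := fun σ τ => by
    rw [dot_kmul, dot_comm]
  have h0 : (D.integral fun K x => ⟪v.grad K x, D.κ K • u.grad K x⟫)
      = D.integral fun K x => ⟪u.grad K x, D.κ K • v.grad K x⟫ := by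
    simp only [inner_smul_right, real_inner_comm]
  have h1 : ∀ e x, ⟪D.jump u.tr e x, D.avg (D.kmul v.gradTr) e x⟫
        + ⟪D.avg (D.kmul u.gradTr) e x, D.jump v.tr e x⟫
      = ⟪D.jump v.tr e x, D.avg (D.kmul u.gradTr) e x⟫
        + ⟪D.avg (D.kmul v.gradTr) e x, D.jump u.tr e x⟫ := fun e x => by
    rw [real_inner_comm (D.avg (D.kmul v.gradTr) e x), real_inner_comm (D.jump v.tr e x), add_comm]
  have h2 : ∀ e x, ⟪D.C12 e, D.jump u.tr e x⟫ * D.normalJump (D.kmul v.gradTr) e x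
        + D.normalJump (D.kmul u.gradTr) e x * ⟪D.C12 e, D.jump v.tr e x⟫
      = ⟪D.C12 e, D.jump v.tr e x⟫ * D.normalJump (D.kmul u.gradTr) e x
        + D.normalJump (D.kmul v.gradTr) e x * ⟪D.C12 e, D.jump u.tr e x⟫ := fun e x => by ring
  have h3 : ∀ e x, ⟪D.bdry (D.kmul u.gradTr) e x, D.bdryNormal e⟫ * D.bdry v.tr e x
        + D.bdry u.tr e x * ⟪D.bdry (D.kmul v.gradTr) e x, D.bdryNormal e⟫
      = ⟪D.bdry (D.kmul v.gradTr) e x, D.bdryNormal e⟫ * D.bdry u.tr e x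
        + D.bdry v.tr e x * ⟪D.bdry (D.kmul u.gradTr) e x, D.bdryNormal e⟫ := fun e x => by ring
  have h4 : ∀ e x, ⟪D.jump u.tr e x, D.jump v.tr e x⟫ = ⟪D.jump v.tr e x, D.jump u.tr e x⟫ :=
    fun e x => real_inner_comm _ _
  have h5 : ∀ e x, D.bdry u.tr e x * D.bdry v.tr e x = D.bdry v.tr e x * D.bdry u.tr e x :=
    fun e x => mul_comm _ _
  simp only [cdgForm, baseForm, h0, h1, h2, h3, h4, h5, hdot (D.faceLift u _)]

theorem rDE_zero (hd : 1 ≤ d) (e : Finset (Pt d)) : D.rDE e 0 = 0 := by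
  by_cases he : e ∈ D.dirichletFaces
  · refine Sigmah_ext (rDE_mem hd he MemLp.zero) D.Sigmah.zero_mem fun τ hτ => ?_
    rw [dot_rDE hd he MemLp.zero hτ, rDFun, dot_zero_left]
    simp
  · exact rDE_eq_zero he 0

/-- The load functional for homogeneous boundary data. -/
theorem cdgLoad_zero (hd : 1 ≤ d) (f : Pt d → ℝ) (v : D.BrokenFn) :
    D.cdgLoad f 0 0 v = D.integral fun K x => f x * v.val K x := by
  have h : ∀ e x, D.bdry (D.kmul (D.rDE e 0)) e x = 0 := fun e x => by
    simp [rDE_zero hd, kmul, Triangulation.bdry]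
  simp [cdgLoad, h]

/-- The stress and the flux depend on `u` only, so the summed residual of the second equation is
visibly linear in the test function. This avoids proving linearity of each lifting in its data. -/
theorem isLinearMap_residual (hd : 1 ≤ d) {f gD gN : Pt d → ℝ}
    (hf : MemLp f 2 (volume.restrict D.domain))
    (hgD : ∀ e ∈ D.dirichletFaces, MemLp gD 2 (faceMeasure e))
    (hgN : ∀ e ∈ D.neumannFaces, MemLp gN 2 (faceMeasure e)) {u : D.Cell → Pt d → ℝ}
    (hu : u ∈ D.Vh) :
    IsLinearMap ℝ fun v : D.Vh =>
      D.cdgForm (.smooth u) (.smooth v) - D.cdgLoad f gD gN (.smooth v) := by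
  have hs := l2Field_of_mem (stress_mem hd hgD hu)
  have hg : ∀ v : D.Vh, D.L2Field fun K => gradient (v.1 K) := fun v =>
    l2Field_of_mem (gradient_mem v.2)
  have hdiff : ∀ (v : D.Vh) (K : D.Cell), Differentiable ℝ (v.1 K) := fun v K =>
    (contDiff_of_mem_polySpace (mem_Vh.1 v.2 K)).differentiable (by simp)
  have hv : ∀ (v : D.Vh) (K : D.Cell), MemLp (v.1 K) 2 (volume.restrict (hull K.1)) := fun v K =>
    ((isH2_smooth hd v.2) K).1.1
  have ht : ∀ v : D.Vh, D.L2Trace v.1 := fun v => l2Trace_of_mem_Vh hd v.2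
  have hσ : ∀ K : D.Cell, ∀ e ∈ K.1.powersetCard d,
      MemLp (fun x => ⟪D.sigmaHat gD gN (.smooth u) e x, outwardNormal K.1 e⟫) 2 (faceMeasure e) :=
    fun K e he => (memLp_sigmaHat hd hgD hgN (isL2_smooth hd hu)
      (mem_faces.2 ⟨K, he⟩)).inner_const _
  simp only [← fun v : D.Vh => sum_residual_load hd f hgD hgN hu v.2]
  constructor
  · intro v w
    rw [← Finset.sum_add_distrib]
    refine Finset.sum_congr rfl fun K _ => ?_
    have hgr : ∀ x, gradient ((v + w : D.Vh).1 K) x = gradient (v.1 K) x + gradient (w.1 K) x := by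
      intro x
      change gradient (v.1 K + w.1 K) x = _
      rw [gradient, fderiv_add (hdiff v K x) (hdiff w K x), map_add]; rfl
    have hadd : ∀ x, (v + w : D.Vh).1 K x = v.1 K x + w.1 K x := fun _ => rfl
    simp only [hgr, hadd, inner_add_right, mul_add]
    rw [integral_add ((hs K).inner_two (hg v K)) ((hs K).inner_two (hg w K)),
      integral_add ((memLp_of_domain hf K).integrable_mul_two (hv v K))
        ((memLp_of_domain hf K).integrable_mul_two (hv w K)),
      Finset.sum_congr rfl fun e he => integral_add ((hσ K e he).integrable_mul_two (ht v K e he))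
        ((hσ K e he).integrable_mul_two (ht w K e he)), Finset.sum_add_distrib]
    ring
  · intro c v
    rw [smul_eq_mul, Finset.mul_sum]
    refine Finset.sum_congr rfl fun K _ => ?_
    have hgr : ∀ x, gradient ((c • v : D.Vh).1 K) x = c • gradient (v.1 K) x := by
      intro x
      change gradient (c • v.1 K) x = _
      rw [gradient, fderiv_const_smul (hdiff v K x), map_smul]; rfl
    have hsmul : ∀ x, (c • v : D.Vh).1 K x = c * v.1 K x := fun _ => rfl
    simp only [hgr, hsmul, inner_smul_right, mul_left_comm _ c, integral_const_mul,
      ← Finset.mul_sum]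
    ring

/-- With zero data the load vanishes and the residual is the form, linear in its second argument;
symmetry transfers this to the first. -/
theorem isLinearMap_cdgForm (hd : 1 ≤ d) {v : D.Cell → Pt d → ℝ} (hv : v ∈ D.Vh) :
    IsLinearMap ℝ fun u : D.Vh => D.cdgForm (.smooth u) (.smooth v) := by
  have h := isLinearMap_residual (D := D) (f := 0) (gD := 0) (gN := 0) hd MemLp.zero
    (fun _ _ => MemLp.zero) (fun _ _ => MemLp.zero) hv
  simpa [cdgLoad_zero hd, Triangulation.integral, cdgForm_comm (.smooth v)] using h

/-- The load is the form with first argument 0 minus the residual at u = 0, a difference of linear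
maps. -/
theorem isLinearMap_cdgLoad (hd : 1 ≤ d) {f gD gN : Pt d → ℝ}
    (hf : MemLp f 2 (volume.restrict D.domain))
    (hgD : ∀ e ∈ D.dirichletFaces, MemLp gD 2 (faceMeasure e))
    (hgN : ∀ e ∈ D.neumannFaces, MemLp gN 2 (faceMeasure e)) :
    IsLinearMap ℝ fun v : D.Vh => D.cdgLoad f gD gN (.smooth v) := by
  have h := isLinearMap_residual hd hf hgD hgN D.Vh.zero_mem
  have h' := isLinearMap_cdgForm hd D.Vh.zero_mem
  simp only [cdgForm_comm _ (BrokenFn.smooth 0)] at h'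
  have h2 := ((h'.mk' _) - (h.mk' _)).isLinear
  have heq : (fun v : D.Vh => D.cdgLoad f gD gN (.smooth v)) = fun v : D.Vh =>
      D.cdgForm (.smooth 0) (.smooth v)
        - (D.cdgForm (.smooth 0) (.smooth v) - D.cdgLoad f gD gN (.smooth v)) := by
    funext v; ring
  rw [heq]
  exact h2

theorem dot_sum_right {ι : Type*} {s : Finset ι} {σ : ι → D.Field} {τ : D.Field}
    (hσ : ∀ i ∈ s, D.L2Field (σ i)) (hτ : D.L2Field τ) :
    D.dot τ (∑ i ∈ s, σ i) = ∑ i ∈ s, D.dot τ (σ i) := by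
  rw [dot_comm, dot_sum_left hσ hτ]
  exact Finset.sum_congr rfl fun i _ => dot_comm _ _

-- The global liftings are sums of the face liftings; expanding their product and splitting off e' =
-- e leaves the stated double sum.
open Classical in
theorem ldgForm_eq (hd : 1 ≤ d) {u v : D.BrokenFn} (hu : D.L2Trace u.tr) (hv : D.L2Trace v.tr) :
    D.ldgForm u v = D.cdgForm u v + ∑ e ∈ D.activeFaces, ∑ e' ∈ D.activeFaces.erase e,
        D.dot (D.kmul (D.faceLift u e)) (D.faceLift v e') := by
  have mu : ∀ e ∈ D.activeFaces, D.L2Field (D.faceLift u e) := fun e he =>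
    l2Field_of_mem (faceLift_mem hd he hu)
  have mv : ∀ e ∈ D.activeFaces, D.L2Field (D.faceLift v e) := fun e he =>
    l2Field_of_mem (faceLift_mem hd he hv)
  have mv' : D.L2Field (∑ e ∈ D.activeFaces, D.faceLift v e) :=
    l2Field_of_mem (D.Sigmah.sum_mem fun e he => faceLift_mem hd he hv)
  rw [ldgForm, cdgForm, add_assoc, ← Finset.sum_add_distrib, globalLift_eq_sum hd hu,
    globalLift_eq_sum hd hv, dot_kmul, dot_sum_left mu mv'.kmul]
  congr 1
  refine Finset.sum_congr rfl fun e he => ?_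
  rw [← dot_kmul, dot_sum_right mv (mu e he).kmul,
    Finset.add_sum_erase _ (fun e' => D.dot (D.kmul (D.faceLift u e)) (D.faceLift v e')) he]

open Classical in
theorem ldgLoad_eq (hd : 1 ≤ d) (f : Pt d → ℝ) {gD : Pt d → ℝ} (gN : Pt d → ℝ)
    (hgD : ∀ e ∈ D.dirichletFaces, MemLp gD 2 (faceMeasure e)) {v : D.BrokenFn} (hv : v.IsL2) :
    D.ldgLoad f gD gN v = D.cdgLoad f gD gN v
      + ∑ e ∈ D.dirichletFaces, ∑ e' ∈ D.activeFaces.erase e,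
          D.dot (D.kmul (D.rDE e gD)) (D.faceLift v e') := by
  have hρ : D.rGlobal (D.jump v.tr) + D.lGlobal (fun e' y => ⟪D.C12 e', D.jump v.tr e' y⟫)
      = ∑ e ∈ D.interiorFaces, D.faceLift v e := by
    rw [rGlobal_eq_sum hd fun e he => hv.tr.jump (interior_mem_faces he),
      lGlobal_eq_sum hd fun e he => l2Trace_C12 hv.tr (interior_mem_faces he),
      ← Finset.sum_add_distrib]
    exact Finset.sum_congr rfl fun e he => (faceLift_interior he v).symm
  have mI : ∀ e ∈ D.interiorFaces, D.L2Field (D.faceLift v e) := fun e he =>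
    l2Field_of_mem (faceLift_mem_interior hd he hv.tr)
  have mg : ∀ e ∈ D.dirichletFaces, D.L2Field (D.rDE e gD) := fun e he =>
    l2Field_of_mem (rDE_mem hd he (hgD e he))
  have mv : ∀ e ∈ D.dirichletFaces, D.L2Field (D.faceLift v e) := fun e he =>
    l2Field_of_mem (faceLift_mem_dirichlet hd he hv.tr)
  have mρ := kmul_mem (D.Sigmah.sum_mem fun e he => faceLift_mem_interior hd he hv.tr)
  have h1 : ∀ e ∈ D.dirichletFaces, ∫ x, gD x *
      ⟪D.bdry (D.kmul (v.gradTr + D.rGlobal (D.jump v.tr)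
        + D.lGlobal (fun e' y => ⟪D.C12 e', D.jump v.tr e' y⟫))) e x, D.bdryNormal e⟫ ∂faceMeasure e
      = (∫ x, gD x * ⟪D.bdry (D.kmul v.gradTr) e x, D.bdryNormal e⟫ ∂faceMeasure e)
        - ∑ e' ∈ D.interiorFaces, D.dot (D.kmul (D.rDE e gD)) (D.faceLift v e') := by
    intro e he
    have hf := dirichlet_mem_faces he
    rw [add_assoc, hρ, ← dot_sum_right mI (mg e he).kmul, dot_kmul,
      dot_rDE hd he (hgD e he) mρ, rDFun, sub_neg_eq_add, kmul_add]
    simp only [bdry_add, inner_add_left, mul_add]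
    exact integral_add
      ((hgD e he).integrable_mul_two ((l2Trace_kmul hv.gradTr).bdry_inner hf))
      ((hgD e he).integrable_mul_two ((l2Trace_of_mem hd mρ).bdry_inner hf))
  have mG := D.Sigmah.sum_mem fun e he => rDE_mem hd he (hgD e he)
  -- The trace of v on each face tests the liftings of gD from all Dirichlet faces. CDG keeps only
  -- the matching face, as computed in `h3`.
  have h2 : ∑ e ∈ D.dirichletFaces, ∫ x, D.bdry v.tr e x *
      ⟪D.bdry (D.kmul (D.rDGlobal (fun _ => gD))) e x, D.bdryNormal e⟫ ∂faceMeasure e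
      = -∑ e ∈ D.dirichletFaces, ∑ e' ∈ D.dirichletFaces,
        D.dot (D.kmul (D.rDE e gD)) (D.faceLift v e') := by
    rw [Finset.sum_comm, ← Finset.sum_neg_distrib]
    refine Finset.sum_congr rfl fun e he => ?_
    rw [rDGlobal_eq_sum hd hgD, eq_neg_iff_add_eq_zero, ← neg_eq_iff_add_eq_zero,
      ← dot_faceLift_dirichlet hd he hv.tr (kmul_mem mG), ← dot_kmul,
      dot_sum_right mg (mv e he).kmul]
    exact Finset.sum_congr rfl fun e' _ => by rw [dot_kmul, dot_comm]
  have h3 : ∀ e ∈ D.dirichletFaces, ∫ x, D.bdry v.tr e x *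
      ⟪D.bdry (D.kmul (D.rDE e gD)) e x, D.bdryNormal e⟫ ∂faceMeasure e
      = -D.dot (D.kmul (D.rDE e gD)) (D.faceLift v e) := by
    intro e he
    rw [eq_neg_iff_add_eq_zero, ← neg_eq_iff_add_eq_zero, dot_comm,
      dot_faceLift_dirichlet hd he hv.tr (kmul_mem (rDE_mem hd he (hgD e he)))]
  have h4 : ∀ e ∈ D.dirichletFaces, ∑ e' ∈ D.activeFaces.erase e,
      D.dot (D.kmul (D.rDE e gD)) (D.faceLift v e')
      = (∑ e' ∈ D.interiorFaces, D.dot (D.kmul (D.rDE e gD)) (D.faceLift v e'))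
        + (∑ e' ∈ D.dirichletFaces, D.dot (D.kmul (D.rDE e gD)) (D.faceLift v e'))
        - D.dot (D.kmul (D.rDE e gD)) (D.faceLift v e) := by
    intro e he
    rw [← sum_activeFaces fun e' => D.dot (D.kmul (D.rDE e gD)) (D.faceLift v e')]
    exact Finset.sum_erase_eq_sub (Finset.mem_union_right _ he)
  rw [ldgLoad, cdgLoad, Finset.sum_congr rfl h1, h2, Finset.sum_congr rfl h3,
    Finset.sum_congr rfl h4]
  simp only [Finset.sum_add_distrib, Finset.sum_sub_distrib, Finset.sum_neg_distrib]
  ring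

end Discretization

/-- Scaling the approximating sequence; needed to pass from the components of ∇u to those of κ∇u on
one cell. -/
theorem HasH1Trace.const_smul {d : ℕ} {K : Finset (Pt d)} {v γ : Pt d → ℝ} {G : Pt d → Pt d}
    (h : HasH1Trace K v G γ) (c : ℝ) : HasH1Trace K (c • v) (c • G) (c • γ) := by
  obtain ⟨h1, h2, h3, h4, φ, hφ, hφ1, hφ2, hφ3⟩ := h
  have key : ∀ {E : Type} [NormedAddCommGroup E] [NormedSpace ℝ E] {μ : Measure (Pt d)}
      {a : ℕ → Pt d → E} {b : Pt d → E},
      Tendsto (fun n => eLpNorm (a n - b) 2 μ) atTop (𝓝 0) →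
      Tendsto (fun n => eLpNorm (c • a n - c • b) 2 μ) atTop (𝓝 0) := by
    intro E _ _ μ a b h
    have := ENNReal.Tendsto.const_mul (a := ‖c‖ₑ) h (Or.inr enorm_ne_top)
    simpa only [← smul_sub, eLpNorm_const_smul, mul_zero] using this
  have hgr : ∀ n, gradient (c • φ n) = c • gradient (φ n) := fun n => by
    funext x
    rw [gradient, fderiv_const_smul ((hφ n).differentiable (by simp) x), map_smul]; rfl
  refine ⟨h1.const_smul c, h2.const_smul c, fun ψ hψ hc hs i => ?_, fun e he =>
    (h4 e he).const_smul c, fun n => c • φ n, fun n => (hφ n).const_smul c, key hφ1, ?_,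
    fun e he => key (hφ3 e he)⟩
  · have := h3 ψ hψ hc hs i
    simp only [Pi.smul_apply, smul_eq_mul, PiLp.smul_apply, mul_assoc, integral_const_mul, this,
      mul_neg]
  · simp only [hgr]; exact key hφ2

/-! ### Regularity of the exact solution: the equation almost everywhere and no jumps. -/

namespace Triangulation

variable {d : ℕ} {M : Triangulation d} {e : Finset (Pt d)}

theorem isFiniteMeasure_faceMeasure (hd : 1 ≤ d) (he : e ∈ M.faces) :
    IsFiniteMeasure (faceMeasure e) := by
  obtain ⟨K, hK⟩ := mem_faces.1 he
  exact (isSimplex K).isFiniteMeasure_faceMeasure hd hK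

/-- The fundamental lemma of the calculus of variations on an interior face. -/
theorem ae_eq_zero_of_forall_test (hd : 1 ≤ d) (he : e ∈ M.interiorFaces) {g : Pt d → ℝ}
    (hg : MemLp g 2 (faceMeasure e))
    (h : ∀ φ : Pt d → ℝ, ContDiff ℝ ∞ φ → HasCompactSupport φ →
      tsupport φ ⊆ M.faceNeighbourhood e → ∫ x, φ x * g x ∂faceMeasure e = 0) :
    ∀ᵐ x ∂faceMeasure e, g x = 0 := by
  have := isFiniteMeasure_faceMeasure hd (mem_interiorFaces.1 he).1
  have hz := isOpen_faceNeighbourhood (M := M) (e := e)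
    |>.ae_eq_zero_of_integral_contDiff_smul_eq_zero
      ((hg.integrable one_le_two).locallyIntegrable.locallyIntegrableOn _) h
  filter_upwards [hz, ae_mem_faceNeighbourhood hd he] with x hx hx' using hx hx'

theorem integral_face_eq_zero {φ : Pt d → ℝ} (h : ∀ x ∈ hull e, φ x = 0) (g : Pt d → ℝ) :
    ∫ x, φ x * g x ∂faceMeasure e = 0 := by
  refine integral_eq_zero_of_ae ?_
  filter_upwards [ae_faceMeasure_mem_hull e] with x hx
  rw [h x hx, zero_mul, Pi.zero_apply]

/-- The support of the test function avoids all other faces, so a global identity is localised to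
`e`. -/
theorem sum_faces_test (he : e ∈ M.faces) {φ : Pt d → ℝ}
    (hφ : tsupport φ ⊆ M.faceNeighbourhood e) (F : Finset (Pt d) → Pt d → ℝ) :
    ∑ e' ∈ M.faces, ∫ x, φ x * F e' x ∂faceMeasure e' = ∫ x, φ x * F e x ∂faceMeasure e :=
  Finset.sum_eq_single_of_mem e he fun _ he' hne => integral_face_eq_zero (fun _ hx =>
    image_eq_zero_of_notMem_tsupport fun hs => faceNeighbourhood_disjoint he' hne (hφ hs) hx) _

theorem notMem_interior_of_mem_face (he : e ∈ M.faces) {K : M.Cell} {x : Pt d} (hx : x ∈ hull e) :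
    x ∉ interior (hull K.1) := by
  intro h
  obtain ⟨K', hK'⟩ := mem_faces.1 he
  have hxK' : x ∈ hull K'.1 := hull_mono (Finset.mem_powersetCard.1 hK').1 hx
  obtain rfl := eq_of_mem_interior h hxK'
  exact (isSimplex K).hull_face_disjoint_interior hK' hx h

/-- If the broken gradient is the weak gradient on `Ω`, the function has no jumps. -/
theorem jump_eq_zero (hd : 1 ≤ d) {v γ : M.Cell → Pt d → ℝ} {G : M.Cell → Pt d → Pt d}
    (hv : ∀ K : M.Cell, HasH1Trace K.1 (v K) (G K) (γ K))
    (h : ∀ φ : Pt d → ℝ, ContDiff ℝ ∞ φ → HasCompactSupport φ → tsupport φ ⊆ M.domain →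
      ∀ i, (M.integral fun K x => v K x * gradient φ x i)
        = -M.integral fun K x => G K x i * φ x)
    (he : e ∈ M.interiorFaces) : ∀ᵐ x ∂faceMeasure e, M.jump γ e x = 0 := by
  have hf := (mem_interiorFaces.1 he).1
  have hγ : M.L2Trace γ := fun K e he => (hv K).2.2.2.1 e he
  have key : ∀ i, ∀ᵐ x ∂faceMeasure e, M.jump γ e x i = 0 := by
    intro i
    refine ae_eq_zero_of_forall_test hd he ((hγ.jump hf).eval_piLp i) fun φ hφ hc hs => ?_
    rw [← sum_faces_test hf hs fun e' x => M.jump γ e' x i]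
    have hφ' := fun K : M.Cell => (isSimplex K).hasH1Trace_smooth hd hφ
    have hgreen := Finset.sum_congr (s₁ := Finset.univ) rfl fun (K : M.Cell) _ =>
      (isSimplex K).green hd (hv K) (hφ' K) i
    have h0 := h φ hφ hc (hs.trans Set.inter_subset_left) i
    simp only [Triangulation.integral] at h0
    -- The weak gradient identity cancels the volume terms of Green's formula, so only jump terms on
    -- the faces are left, with sum zero.
    rw [Finset.sum_add_distrib, h0, add_neg_cancel, sum_cells_faces] at hgreen
    refine Eq.trans (Finset.sum_congr rfl fun e' he' => ?_) hgreen.symm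
    have hint : ∀ K ∈ M.neighbours e', Integrable
        (fun x => γ K x * φ x * outwardNormal K.1 e' i) (faceMeasure e') := fun K hK =>
      ((hγ.memLp he' hK).integrable_mul_two ((hφ' K).2.2.2.1 e'
        ((mem_neighbours_of_mem_faces he').1 hK))).mul_const _
    simp only [← integral_mul_const]
    rw [← integral_finsetSum _ hint]
    refine integral_congr_ae (Eventually.of_forall fun x => ?_)
    simp only [Triangulation.jump, WithLp.ofLp_sum, Finset.sum_apply, PiLp.smul_apply, smul_eq_mul,
      Finset.mul_sum]
    exact Finset.sum_congr rfl fun K _ => by ring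
  filter_upwards [ae_all_iff.2 key] with x hx
  ext i; exact hx i

section Flux

variable {f : Pt d → ℝ} {τ δ : M.Cell → Pt d → Pt d} {H : M.Cell → Fin d → Pt d → Pt d}

/-- Green's formula and the weak equation combined: the normal jumps balance the elementwise
residual f + div τ. Choosing where φ is supported isolates either side. -/
theorem sum_faces_normalJump (hd : 1 ≤ d) (hf : MemLp f 2 (volume.restrict M.domain))
    (hτ : ∀ (K : M.Cell) i, HasH1Trace K.1 (fun x => τ K x i) (H K i) (fun x => δ K x i))
    (h : ∀ φ : Pt d → ℝ, ContDiff ℝ ∞ φ → HasCompactSupport φ → tsupport φ ⊆ M.domain →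
      (M.integral fun K x => ⟪τ K x, gradient φ x⟫) = M.integral fun _ x => f x * φ x)
    {φ : Pt d → ℝ} (hφ : ContDiff ℝ ∞ φ) (hc : HasCompactSupport φ) (hs : tsupport φ ⊆ M.domain) :
    ∑ e ∈ M.faces, ∫ x, φ x * M.normalJump δ e x ∂faceMeasure e
      = M.integral fun K x => φ x * (f x + ∑ i, H K i x i) := by
  have hφ' := fun K : M.Cell => (isSimplex K).hasH1Trace_smooth hd hφ
  have hgreen := broken_green hd hφ' hτ
  have h0 := h φ hφ hc hs
  have h1 : (M.integral fun K x => ⟪gradient φ x, τ K x⟫)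
      = M.integral fun K x => φ x * f x := by
    simpa only [real_inner_comm, mul_comm] using h0
  simp only [Triangulation.normalJump, Finset.mul_sum]
  rw [← hgreen, h1, Triangulation.integral, Triangulation.integral, Triangulation.integral,
    ← Finset.sum_add_distrib]
  refine Finset.sum_congr rfl fun K _ => ?_
  have i2 : MemLp (fun x => ∑ i, H K i x i) 2 (volume.restrict (hull K.1)) :=
    memLp_finsetSum _ fun i _ => (hτ K i).2.1.eval_piLp i
  rw [← integral_add ((hφ' K).1.integrable_mul_two (memLp_of_domain hf K))
    ((hφ' K).1.integrable_mul_two i2)]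
  simp only [mul_add, Finset.mul_sum]

/-- The equation holds almost everywhere in each element. -/
theorem ae_eq_neg_divergence (hd : 1 ≤ d) (hf : MemLp f 2 (volume.restrict M.domain))
    (hτ : ∀ (K : M.Cell) i, HasH1Trace K.1 (fun x => τ K x i) (H K i) (fun x => δ K x i))
    (h : ∀ φ : Pt d → ℝ, ContDiff ℝ ∞ φ → HasCompactSupport φ → tsupport φ ⊆ M.domain →
      (M.integral fun K x => ⟪τ K x, gradient φ x⟫) = M.integral fun _ x => f x * φ x)
    (K : M.Cell) : ∀ᵐ x ∂volume.restrict (hull K.1), f x + ∑ i, H K i x i = 0 := by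
  have hmem : MemLp (fun x => f x + ∑ i, H K i x i) 2 (volume.restrict (hull K.1)) :=
    (memLp_of_domain hf K).add (memLp_finsetSum _ fun i _ => (hτ K i).2.1.eval_piLp i)
  have hz := isOpen_interior (s := hull K.1)
    |>.ae_eq_zero_of_integral_contDiff_smul_eq_zero
      ((hmem.integrable one_le_two).locallyIntegrable.locallyIntegrableOn _)
      fun φ hφ hc hs => ?_
  · have hae : (interior (hull K.1) : Set (Pt d)) =ᵐ[volume] hull K.1 :=
      interior_ae_eq_of_null_frontier ((convex_hull K.1).addHaar_frontier volume)
    have hin : ∀ᵐ x ∂volume.restrict (hull K.1), x ∈ interior (hull K.1) := by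
      rw [← Measure.restrict_congr_set hae]
      exact ae_restrict_mem isOpen_interior.measurableSet
    filter_upwards [hz, hin] with x hx hx' using hx hx'
  -- A test function supported in the interior of `K` sees neither faces nor other cells.
  · have hsum := sum_faces_normalJump hd hf hτ h hφ hc (hs.trans (interior_hull_subset_domain K))
    rw [Finset.sum_eq_zero fun e he => integral_face_eq_zero (fun x hx =>
      image_eq_zero_of_notMem_tsupport fun hsx => notMem_interior_of_mem_face he hx (hs hsx)) _,
      Triangulation.integral, Finset.sum_eq_single K] at hsum
    · exact hsum.symm
    · intro K' _ hne
      refine integral_eq_zero_of_ae ?_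
      filter_upwards [ae_mem_hull K'.1] with x hx
      rw [image_eq_zero_of_notMem_tsupport fun hsx => hne (eq_of_mem_interior (hs hsx) hx).symm,
        zero_mul, Pi.zero_apply]
    · simp

/-- A field whose distributional divergence is square integrable has no normal jumps. -/
theorem normalJump_eq_zero (hd : 1 ≤ d) (hf : MemLp f 2 (volume.restrict M.domain))
    (hτ : ∀ (K : M.Cell) i, HasH1Trace K.1 (fun x => τ K x i) (H K i) (fun x => δ K x i))
    (h : ∀ φ : Pt d → ℝ, ContDiff ℝ ∞ φ → HasCompactSupport φ → tsupport φ ⊆ M.domain →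
      (M.integral fun K x => ⟪τ K x, gradient φ x⟫) = M.integral fun _ x => f x * φ x)
    (he : e ∈ M.interiorFaces) : ∀ᵐ x ∂faceMeasure e, M.normalJump δ e x = 0 := by
  have hfc := (mem_interiorFaces.1 he).1
  have hδ : M.L2Trace δ := fun K e he => MemLp.of_eval_piLp fun i => (hτ K i).2.2.2.1 e he
  refine ae_eq_zero_of_forall_test hd he (hδ.normalJump hfc) fun φ hφ hc hs => ?_
  rw [← sum_faces_test hfc hs fun e' x => M.normalJump δ e' x,
    sum_faces_normalJump hd hf hτ h hφ hc (hs.trans Set.inter_subset_left)]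
  -- The residual is already known to vanish in every cell, so only the face term remains.
  refine Finset.sum_eq_zero fun K _ => integral_eq_zero_of_ae ?_
  filter_upwards [ae_eq_neg_divergence hd hf hτ h K] with x hx
  rw [hx, mul_zero, Pi.zero_apply]

end Flux

end Triangulation

/-! ### Consistency of the primal form. -/

namespace Discretization

open Triangulation

variable {d : ℕ} {D : Discretization d} {e : Finset (Pt d)}

theorem faceLift_eq_zero (hd : 1 ≤ d) (he : e ∈ D.interiorFaces) {u : D.BrokenFn}
    (hu : D.L2Trace u.tr) (h : ∀ᵐ x ∂faceMeasure e, D.jump u.tr e x = 0) :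
    D.faceLift u e = 0 := by
  refine Sigmah_ext (faceLift_mem_interior hd he hu) D.Sigmah.zero_mem fun τ hτ => ?_
  rw [dot_faceLift_interior hd he hu hτ, dot_zero_left, integral_eq_zero_of_ae,
    integral_eq_zero_of_ae]
  · simp
  · filter_upwards [h] with x hx; simp [hx]
  · filter_upwards [h] with x hx; simp [hx]

/-- The broken Green formula for v and κ∇u already gives the load up to the terms carrying the
boundary data gD. All terms of the form with the jump of u or the normal jump of κ∇u vanish, and
those on Dirichlet faces become the gD-terms after substituting u = gD. -/
theorem consistency (hd : 1 ≤ d) {f gD gN : Pt d → ℝ}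
    (hf : MemLp f 2 (volume.restrict D.domain)) {u : D.BrokenFn} (hu : u.IsH2)
    (hs : D.SolvesPoisson f gD gN u) {v : D.BrokenFn} (hv : v.IsH2) :
    D.cdgForm u v = D.cdgLoad f gD gN v := by
  obtain ⟨hpde, hD, hN⟩ := hs
  have lu := hu.isL2
  have lv := hv.isL2
  choose H hH using fun K => (hu K).2
  have hτ : ∀ (K : D.Cell) i, HasH1Trace K.1 (fun x => D.kmul u.grad K x i) (D.κ K • H K i)
      (fun x => D.kmul u.gradTr K x i) := fun K i => (hH K i).const_smul (D.κ K)
  have hflux : ∀ φ : Pt d → ℝ, ContDiff ℝ ∞ φ → HasCompactSupport φ → tsupport φ ⊆ D.domain →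
      (D.integral fun K x => ⟪D.kmul u.grad K x, gradient φ x⟫)
        = D.integral fun _ x => f x * φ x := fun φ h1 h2 h3 => (hpde φ h1 h2 h3).2
  have hjump : ∀ e ∈ D.interiorFaces, ∀ᵐ x ∂faceMeasure e, D.jump u.tr e x = 0 := fun e he =>
    jump_eq_zero hd (fun K => (hu K).1) (fun φ h1 h2 h3 => (hpde φ h1 h2 h3).1) he
  have hnj : ∀ e ∈ D.interiorFaces, ∀ᵐ x ∂faceMeasure e,
      D.normalJump (D.kmul u.gradTr) e x = 0 := fun e he =>
    normalJump_eq_zero hd hf hτ hflux he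
  have hgreen := broken_green hd (fun K => (hv K).1) hτ
  -- The volume term of Green's formula is −∫ f v, since f = −div(κ∇u) almost everywhere in each
  -- cell.
  have hload : (D.integral fun K x => v.val K x * ∑ i, (D.κ K • H K i) x i)
      = -D.integral fun K x => f x * v.val K x := by
    simp only [Triangulation.integral, ← Finset.sum_neg_distrib, ← integral_neg]
    refine Finset.sum_congr rfl fun K _ => integral_congr_ae ?_
    filter_upwards [ae_eq_neg_divergence hd hf hτ hflux K] with x hx
    rw [eq_neg_of_add_eq_zero_right hx]; ring
  have hI : ∀ e ∈ D.interiorFaces, (∫ x, ∑ K ∈ D.neighbours e,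
      v.tr K x * ⟪D.kmul u.gradTr K x, outwardNormal K.1 e⟫ ∂faceMeasure e)
      = ∫ x, ⟪D.avg (D.kmul u.gradTr) e x, D.jump v.tr e x⟫ ∂faceMeasure e := by
    intro e he
    refine integral_congr_ae ?_
    filter_upwards [hnj e he] with x hx
    rw [sum_flux_interior hd he, hx, mul_zero, add_zero, real_inner_comm]
  have hDf : ∀ e ∈ D.dirichletFaces, (∫ x, ∑ K ∈ D.neighbours e,
      v.tr K x * ⟪D.kmul u.gradTr K x, outwardNormal K.1 e⟫ ∂faceMeasure e)
      = ∫ x, ⟪D.bdry (D.kmul u.gradTr) e x, D.bdryNormal e⟫ * D.bdry v.tr e x ∂faceMeasure e := by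
    intro e he
    simp only [sum_flux_boundary hd (D.dirichlet_subset he), mul_comm]
  have hNf : ∀ e ∈ D.neumannFaces, (∫ x, ∑ K ∈ D.neighbours e,
      v.tr K x * ⟪D.kmul u.gradTr K x, outwardNormal K.1 e⟫ ∂faceMeasure e)
      = ∫ x, D.bdry v.tr e x * gN x ∂faceMeasure e := by
    intro e he
    refine integral_congr_ae ?_
    filter_upwards [hN e he] with x hx
    rw [sum_flux_boundary hd (neumann_mem_boundary he), hx]
  rw [hload, sum_faces hd, Finset.sum_congr rfl hI, Finset.sum_congr rfl hDf,
    Finset.sum_congr rfl hNf] at hgreen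
  have hdot : D.dot u.grad (D.kmul v.grad)
      = D.integral fun K x => ⟪v.grad K x, D.kmul u.grad K x⟫ := by
    rw [← dot_kmul, dot_comm]; rfl
  have z1 : ∀ e ∈ D.interiorFaces,
      (-(∫ x, ⟪D.jump u.tr e x, D.avg (D.kmul v.gradTr) e x⟫ ∂faceMeasure e)
        - ∫ x, ⟪D.C12 e, D.jump u.tr e x⟫ * D.normalJump (D.kmul v.gradTr) e x
            ∂faceMeasure e) = 0 := by
    intro e he
    rw [integral_eq_zero_of_ae, integral_eq_zero_of_ae, neg_zero, sub_zero]
    · filter_upwards [hjump e he] with x hx; simp [hx]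
    · filter_upwards [hjump e he] with x hx; simp [hx]
  have z2 : ∀ e ∈ D.interiorFaces, ∫ x, D.normalJump (D.kmul u.gradTr) e x *
      ⟪D.C12 e, D.jump v.tr e x⟫ ∂faceMeasure e = 0 := by
    intro e he
    refine integral_eq_zero_of_ae ?_
    filter_upwards [hnj e he] with x hx; simp [hx]
  have z3 : ∀ e ∈ D.interiorFaces,
      ∫ x, D.C11 * ⟪D.jump u.tr e x, D.jump v.tr e x⟫ ∂faceMeasure e = 0 := by
    intro e he
    refine integral_eq_zero_of_ae ?_
    filter_upwards [hjump e he] with x hx; simp [hx]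
  have z4 : ∀ e ∈ D.interiorFaces, D.dot (D.kmul (D.faceLift u e)) (D.faceLift v e) = 0 := by
    intro e he
    rw [dot_kmul, faceLift_eq_zero hd he lu.tr (hjump e he), dot_zero_left]
  have d1 : ∀ e ∈ D.dirichletFaces,
      ∫ x, D.bdry u.tr e x * ⟪D.bdry (D.kmul v.gradTr) e x, D.bdryNormal e⟫ ∂faceMeasure e
      = ∫ x, gD x * ⟪D.bdry (D.kmul v.gradTr) e x, D.bdryNormal e⟫ ∂faceMeasure e := by
    intro e he
    refine integral_congr_ae ?_
    filter_upwards [hD e he] with x hx; rw [hx]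
  have d2 : ∀ e ∈ D.dirichletFaces,
      ∫ x, D.C11 * (D.bdry u.tr e x * D.bdry v.tr e x) ∂faceMeasure e
      = ∫ x, D.C11 * (gD x * D.bdry v.tr e x) ∂faceMeasure e := by
    intro e he
    refine integral_congr_ae ?_
    filter_upwards [hD e he] with x hx; rw [hx]
  -- Since u = gD on e, the lifting of u there is that of gD, and the diagonal product turns into
  -- the lifting term of the load.
  have d3 : ∀ e ∈ D.dirichletFaces, D.dot (D.kmul (D.faceLift u e)) (D.faceLift v e)
      = -∫ x, D.bdry v.tr e x * ⟪D.bdry (D.kmul (D.rDE e gD)) e x, D.bdryNormal e⟫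
          ∂faceMeasure e := by
    intro e he
    rw [dot_comm, dot_faceLift_dirichlet hd he lv.tr
      (kmul_mem (faceLift_mem_dirichlet hd he lu.tr)), faceLift_dirichlet he,
      rDE_congr he (hD e he)]
  rw [cdgForm, baseForm_eq lu lv, cdgLoad, sum_activeFaces, hdot, Finset.sum_eq_zero z1,
    Finset.sum_add_distrib, Finset.sum_eq_zero z2, Finset.sum_eq_zero z3, Finset.sum_eq_zero z4,
    Finset.sum_congr rfl d1, Finset.sum_congr rfl d2, Finset.sum_congr rfl d3]
  simp only [Finset.sum_neg_distrib]
  linarith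

end Discretization

end CDG

end

open CDG in
open Classical in
theorem mainTheorem2 {d : ℕ} (hd : 1 ≤ d) (D : Discretization d)
    (f gD gN : Pt d → ℝ)
    (hf : MemLp f 2 (volume.restrict D.domain))
    (hgD : ∀ e ∈ D.dirichletFaces, MemLp gD 2 (faceMeasure e))
    (hgN : ∀ e ∈ D.neumannFaces, MemLp gN 2 (faceMeasure e)) :
    -- the face-wise liftings are well defined by their variational identities
    (∀ e ∈ D.interiorFaces, ∀ φ : Pt d → Pt d, MemLp φ 2 (faceMeasure e) → ∀ ρ : D.Field,
      (ρ ∈ D.Sigmah ∧ ∀ τ ∈ D.Sigmah, D.dot ρ τ = D.rFun e φ τ) ↔ ρ = D.rE e φ) ∧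
    (∀ e ∈ D.interiorFaces, ∀ q : Pt d → ℝ, MemLp q 2 (faceMeasure e) → ∀ ρ : D.Field,
      (ρ ∈ D.Sigmah ∧ ∀ τ ∈ D.Sigmah, D.dot ρ τ = D.lFun e q τ) ↔ ρ = D.lE e q) ∧
    (∀ e ∈ D.dirichletFaces, ∀ q : Pt d → ℝ, MemLp q 2 (faceMeasure e) → ∀ ρ : D.Field,
      (ρ ∈ D.Sigmah ∧ ∀ τ ∈ D.Sigmah, D.dot ρ τ = D.rDFun e q τ) ↔ ρ = D.rDE e q) ∧
    -- elimination of `σ`: the scheme is equivalent to the primal problem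
    (∀ u ∈ D.Vh, D.stress gD (.smooth u) ∈ D.Sigmah ∧
      ∀ σ ∈ D.Sigmah, D.IsCDGSolution f gD gN u σ ↔
        σ = D.stress gD (.smooth u) ∧
        ∀ v ∈ D.Vh, D.cdgForm (.smooth u) (.smooth v) = D.cdgLoad f gD gN (.smooth v)) ∧
    (∀ u ∈ D.Vh, (∃ σ ∈ D.Sigmah, D.IsCDGSolution f gD gN u σ) ↔
        ∀ v ∈ D.Vh, D.cdgForm (.smooth u) (.smooth v) = D.cdgLoad f gD gN (.smooth v)) ∧
    -- the forms are (bi)linear on `V_h`, and the bilinear form is symmetric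
    (∀ v ∈ D.Vh, IsLinearMap ℝ fun u : D.Vh => D.cdgForm (.smooth u) (.smooth v)) ∧
    (IsLinearMap ℝ fun v : D.Vh => D.cdgLoad f gD gN (.smooth v)) ∧
    (∀ u v : D.BrokenFn, D.cdgForm u v = D.cdgForm v u) ∧
    -- `V_h` is part of the broken space `H²(𝒯_h)`, on which the forms are also defined
    (∀ v ∈ D.Vh, (Triangulation.BrokenFn.smooth v).IsH2) ∧
    -- consistency
    (∀ u : D.BrokenFn, u.IsH2 → D.SolvesPoisson f gD gN u →
      ∀ v : D.BrokenFn, v.IsH2 → D.cdgForm u v = D.cdgLoad f gD gN v) ∧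
    -- adjoint consistency
    (∀ g : Pt d → ℝ, MemLp g 2 (volume.restrict D.domain) →
      ∀ ψ : D.BrokenFn, ψ.IsH2 → D.SolvesPoisson g 0 0 ψ →
      ∀ v : D.BrokenFn, v.IsH2 → D.cdgForm v ψ = D.integral fun K x => g x * v.val K x) ∧
    -- comparison with LDG: off-diagonal products of liftings are dropped
    (∀ u v : D.BrokenFn, u.IsH2 → v.IsH2 →
      D.ldgForm u v = D.cdgForm u v + ∑ e ∈ D.activeFaces, ∑ e' ∈ D.activeFaces.erase e,
        D.dot (D.kmul (D.faceLift u e)) (D.faceLift v e')) ∧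
    (∀ v : D.BrokenFn, v.IsH2 →
      D.ldgLoad f gD gN v = D.cdgLoad f gD gN v
        + ∑ e ∈ D.dirichletFaces, ∑ e' ∈ D.activeFaces.erase e,
          D.dot (D.kmul (D.rDE e gD)) (D.faceLift v e')) := by
  refine ⟨fun e he φ hφ ρ => ?_, fun e he q hq ρ => ?_, fun e he q hq ρ => ?_,
    fun u hu => ⟨Discretization.stress_mem hd hgD hu, fun σ hσ =>
      Discretization.isCDGSolution_iff hd f hgD hgN hu hσ⟩,
    fun u hu => ⟨?_, fun h => ⟨_, Discretization.stress_mem hd hgD hu, ?_⟩⟩,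
    fun v hv => Discretization.isLinearMap_cdgForm hd hv,
    Discretization.isLinearMap_cdgLoad hd hf hgD hgN, Discretization.cdgForm_comm,
    fun v hv => Discretization.isH2_smooth hd hv,
    fun u hu hs v hv => Discretization.consistency hd hf hu hs hv,
    fun g hg ψ hψ hs v hv => ?_,
    fun u v hu hv => Discretization.ldgForm_eq hd hu.isL2.tr hv.isL2.tr,
    fun v hv => Discretization.ldgLoad_eq hd f gN hgD hv.isL2⟩
  · rw [Discretization.rE_eq he]
    exact (Discretization.linear_rFun hd (Discretization.interior_mem_faces he) hφ).represent_iff ρ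
  · rw [Discretization.lE_eq he]
    exact (Discretization.linear_lFun hd (Discretization.interior_mem_faces he) hq).represent_iff ρ
  · rw [Discretization.rDE_eq he]
    exact (Discretization.linear_rDFun hd
      (Discretization.dirichlet_mem_faces he) hq).represent_iff ρ
  · rintro ⟨σ, hσ, h⟩
    exact ((Discretization.isCDGSolution_iff hd f hgD hgN hu hσ).1 h).2
  · exact (Discretization.isCDGSolution_iff hd f hgD hgN hu
      (Discretization.stress_mem hd hgD hu)).2 ⟨rfl, h⟩
  -- Adjoint consistency is consistency for ψ with homogeneous boundary data, read through the
  -- symmetry of the form.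
  · rw [Discretization.cdgForm_comm, Discretization.consistency hd hg hψ hs hv,
      Discretization.cdgLoad_zero hd]
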